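/- Let $\mathfrak g$ be a finite-dimensional real Lie algebra with an inner product $Q=\langle\cdot,\cdot\rangle$. Its Levi-Civita connection $\nabla$ is given by the Koszul formula $2\langle\nabla_XY,Z\rangle=\langle[X,Y],Z\rangle-\langle[Y,Z],X\rangle+\langle[Z,X],Y\rangle$, its curvature by $R(X,Y)=\nabla_X\nabla_Y-\nabla_Y\nabla_X-\nabla_{[X,Y]}$, and its Ricci operator $\mathrm{Ric}$ by $\langle\mathrm{Ric}\,Y,Z\rangle=\operatorname{tr}\bigl(X\mapsto R(X,Y)Z\bigr)$; this is the Ricci operator at the identity of the corresponding left-invariant metric on a Lie group with Lie algebra $\mathfrak g$. If $\lambda_1\le\dots\le\lambda_4$ are the eigenvalues (with multiplicity) of a symmetric operator on a 4-dimensional Euclidean space, its signature is $(\operatorname{sgn}\lambda_1,\dots,\operatorname{sgn}\lambda_4)$. The 15 possible signatures are numbered as follows: 1 $(-,-,-,-)$; 2 $(-,-,-,0)$; 3 $(-,-,-,+)$; 4 $(-,-,0,0)$; 5 $(-,-,0,+)$; 6 $(-,-,+,+)$; 7 $(-,0,0,0)$; 8 $(-,0,0,+)$; 9 $(-,0,+,+)$;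 10 $(-,+,+,+)$; 11 $(0,0,0,0)$; 12 $(0,0,0,+)$; 13 $(0,0,+,+)$; 14 $(0,+,+,+)$; 15 $(+,+,+,+)$. Mubarakzhanov's list consists of the following real Lie algebras with basis $e_1,\dots,e_4$ (brackets not determined by the given ones are zero): - $4A_1$: abelian; - $A_2\oplus 2A_1$: $[e_1,e_2]=e_2$; - $2A_2$: $[e_1,e_2]=e_2$, $[e_3,e_4]=e_4$; - $A_{3,1}\oplus A_1$: $[e_2,e_3]=e_1$; - $A_{3,2}\oplus A_1$: $[e_1,e_3]=e_1$, $[e_2,e_3]=e_1+e_2$; - $A_{3,3}\oplus A_1$: $[e_1,e_3]=e_1$, $[e_2,e_3]=e_2$; - $A_{3,4}\oplus A_1$: $[e_1,e_3]=e_1$, $[e_2,e_3]=-e_2$; - $A_{3,5}^\alpha\oplus A_1$ ($0<\alpha<1$): $[e_1,e_3]=e_1$, $[e_2,e_3]=\alpha e_2$; - $A_{3,6}\oplus A_1$: $[e_1,e_3]=-e_2$, $[e_2,e_3]=e_1$; - $A_{3,7}^\alpha\oplus A_1$ ($\alpha>0$): $[e_1,e_3]=\alpha e_1-e_2$, $[e_2,e_3]=e_1+\alpha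 e_2$; - $A_{3,8}\oplus A_1$: $[e_1,e_2]=-e_3$, $[e_3,e_1]=e_2$, $[e_2,e_3]=e_1$; - $A_{3,9}\oplus A_1$: $[e_1,e_2]=e_3$, $[e_3,e_1]=e_2$, $[e_2,e_3]=e_1$; - $A_{4,1}$: $[e_2,e_4]=e_1$, $[e_3,e_4]=e_2$; - $A_{4,2}^\alpha$ ($\alpha\ne0$): $[e_1,e_4]=\alpha e_1$, $[e_2,e_4]=e_2$, $[e_3,e_4]=e_2+e_3$; - $A_{4,3}$: $[e_1,e_4]=e_1$, $[e_3,e_4]=e_2$; - $A_{4,4}$: $[e_1,e_4]=e_1$, $[e_2,e_4]=e_1+e_2$, $[e_3,e_4]=e_2+e_3$; - $A_{4,5}^{\alpha,\beta}$ ($\alpha\beta\ne0$, $-1\le\alpha\le\beta\le1$): $[e_1,e_4]=e_1$, $[e_2,e_4]=\alpha e_2$, $[e_3,e_4]=\beta e_3$; - $A_{4,6}^{\alpha,\beta}$ ($\alpha\ne0$, $\beta\ge0$): $[e_1,e_4]=\alpha e_1$, $[e_2,e_4]=\beta e_2-e_3$, $[e_3,e_4]=e_2+\beta e_3$; - $A_{4,7}$: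 $[e_2,e_3]=e_1$, $[e_1,e_4]=2e_1$, $[e_2,e_4]=e_2$, $[e_3,e_4]=e_2+e_3$; - $A_{4,8}$: $[e_2,e_3]=e_1$, $[e_2,e_4]=e_2$, $[e_3,e_4]=-e_3$; - $A_{4,9}^\beta$ ($-1<\beta\le1$): $[e_2,e_3]=e_1$, $[e_1,e_4]=(1+\beta)e_1$, $[e_2,e_4]=e_2$, $[e_3,e_4]=\beta e_3$; - $A_{4,10}$: $[e_2,e_3]=e_1$, $[e_2,e_4]=-e_3$, $[e_3,e_4]=e_2$; - $A_{4,11}^\alpha$ ($\alpha>0$): $[e_2,e_3]=e_1$, $[e_1,e_4]=2\alpha e_1$, $[e_2,e_4]=\alpha e_2-e_3$, $[e_3,e_4]=e_2+\alpha e_3$; - $A_{4,12}$: $[e_1,e_3]=e_1$, $[e_2,e_3]=e_2$, $[e_1,e_4]=-e_2$, $[e_2,e_4]=e_1$. **Theorem.** Let $\mathfrak g$ be a unimodular Lie algebra (that is, $\operatorname{tr}\operatorname{ad}X=0$ for all $X\in\mathfrak g$) isomorphic to an algebra of this list, and let $s$ be one of the 15 signatures. Then there is an inner product on $\mathfrak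 g$ whose Ricci operator has signature $s$ if and only if the number of $s$ is given for $\mathfrak g$ in the following table (which has an entry for every unimodular algebra of the list): - $4A_1$: 11; - $A_{3,1}\oplus A_1$: 5; - $A_{3,4}\oplus A_1$: 3, 5, 6, 7; - $A_{3,6}\oplus A_1$: 3, 5, 6, 11; - $A_{3,8}\oplus A_1$: 3, 5, 6, 7; - $A_{3,9}\oplus A_1$: 3, 5, 6, 8, 9, 10, 12, 14; - $A_{4,1}$: 3, 5, 6; - $A_{4,2}^{-2}$: 3, 5, 6; - $A_{4,5}^{\alpha,-1-\alpha}$, $-1<\alpha<-\tfrac12$: 3, 5, 6, 7; - $A_{4,5}^{-1/2,-1/2}$: 5, 7; - $A_{4,6}^{-2\beta,\beta}$ ($\beta>0$): 3, 5, 6, 7; - $A_{4,8}$: 3, 5, 6; - $A_{4,10}$: 3, 5, 6. -/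

import Mathlib

noncomputable section

namespace RicciSignature

/-! ### Metric Lie algebras: Levi-Civita connection, curvature, Ricci operator -/

section Metric

variable (L : Type*) [LieRing L] [LieAlgebra ℝ L]

/-- An inner product on (the vector space underlying) a real Lie algebra. -/
structure InnerProd where
  /-- the bilinear form -/
  form : LinearMap.BilinForm ℝ L
  symm : ∀ x y, form x y = form y x
  pos : ∀ x, x ≠ 0 → 0 < form x x

/-- A Lie algebra is unimodular if all `ad X` are traceless. -/
def IsUnimodular : Prop := ∀ X : L, LinearMap.trace ℝ L (LieAlgebra.ad ℝ L X) = 0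

variable {L}

namespace InnerProd

theorem nondegenerate (Q : InnerProd L) : Q.form.Nondegenerate := by
  constructor
  · intro x hx
    by_contra h
    exact (Q.pos x h).ne' (hx x)
  · intro x hx
    by_contra h
    exact (Q.pos x h).ne' (hx x)

/-- The right-hand side of the Koszul formula for left-invariant vector fields:
`½ (⟨[X,Y],Z⟩ - ⟨[Y,Z],X⟩ + ⟨[Z,X],Y⟩)`, as a linear form in `Z` depending bilinearly
on `X` and `Y`. -/
def koszul (Q : InnerProd L) : L →ₗ[ℝ] L →ₗ[ℝ] Module.Dual ℝ L :=
  LinearMap.mk₂ ℝ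
    (fun X Y =>
      { toFun := fun Z => (1 / 2) * (Q.form ⁅X, Y⁆ Z - Q.form ⁅Y, Z⁆ X + Q.form ⁅Z, X⁆ Y)
        map_add' := by intro Z W; simp; ring
        map_smul' := by intro c Z; simp; ring })
    (by intro X X' Y; ext Z; simp; ring)
    (by intro c X Y; ext Z; simp; ring)
    (by intro X Y Y'; ext Z; simp; ring)
    (by intro c X Y; ext Z; simp; ring)

variable [FiniteDimensional ℝ L]

/-- The vector representing a linear form with respect to the inner product. -/
def sharp (Q : InnerProd L) : Module.Dual ℝ L →ₗ[ℝ] L :=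
  (LinearMap.BilinForm.toDual Q.form Q.nondegenerate).symm.toLinearMap

theorem form_sharp (Q : InnerProd L) (f : Module.Dual ℝ L) (Z : L) :
    Q.form (Q.sharp f) Z = f Z :=
  LinearMap.BilinForm.apply_toDual_symm_apply (hB := Q.nondegenerate) f Z

/-- The Levi-Civita connection on left-invariant vector fields: `Q.nabla X Y` is `∇_X Y`,
determined by the Koszul formula. -/
def nabla (Q : InnerProd L) : L →ₗ[ℝ] L →ₗ[ℝ] L :=
  Q.koszul.compr₂ Q.sharp

/-- The curvature operator `R(X,Y) = ∇_X ∇_Y - ∇_Y ∇_X - ∇_[X,Y]`. -/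
def curvature (Q : InnerProd L) (X Y : L) : L →ₗ[ℝ] L :=
  Q.nabla X ∘ₗ Q.nabla Y - Q.nabla Y ∘ₗ Q.nabla X - Q.nabla ⁅X, Y⁆

/-- The endomorphism `X ↦ R(X,Y)Z`. -/
def curvatureLeft (Q : InnerProd L) (Y Z : L) : L →ₗ[ℝ] L where
  toFun X := Q.curvature X Y Z
  map_add' X X' := by simp [curvature]; abel
  map_smul' c X := by simp [curvature, smul_sub]

/-- The Ricci form `ric(Y,Z) = tr (X ↦ R(X,Y)Z)`. -/
def ricciForm (Q : InnerProd L) : LinearMap.BilinForm ℝ L :=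
  LinearMap.mk₂ ℝ (fun Y Z => LinearMap.trace ℝ L (Q.curvatureLeft Y Z))
    (by
      intro Y Y' Z
      rw [← map_add]
      congr 1
      ext X
      simp [curvatureLeft, curvature]
      abel)
    (by
      intro c Y Z
      rw [← map_smul]
      congr 1
      ext X
      simp [curvatureLeft, curvature, smul_sub])
    (by
      intro Y Z Z'
      rw [← map_add]
      congr 1
      ext X
      simp [curvatureLeft])
    (by
      intro c Y Z
      rw [← map_smul]
      congr 1
      ext X
      simp [curvatureLeft])

/-- The Ricci operator, `⟨Ric Y, Z⟩ = ric(Y,Z)`. -/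
def ricciOperator (Q : InnerProd L) : L →ₗ[ℝ] L :=
  Q.sharp ∘ₗ Q.ricciForm

end InnerProd

/-- `s` is the signature of the operator `A`: the eigenvalues of `A`, listed with multiplicity in
non-decreasing order `l 0 ≤ l 1 ≤ …`, have the signs `s 0, s 1, …`. -/
def HasSignature [FiniteDimensional ℝ L] {n : ℕ} (A : L →ₗ[ℝ] L) (s : Fin n → SignType) : Prop :=
  ∃ l : Fin n → ℝ, Monotone l ∧
    A.charpoly = ∏ i, (Polynomial.X - Polynomial.C (l i)) ∧
    ∀ i, s i = SignType.sign (l i)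

end Metric

/-! ### Mubarakzhanov's list of four-dimensional real Lie algebras -/

/-- The entries of Mubarakzhanov's list, with their parameters. -/
inductive Mubarakzhanov : Type
  /-- `4A₁` -/
  | fourA1
  /-- `A₂ ⊕ 2A₁` -/
  | A2_2A1
  /-- `2A₂` -/
  | twoA2
  /-- `A_{3,1} ⊕ A₁` -/
  | A31_A1
  /-- `A_{3,2} ⊕ A₁` -/
  | A32_A1
  /-- `A_{3,3} ⊕ A₁` -/
  | A33_A1
  /-- `A_{3,4} ⊕ A₁` -/
  | A34_A1
  /-- `A_{3,5}^α ⊕ A₁` -/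
  | A35_A1 (α : ℝ) (hα : 0 < α ∧ α < 1)
  /-- `A_{3,6} ⊕ A₁` -/
  | A36_A1
  /-- `A_{3,7}^α ⊕ A₁` -/
  | A37_A1 (α : ℝ) (hα : 0 < α)
  /-- `A_{3,8} ⊕ A₁` -/
  | A38_A1
  /-- `A_{3,9} ⊕ A₁` -/
  | A39_A1
  /-- `A_{4,1}` -/
  | A41
  /-- `A_{4,2}^α` -/
  | A42 (α : ℝ) (hα : α ≠ 0)
  /-- `A_{4,3}` -/
  | A43
  /-- `A_{4,4}` -/
  | A44
  /-- `A_{4,5}^{α,β}` -/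
  | A45 (α β : ℝ) (h : α * β ≠ 0) (h' : -1 ≤ α ∧ α ≤ β ∧ β ≤ 1)
  /-- `A_{4,6}^{α,β}` -/
  | A46 (α β : ℝ) (hα : α ≠ 0) (hβ : 0 ≤ β)
  /-- `A_{4,7}` -/
  | A47
  /-- `A_{4,8}` -/
  | A48
  /-- `A_{4,9}^β` -/
  | A49 (β : ℝ) (hβ : -1 < β ∧ β ≤ 1)
  /-- `A_{4,10}` -/
  | A410
  /-- `A_{4,11}^α` -/
  | A411 (α : ℝ) (hα : 0 < α)
  /-- `A_{4,12}` -/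
  | A412

/-- The brackets `bij = [eᵢ, eⱼ]`, `i < j`, of the basis vectors `e₁, …, e₄` of `ℝ⁴`;
the ones that are not given are zero. -/
structure Relations where
  b12 : Fin 4 → ℝ := 0
  b13 : Fin 4 → ℝ := 0
  b14 : Fin 4 → ℝ := 0
  b23 : Fin 4 → ℝ := 0
  b24 : Fin 4 → ℝ := 0
  b34 : Fin 4 → ℝ := 0

/-- The alternating bilinear bracket on `ℝ⁴` with the given values on the basis vectors. -/
def Relations.bracket (r : Relations) (x y : Fin 4 → ℝ) : Fin 4 → ℝ :=
  (x 0 * y 1 - x 1 * y 0) • r.b12 + (x 0 * y 2 - x 2 * y 0) • r.b13 +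
  (x 0 * y 3 - x 3 * y 0) • r.b14 + (x 1 * y 2 - x 2 * y 1) • r.b23 +
  (x 1 * y 3 - x 3 * y 1) • r.b24 + (x 2 * y 3 - x 3 * y 2) • r.b34

namespace Relations

theorem bracket_add_left (r : Relations) (x y z : Fin 4 → ℝ) :
    r.bracket (x + y) z = r.bracket x z + r.bracket y z := by
  ext i
  simp [bracket]
  ring

theorem bracket_add_right (r : Relations) (x y z : Fin 4 → ℝ) :
    r.bracket x (y + z) = r.bracket x y + r.bracket x z := by
  ext i
  simp [bracket]
  ring

theorem bracket_smul_right (r : Relations) (c : ℝ) (x y : Fin 4 → ℝ) :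
    r.bracket x (c • y) = c • r.bracket x y := by
  ext i
  simp [bracket]
  ring

theorem bracket_self (r : Relations) (x : Fin 4 → ℝ) : r.bracket x x = 0 := by
  ext i
  simp [bracket]
  ring_nf

end Relations

/-- First standard basis vector. -/
def e1 : Fin 4 → ℝ := ![1, 0, 0, 0]
/-- Second standard basis vector. -/
def e2 : Fin 4 → ℝ := ![0, 1, 0, 0]
/-- Third standard basis vector. -/
def e3 : Fin 4 → ℝ := ![0, 0, 1, 0]
/-- Fourth standard basis vector. -/
def e4 : Fin 4 → ℝ := ![0, 0, 0, 1]

namespace Mubarakzhanov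

/-- The commutation relations of the list. -/
def relations : Mubarakzhanov → Relations
  | fourA1 => {}
  | A2_2A1 => { b12 := e2 }
  | twoA2 => { b12 := e2, b34 := e4 }
  | A31_A1 => { b23 := e1 }
  | A32_A1 => { b13 := e1, b23 := e1 + e2 }
  | A33_A1 => { b13 := e1, b23 := e2 }
  | A34_A1 => { b13 := e1, b23 := -e2 }
  | A35_A1 α _ => { b13 := e1, b23 := α • e2 }
  | A36_A1 => { b13 := -e2, b23 := e1 }
  | A37_A1 α _ => { b13 := α • e1 - e2, b23 := e1 + α • e2 }
  | A38_A1 => { b12 := -e3, b13 := -e2, b23 := e1 }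
  | A39_A1 => { b12 := e3, b13 := -e2, b23 := e1 }
  | A41 => { b24 := e1, b34 := e2 }
  | A42 α _ => { b14 := α • e1, b24 := e2, b34 := e2 + e3 }
  | A43 => { b14 := e1, b34 := e2 }
  | A44 => { b14 := e1, b24 := e1 + e2, b34 := e2 + e3 }
  | A45 α β _ _ => { b14 := e1, b24 := α • e2, b34 := β • e3 }
  | A46 α β _ _ => { b14 := α • e1, b24 := β • e2 - e3, b34 := e2 + β • e3 }
  | A47 => { b23 := e1, b14 := (2 : ℝ) • e1, b24 := e2, b34 := e2 + e3 }
  | A48 => { b23 := e1, b24 := e2, b34 := -e3 }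
  | A49 β _ => { b23 := e1, b14 := (1 + β) • e1, b24 := e2, b34 := β • e3 }
  | A410 => { b23 := e1, b24 := -e3, b34 := e2 }
  | A411 α _ => { b23 := e1, b14 := (2 * α) • e1, b24 := α • e2 - e3, b34 := e2 + α • e3 }
  | A412 => { b13 := e1, b23 := e2, b14 := -e2, b24 := e1 }

/-- The Lie algebra of the list: the vector space `ℝ⁴` with the bracket determined by the
commutation relations. -/
def Alg (_ : Mubarakzhanov) : Type := Fin 4 → ℝ

instance (g : Mubarakzhanov) : AddCommGroup g.Alg :=
  inferInstanceAs (AddCommGroup (Fin 4 → ℝ))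

instance (g : Mubarakzhanov) : Module ℝ g.Alg :=
  inferInstanceAs (Module ℝ (Fin 4 → ℝ))

set_option maxHeartbeats 4000000 in
theorem bracket_jacobi (g : Mubarakzhanov) (x y z : Fin 4 → ℝ) :
    g.relations.bracket x (g.relations.bracket y z) =
      g.relations.bracket (g.relations.bracket x y) z +
        g.relations.bracket y (g.relations.bracket x z) := by
  cases g <;> ext i <;> fin_cases i <;>
    simp [relations, Relations.bracket, e1, e2, e3, e4] <;> ring

instance (g : Mubarakzhanov) : LieRing g.Alg where
  bracket x y := g.relations.bracket x y
  add_lie x y z := g.relations.bracket_add_left x y z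
  lie_add x y z := g.relations.bracket_add_right x y z
  lie_self x := g.relations.bracket_self x
  leibniz_lie x y z := g.bracket_jacobi x y z

instance (g : Mubarakzhanov) : LieAlgebra ℝ g.Alg where
  lie_smul c x y := g.relations.bracket_smul_right c x y

end Mubarakzhanov

/-! ### The tables of signatures -/

/-- The fifteen possible signatures in dimension four, numbered `1, …, 15`:
item number `k + 1` is `signatureItem k`. -/
def signatureItem : Fin 15 → Fin 4 → SignType :=
  ![![-1, -1, -1, -1],
    ![-1, -1, -1, 0],
    ![-1, -1, -1, 1],
    ![-1, -1, 0, 0],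
    ![-1, -1, 0, 1],
    ![-1, -1, 1, 1],
    ![-1, 0, 0, 0],
    ![-1, 0, 0, 1],
    ![-1, 0, 1, 1],
    ![-1, 1, 1, 1],
    ![0, 0, 0, 0],
    ![0, 0, 0, 1],
    ![0, 0, 1, 1],
    ![0, 1, 1, 1],
    ![1, 1, 1, 1]]

/-- The numbers of the signatures with the entry `+` in the row of a Lie algebra in the table for
the unimodular algebras. The non-unimodular algebras have no row there; they get the value `∅`. -/
def plusEntries : Mubarakzhanov → Finset ℕ
  | .fourA1 => {11}
  | .A31_A1 => {5}
  | .A34_A1 => {3, 5, 6, 7}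
  | .A36_A1 => {3, 5, 6, 11}
  | .A38_A1 => {3, 5, 6, 7}
  | .A39_A1 => {3, 5, 6, 8, 9, 10, 12, 14}
  | .A41 => {3, 5, 6}
  | .A42 α _ => if α = -2 then {3, 5, 6} else ∅
  | .A45 α β _ _ =>
      if α = -1 / 2 ∧ β = -1 / 2 then {5, 7}
      else if -1 < α ∧ α < -1 / 2 ∧ β = -1 - α then {3, 5, 6, 7}
      else ∅
  | .A46 α β _ _ => if α = -2 * β then {3, 5, 6, 7} else ∅
  | .A48 => {3, 5, 6}
  | .A410 => {3, 5, 6}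
  | _ => ∅

end RicciSignature

end

/-! In an orthonormal frame the Ricci operator is a matrix of quadratic polynomials in the structure
constants, so the question is which structure constants occur for orthonormal frames of a given
algebra. Gram-Schmidt along an invariant flag, or diagonalization of an invariant form, brings them
to a normal form with few parameters. Conversely, declaring any basis orthonormal gives an inner
product, so a signature is realized by exhibiting a basis. The unimodular algebras fall into three
families.

Semidirect products ℝ ⋉ ℝ³, with traceless action matrix D. Here Ric = ½[D, Dᵀ] on ℝ³ and Ric f₄ =
-tr(S²) f₄, with S the symmetric part of D. The commutator is traceless, so its eigenvalues have
signs (-,-,+), (-,0,+), (-,+,+), or all vanish because D is normal. If S ≠ 0 this leaves numbers 3,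
5, 6 and 7, selected by a determinant and a norm; S = 0 gives the flat number 11. Normality is
impossible for non-diagonalizable D, and a real double eigenspace forces the determinant to vanish.

Extensions of the Heisenberg algebra (`signature_heisenbergExt`). Ric is positive on the center and
negative definite on a suitable plane, so only 3, 5 and 6 remain.

The algebras sl₂ ⊕ ℝ and su₂ ⊕ ℝ. Diagonalizing a multiple of the Killing form against the inner
product gives [fᵢ, fⱼ] = lₖ fₖ + tₖ f₄ with f₄ central (`exists_reductive_frame`). For sl₂ the lₖ do
not share a sign; Ric then has two negative eigenvalues and a positive one, apart from one
degenerate product case of type 7 (`signature_reductive_indefinite`). For su₂ they share a sign. The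
vector orthogonal to the derived algebra has Ric ≤ 0: strict inequality leaves a negative and, as t
≠ 0, a positive eigenvalue, while in the remaining cases the spectrum is explicit
(`signature_reductive_of_pos`). -/

noncomputable section

namespace RicciSignature

/-! ### Frames and structure constants -/

section Frames

variable {L : Type*} [LieRing L] [LieAlgebra ℝ L]

/-- The linear combination of a frame with the given coefficients. -/
def comb (f : Fin 4 → L) (v : Fin 4 → ℝ) : L := ∑ k, v k • f k

/-- The brackets of the members of the frame `f` are given by `r`. -/
structure HasRelations (f : Fin 4 → L) (r : Relations) : Prop where
  h12 : ⁅f 0, f 1⁆ = comb f r.b12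
  h13 : ⁅f 0, f 2⁆ = comb f r.b13
  h14 : ⁅f 0, f 3⁆ = comb f r.b14
  h23 : ⁅f 1, f 2⁆ = comb f r.b23
  h24 : ⁅f 1, f 3⁆ = comb f r.b24
  h34 : ⁅f 2, f 3⁆ = comb f r.b34

/-- The structure constants: `r.const i j k` is the `k`-th coefficient of `[fᵢ, fⱼ]`. -/
def Relations.const (r : Relations) (i j k : Fin 4) : ℝ :=
  ![![0, r.b12, r.b13, r.b14], ![-r.b12, 0, r.b23, r.b24],
    ![-r.b13, -r.b23, 0, r.b34], ![-r.b14, -r.b24, -r.b34, 0]] i j k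

theorem comb_neg (f : Fin 4 → L) (v : Fin 4 → ℝ) : comb f (-v) = -comb f v := by
  simp [comb]

theorem comb_zero (f : Fin 4 → L) : comb f 0 = 0 := by
  simp [comb]

theorem HasRelations.lie {f : Fin 4 → L} {r : Relations} (h : HasRelations f r) (i j : Fin 4) :
    ⁅f i, f j⁆ = comb f (r.const i j) := by
  have hs : ∀ i j, ⁅f i, f j⁆ = -⁅f j, f i⁆ := fun i j => (lie_skew _ _).symm
  fin_cases i <;> fin_cases j <;>
    first
      | exact (lie_self _).trans (comb_zero f).symm
      | exact h.h12
      | exact h.h13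
      | exact h.h14
      | exact h.h23
      | exact h.h24
      | exact h.h34
      | exact (hs _ _).trans ((congrArg _ h.h12).trans (comb_neg f _).symm)
      | exact (hs _ _).trans ((congrArg _ h.h13).trans (comb_neg f _).symm)
      | exact (hs _ _).trans ((congrArg _ h.h14).trans (comb_neg f _).symm)
      | exact (hs _ _).trans ((congrArg _ h.h23).trans (comb_neg f _).symm)
      | exact (hs _ _).trans ((congrArg _ h.h24).trans (comb_neg f _).symm)
      | exact (hs _ _).trans ((congrArg _ h.h34).trans (comb_neg f _).symm)

theorem repr_comb (u : Module.Basis (Fin 4) ℝ L) (v : Fin 4 → ℝ) (k : Fin 4) :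
    u.repr (comb u v) k = v k := by
  simp only [comb]
  rw [Module.Basis.repr_sum_self]

theorem trace_eq_sum_repr (u : Module.Basis (Fin 4) ℝ L) (A : L →ₗ[ℝ] L) :
    LinearMap.trace ℝ L A = ∑ i, u.repr (A (u i)) i := by
  rw [LinearMap.trace_eq_matrix_trace ℝ u, Matrix.trace]
  simp [LinearMap.toMatrix_apply]

theorem HasRelations.unimodular {u : Module.Basis (Fin 4) ℝ L} {r : Relations}
    (h : HasRelations u r) (hL : IsUnimodular L) (j : Fin 4) : ∑ i, r.const j i i = 0 := by
  have := hL (u j)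
  rw [trace_eq_sum_repr u] at this
  simpa only [LieAlgebra.ad_apply, h.lie, repr_comb] using this

end Frames

/-! ### The Ricci form in an orthonormal frame -/

section Orthonormal

variable {L : Type*} [LieRing L] [LieAlgebra ℝ L]

/-- The frame `f` is orthonormal with respect to `Q`. -/
def IsOrthonormal (Q : InnerProd L) (f : Fin 4 → L) : Prop :=
  ∀ i j, Q.form (f i) (f j) = if i = j then 1 else 0

theorem IsOrthonormal.form_comb {Q : InnerProd L} {f : Fin 4 → L} (hf : IsOrthonormal Q f)
    (v : Fin 4 → ℝ) (k : Fin 4) : Q.form (comb f v) (f k) = v k := by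
  simp [comb, hf _ _]

theorem IsOrthonormal.linearIndependent {Q : InnerProd L} {f : Fin 4 → L}
    (hf : IsOrthonormal Q f) : LinearIndependent ℝ f := by
  rw [Fintype.linearIndependent_iff]
  intro v hv k
  have := hf.form_comb v k
  rw [comb, hv] at this
  simpa using this.symm

theorem IsOrthonormal.repr {Q : InnerProd L} {f : Module.Basis (Fin 4) ℝ L}
    (hf : IsOrthonormal Q f) (x : L) (k : Fin 4) : f.repr x k = Q.form x (f k) := by
  conv_rhs => rw [← f.sum_repr x]
  exact (hf.form_comb (fun i => f.repr x i) k).symm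

/-- Christoffel symbols of an orthonormal frame: half the Koszul combination of the
structure constants. -/
def Relations.christoffel (r : Relations) (i j k : Fin 4) : ℝ :=
  (1 / 2) * (r.const i j k - r.const j k i + r.const k i j)

/-- The Ricci form in an orthonormal frame in terms of the structure constants. -/
def Relations.ric (r : Relations) (a b : Fin 4) : ℝ :=
  ∑ i, ((∑ m, r.christoffel a b m * r.christoffel i m i) -
    (∑ m, r.christoffel i b m * r.christoffel a m i) -
    ∑ m, r.const i a m * r.christoffel m b i)

variable [FiniteDimensional ℝ L]

theorem InnerProd.form_nabla (Q : InnerProd L) (x y z : L) :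
    Q.form (Q.nabla x y) z =
      (1 / 2) * (Q.form ⁅x, y⁆ z - Q.form ⁅y, z⁆ x + Q.form ⁅z, x⁆ y) :=
  Q.form_sharp _ z

theorem nabla_frame {Q : InnerProd L} {f : Module.Basis (Fin 4) ℝ L} {r : Relations}
    (hf : IsOrthonormal Q f) (hr : HasRelations f r) (i j : Fin 4) :
    Q.nabla (f i) (f j) = comb f (r.christoffel i j) := by
  apply f.repr.injective
  ext k
  rw [repr_comb, hf.repr, Q.form_nabla, hr.lie, hr.lie, hr.lie, hf.form_comb, hf.form_comb,
    hf.form_comb]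
  rfl

theorem ricciForm_frame {Q : InnerProd L} {f : Module.Basis (Fin 4) ℝ L} {r : Relations}
    (hf : IsOrthonormal Q f) (hr : HasRelations f r) (a b : Fin 4) :
    Q.ricciForm (f a) (f b) = r.ric a b := by
  have h1 : Q.ricciForm (f a) (f b) =
      LinearMap.trace ℝ L (Q.curvatureLeft (f a) (f b)) := rfl
  rw [h1, trace_eq_sum_repr f]
  unfold Relations.ric
  refine Finset.sum_congr rfl fun i _ => ?_
  have h2 : Q.curvatureLeft (f a) (f b) (f i) =
      Q.nabla (f i) (Q.nabla (f a) (f b)) - Q.nabla (f a) (Q.nabla (f i) (f b)) -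
        Q.nabla ⁅f i, f a⁆ (f b) := rfl
  rw [h2, hf.repr, nabla_frame hf hr, nabla_frame hf hr, hr.lie]
  have hc : ∀ (v : Fin 4 → ℝ) (A : L →ₗ[ℝ] L), A (comb f v) = ∑ m, v m • A (f m) := by
    intro v A
    simp [comb]
  have hc' : ∀ v : Fin 4 → ℝ, Q.nabla (comb f v) (f b) = ∑ m, v m • Q.nabla (f m) (f b) := by
    intro v
    simp [comb]
  rw [hc, hc, hc']
  simp only [nabla_frame hf hr, map_sub, map_sum, map_smul, LinearMap.sub_apply,
    LinearMap.sum_apply, LinearMap.smul_apply, hf.form_comb, smul_eq_mul]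

/-- The matrix of the Ricci operator in an orthonormal frame. -/
def Relations.ricMatrix (r : Relations) : Matrix (Fin 4) (Fin 4) ℝ :=
  Matrix.of fun i j => r.ric j i

theorem charpoly_ricciOperator {Q : InnerProd L} {f : Module.Basis (Fin 4) ℝ L} {r : Relations}
    (hf : IsOrthonormal Q f) (hr : HasRelations f r) :
    Q.ricciOperator.charpoly = r.ricMatrix.charpoly := by
  rw [← LinearMap.charpoly_toMatrix Q.ricciOperator f]
  congr 1
  ext i j
  rw [LinearMap.toMatrix_apply, hf.repr]
  have : Q.form (Q.ricciOperator (f j)) (f i) = Q.ricciForm (f j) (f i) := Q.form_sharp _ _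
  rw [this, ricciForm_frame hf hr]
  rfl

end Orthonormal

/-! ### Signatures of symmetric matrices -/

section Signature

/-- The signs of the sorted roots of the characteristic polynomial of `R` are `s`. -/
def HasMatrixSignature (R : Matrix (Fin 4) (Fin 4) ℝ) (s : Fin 4 → SignType) : Prop :=
  ∃ l : Fin 4 → ℝ, Monotone l ∧
    R.charpoly = ∏ i, (Polynomial.X - Polynomial.C (l i)) ∧ ∀ i, s i = SignType.sign (l i)

/-- From here on an inner product enters only through the structure constants of one of its
orthonormal frames. -/
theorem hasSignature_iff {L : Type*} [LieRing L] [LieAlgebra ℝ L] [FiniteDimensional ℝ L]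
    {Q : InnerProd L} {f : Module.Basis (Fin 4) ℝ L} {r : Relations}
    (hf : IsOrthonormal Q f) (hr : HasRelations f r) (s : Fin 4 → SignType) :
    HasSignature Q.ricciOperator s ↔ HasMatrixSignature r.ricMatrix s := by
  unfold HasSignature HasMatrixSignature
  rw [charpoly_ricciOperator hf hr]

theorem perm_of_prod_eq {l m : Fin 4 → ℝ}
    (h : ∏ i, (Polynomial.X - Polynomial.C (l i)) = ∏ i, (Polynomial.X - Polynomial.C (m i))) :
    (List.ofFn l).Perm (List.ofFn m) := by
  have key : ∀ k : Fin 4 → ℝ,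
      (∏ i, (Polynomial.X - Polynomial.C (k i))).roots = (List.ofFn k : Multiset ℝ) := by
    intro k
    rw [← Fin.univ_val_map]
    conv_rhs => rw [← Polynomial.roots_multiset_prod_X_sub_C (Finset.univ.val.map k)]
    rw [Multiset.map_map]
    rfl
  have := key l
  rw [h, key m] at this
  exact (Quotient.exact this).symm

theorem eq_of_prod_eq {l m : Fin 4 → ℝ} (hl : Monotone l) (hm : Monotone m)
    (h : ∏ i, (Polynomial.X - Polynomial.C (l i)) = ∏ i, (Polynomial.X - Polynomial.C (m i))) :
    l = m :=
  List.ofFn_injective ((perm_of_prod_eq h).eq_of_sortedLE hl.sortedLE_ofFn hm.sortedLE_ofFn)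

theorem prod_comp_sort (m : Fin 4 → ℝ) :
    ∏ i, (Polynomial.X - Polynomial.C ((m ∘ Tuple.sort m) i)) =
      ∏ i, (Polynomial.X - Polynomial.C (m i)) :=
  Equiv.prod_comp (Tuple.sort m) fun i => Polynomial.X - Polynomial.C (m i)

/-- The characteristic polynomial determines its sorted roots, so exhibiting one signature excludes
all others. -/
theorem HasMatrixSignature.unique {R : Matrix (Fin 4) (Fin 4) ℝ} {s t : Fin 4 → SignType}
    (hs : HasMatrixSignature R s) (ht : HasMatrixSignature R t) : s = t := by
  obtain ⟨l, hl, h1, h2⟩ := hs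
  obtain ⟨m, hm, h3, h4⟩ := ht
  have := eq_of_prod_eq hl hm (h1.symm.trans h3)
  funext i
  rw [h2, h4, this]

theorem sign_monotone : Monotone (SignType.sign : ℝ → SignType) := fun _ _ h =>
  SignType.sign.monotone h

/-- A symmetric matrix has a given signature if the roots of its characteristic polynomial,
in some order, have the given signs. -/
theorem hasMatrixSignature_of_roots {R : Matrix (Fin 4) (Fin 4) ℝ} {s : Fin 4 → SignType}
    (m : Fin 4 → ℝ) (hm : ∀ x, (R.charpoly).eval x = ∏ i, (x - m i)) (hs : Monotone s)
    (h : ∀ i, s i = SignType.sign (m i)) : HasMatrixSignature R s := by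
  refine ⟨m ∘ Tuple.sort m, Tuple.monotone_sort m, ?_, ?_⟩
  · rw [prod_comp_sort]
    refine Polynomial.funext fun x => ?_
    rw [hm, Polynomial.eval_prod]
    simp
  · have hs' : s = SignType.sign ∘ m := funext h
    have h1 : Monotone (s ∘ Tuple.sort m) := by
      rw [hs']
      exact sign_monotone.comp (Tuple.monotone_sort m)
    -- Sorting the roots also sorts their signs, and a tuple has only one monotone rearrangement.
    have h2 : s ∘ Tuple.sort m = s ∘ (Equiv.refl (Fin 4)) := Tuple.unique_monotone h1 hs
    intro i
    have := congrFun h2 i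
    simp only [Function.comp_apply, Equiv.refl_apply] at this
    rw [← this, h]
    rfl

/-- Diagonalization of a symmetric matrix whose sorted eigenvalues are `l`. -/
theorem exists_sum_squares {R : Matrix (Fin 4) (Fin 4) ℝ} (hR : R.IsSymm) {l : Fin 4 → ℝ}
    (hl : Monotone l) (h : R.charpoly = ∏ i, (Polynomial.X - Polynomial.C (l i))) :
    ∃ w : Fin 4 → Fin 4 → ℝ, ∀ v : Fin 4 → ℝ,
      v ⬝ᵥ R.mulVec v = ∑ i, l i * (w i ⬝ᵥ v) ^ 2 := by
  have hH : R.IsHermitian := by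
    rw [Matrix.IsHermitian, Matrix.conjTranspose_eq_transpose_of_trivial]
    exact hR
  have h1 := hH.charpoly_eq
  simp only [RCLike.ofReal_real_eq_id, id] at h1
  -- Two sorted root lists of the same polynomial agree, which matches `l` with the eigenvectors of
  -- the spectral theorem.
  have h2 : hH.eigenvalues ∘ Tuple.sort hH.eigenvalues = l :=
    eq_of_prod_eq (Tuple.monotone_sort _) hl ((prod_comp_sort _).trans (h1.symm.trans h))
  set σ := Tuple.sort hH.eigenvalues
  set b := hH.eigenvectorBasis
  refine ⟨fun i => (b (σ i)).ofLp, fun v => ?_⟩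
  have hdot : ∀ x y : Fin 4 → ℝ,
      inner ℝ (WithLp.toLp 2 x : EuclideanSpace ℝ (Fin 4)) (WithLp.toLp 2 y) = x ⬝ᵥ y := by
    intro x y
    simp [PiLp.inner_apply, dotProduct, mul_comm]
  have h3 := b.sum_inner_mul_inner (WithLp.toLp 2 v) (WithLp.toLp 2 (R.mulVec v))
  rw [hdot] at h3
  rw [← h3, ← Equiv.sum_comp σ]
  refine Finset.sum_congr rfl fun i _ => ?_
  have h4 : ∀ j, inner ℝ (WithLp.toLp 2 v : EuclideanSpace ℝ (Fin 4)) (b j) =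
      (b j).ofLp ⬝ᵥ v := fun j => by
    rw [dotProduct_comm]
    exact hdot v (b j).ofLp
  have h5 : ∀ j, inner ℝ (b j) (WithLp.toLp 2 (R.mulVec v) : EuclideanSpace ℝ (Fin 4)) =
      hH.eigenvalues j * ((b j).ofLp ⬝ᵥ v) := fun j => by
    have h6 : inner ℝ (b j) (WithLp.toLp 2 (R.mulVec v) : EuclideanSpace ℝ (Fin 4)) =
        (b j).ofLp ⬝ᵥ R.mulVec v := hdot (b j).ofLp _
    rw [h6, Matrix.dotProduct_mulVec, ← Matrix.mulVec_transpose, hR]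
    have h7 := hH.mulVec_eigenvectorBasis j
    rw [h7, smul_dotProduct, smul_eq_mul]
  rw [h4, h5, ← h2]
  simp only [Function.comp_apply]
  ring

/-- The sorted eigenvalues of a symmetric matrix that is positive on some vector. -/
theorem last_of_pos {R : Matrix (Fin 4) (Fin 4) ℝ} (hR : R.IsSymm) {s : Fin 4 → SignType}
    (hs : HasMatrixSignature R s) (v : Fin 4 → ℝ) (hv : 0 < v ⬝ᵥ R.mulVec v) : s 3 = 1 := by
  obtain ⟨l, hl, h, hsl⟩ := hs
  obtain ⟨w, hw⟩ := exists_sum_squares hR hl h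
  rw [hsl, sign_eq_one_iff]
  by_contra hneg
  rw [hw] at hv
  have : ∑ i, l i * (w i ⬝ᵥ v) ^ 2 ≤ 0 := by
    refine Finset.sum_nonpos fun i _ => ?_
    have h1 : l i ≤ l 3 := hl (Fin.le_last i)
    exact mul_nonpos_of_nonpos_of_nonneg (by linarith) (sq_nonneg _)
  linarith

/-- If the least eigenvalue were nonnegative, the diagonalized form would be a sum of nonnegative
terms. -/
theorem first_of_neg {R : Matrix (Fin 4) (Fin 4) ℝ} (hR : R.IsSymm) {s : Fin 4 → SignType}
    (hs : HasMatrixSignature R s) (v : Fin 4 → ℝ) (hv : v ⬝ᵥ R.mulVec v < 0) : s 0 = -1 := by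
  obtain ⟨l, hl, h, hsl⟩ := hs
  obtain ⟨w, hw⟩ := exists_sum_squares hR hl h
  rw [hsl, sign_eq_neg_one_iff]
  by_contra hneg
  rw [hw] at hv
  have : 0 ≤ ∑ i, l i * (w i ⬝ᵥ v) ^ 2 := by
    refine Finset.sum_nonneg fun i _ => ?_
    have h1 : l 0 ≤ l i := hl (Fin.zero_le i)
    exact mul_nonneg (by linarith) (sq_nonneg _)
  linarith

/-- A symmetric matrix that is negative definite on a plane has two negative eigenvalues. -/
theorem second_of_neg {R : Matrix (Fin 4) (Fin 4) ℝ} (hR : R.IsSymm) {s : Fin 4 → SignType}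
    (hs : HasMatrixSignature R s) (v v' : Fin 4 → ℝ)
    (hv : ∀ α β : ℝ, (α ≠ 0 ∨ β ≠ 0) →
      (α • v + β • v') ⬝ᵥ R.mulVec (α • v + β • v') < 0) : s 1 = -1 := by
  obtain ⟨l, hl, h, hsl⟩ := hs
  obtain ⟨w, hw⟩ := exists_sum_squares hR hl h
  rw [hsl, sign_eq_neg_one_iff]
  by_contra hneg
  -- Min-max argument: the plane contains a nonzero vector orthogonal to the lowest eigenvector, and
  -- there only eigenvalues that are at least `l 1` contribute.
  obtain ⟨α, β, hne, h0⟩ : ∃ α β : ℝ, (α ≠ 0 ∨ β ≠ 0) ∧ w 0 ⬝ᵥ (α • v + β • v') = 0 := by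
    by_cases h1 : w 0 ⬝ᵥ v = 0
    · exact ⟨1, 0, by simp, by simp [h1]⟩
    · refine ⟨w 0 ⬝ᵥ v', -(w 0 ⬝ᵥ v), Or.inr (neg_ne_zero.2 h1), ?_⟩
      simp only [dotProduct_add, dotProduct_smul, smul_eq_mul]
      ring
  have h2 := hv α β hne
  rw [hw, Fin.sum_univ_succ, h0] at h2
  have : 0 ≤ ∑ i : Fin 3, l i.succ * (w i.succ ⬝ᵥ (α • v + β • v')) ^ 2 := by
    refine Finset.sum_nonneg fun i _ => ?_
    have h1 : l 1 ≤ l i.succ := hl (by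
      rw [Fin.le_def]
      simp)
    exact mul_nonneg (by linarith) (sq_nonneg _)
  linarith

end Signature

/-! ### Change of frame -/

section Change

variable {L : Type*} [LieRing L] [LieAlgebra ℝ L]

theorem Relations.bracket_eq_sum (r : Relations) (x y : Fin 4 → ℝ) :
    r.bracket x y = ∑ i, ∑ j, (x i * y j) • r.const i j := by
  funext k
  simp [Relations.bracket, Relations.const, Fin.sum_univ_four]
  ring

theorem comb_add (f : Fin 4 → L) (v w : Fin 4 → ℝ) : comb f (v + w) = comb f v + comb f w := by
  simp [comb, add_smul, Finset.sum_add_distrib]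

theorem comb_smul (f : Fin 4 → L) (c : ℝ) (v : Fin 4 → ℝ) : comb f (c • v) = c • comb f v := by
  simp [comb, mul_smul, Finset.smul_sum]

/-- `comb f` as a linear map. -/
def combLinear (f : Fin 4 → L) : (Fin 4 → ℝ) →ₗ[ℝ] L where
  toFun := comb f
  map_add' := comb_add f
  map_smul' := comb_smul f

theorem comb_sum (f : Fin 4 → L) (v : Fin 4 → Fin 4 → ℝ) :
    comb f (∑ i, v i) = ∑ i, comb f (v i) :=
  map_sum (combLinear f) v Finset.univ

theorem HasRelations.lie_comb {f : Fin 4 → L} {r : Relations} (h : HasRelations f r)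
    (x y : Fin 4 → ℝ) : ⁅comb f x, comb f y⁆ = comb f (r.bracket x y) := by
  rw [Relations.bracket_eq_sum, comb_sum]
  simp only [comb_sum, comb_smul, ← h.lie]
  simp only [comb, sum_lie, lie_sum, smul_lie, lie_smul,
    Finset.smul_sum, mul_smul]
  rw [Finset.sum_comm]
  refine Finset.sum_congr rfl fun i _ => Finset.sum_congr rfl fun j _ => ?_
  first | rfl | rw [smul_comm]

/-- The frame whose members have coordinates `x i` in the frame `u`. -/
def frame (u : Fin 4 → L) (x : Fin 4 → Fin 4 → ℝ) (i : Fin 4) : L := comb u (x i)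

theorem comb_frame (u : Fin 4 → L) (x : Fin 4 → Fin 4 → ℝ) (v : Fin 4 → ℝ) :
    comb (frame u x) v = comb u (∑ k, v k • x k) := by
  rw [comb_sum]
  simp only [comb_smul]
  rfl

theorem HasRelations.frame {u : Fin 4 → L} {r r' : Relations} (h : HasRelations u r)
    (x : Fin 4 → Fin 4 → ℝ)
    (h12 : r.bracket (x 0) (x 1) = ∑ k, r'.b12 k • x k)
    (h13 : r.bracket (x 0) (x 2) = ∑ k, r'.b13 k • x k)
    (h14 : r.bracket (x 0) (x 3) = ∑ k, r'.b14 k • x k)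
    (h23 : r.bracket (x 1) (x 2) = ∑ k, r'.b23 k • x k)
    (h24 : r.bracket (x 1) (x 3) = ∑ k, r'.b24 k • x k)
    (h34 : r.bracket (x 2) (x 3) = ∑ k, r'.b34 k • x k) :
    HasRelations (frame u x) r' := by
  constructor <;> rw [comb_frame] <;> refine (h.lie_comb _ _).trans ?_ <;> congr 1

theorem exists_basis_frame (u : Module.Basis (Fin 4) ℝ L) (x : Fin 4 → Fin 4 → ℝ)
    (hx : (Matrix.of x).det ≠ 0) : ∃ f : Module.Basis (Fin 4) ℝ L, ⇑f = frame u x := by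
  have h1 : u.det (frame u x) = (Matrix.of x).det := by
    rw [Module.Basis.det_apply, ← Matrix.det_transpose]
    congr 1
    ext i j
    simp [Module.Basis.toMatrix_apply, frame, repr_comb]
  have h2 : LinearIndependent ℝ (frame u x) ∧ Submodule.span ℝ (Set.range (frame u x)) = ⊤ := by
    rw [Module.Basis.is_basis_iff_det u, h1]
    exact isUnit_iff_ne_zero.2 hx
  exact ⟨Module.Basis.mk h2.1 h2.2.ge, Module.Basis.coe_mk _ _⟩

/-- The inner product that makes a basis orthonormal. -/
def InnerProd.ofBasis (f : Module.Basis (Fin 4) ℝ L) : InnerProd L where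
  form := ∑ k, (f.coord k).smulRight (f.coord k)
  symm x y := by simp [LinearMap.sum_apply, mul_comm]
  pos x hx := by
    have h : ∃ k, f.repr x k ≠ 0 := by
      by_contra hcon
      push Not at hcon
      exact hx (f.repr.map_eq_zero_iff.1 (Finsupp.ext hcon))
    obtain ⟨k, hk⟩ := h
    simp only [LinearMap.sum_apply, LinearMap.smulRight_apply, LinearMap.smul_apply,
      Module.Basis.coord_apply, smul_eq_mul]
    exact Finset.sum_pos' (fun i _ => mul_self_nonneg _)
      ⟨k, Finset.mem_univ k, mul_self_pos.2 hk⟩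

theorem isOrthonormal_ofBasis (f : Module.Basis (Fin 4) ℝ L) :
    IsOrthonormal (InnerProd.ofBasis f) f := by
  intro i j
  simp [InnerProd.ofBasis, LinearMap.sum_apply, Finsupp.single_apply, eq_comm]

/-- A signature is realized on a Lie algebra as soon as it is the signature of the Ricci matrix
of the relations of some basis. -/
theorem exists_signature_of_frame [FiniteDimensional ℝ L] (u : Module.Basis (Fin 4) ℝ L)
    {r' : Relations} {x : Fin 4 → Fin 4 → ℝ} (hx : (Matrix.of x).det ≠ 0)
    (h : HasRelations (frame u x) r') {s : Fin 4 → SignType}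
    (hs : HasMatrixSignature r'.ricMatrix s) :
    ∃ Q : InnerProd L, HasSignature Q.ricciOperator s := by
  obtain ⟨f, hf⟩ := exists_basis_frame u x hx
  refine ⟨InnerProd.ofBasis f, ?_⟩
  rw [hasSignature_iff (isOrthonormal_ofBasis f) (by rwa [hf])]
  exact hs

end Change

/-! ### Existence of adapted orthonormal frames -/

section Existence

variable {L : Type*} [LieRing L] [LieAlgebra ℝ L]

/-- Gram-Schmidt orthonormalization. -/
theorem exists_triangular_frame (Q : InnerProd L) (u : Module.Basis (Fin 4) ℝ L) :
    ∃ x : Fin 4 → Fin 4 → ℝ, IsOrthonormal Q (frame u x) ∧ (∀ i, 0 < x i i) ∧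
      ∀ i j, i < j → x i j = 0 := by
  -- `B` is `Q` in the coordinates of `u`; the orthonormalization runs on the standard basis of ℝ⁴.
  set B : LinearMap.BilinForm ℝ (Fin 4 → ℝ) :=
    Q.form.compl₁₂ (combLinear u) (combLinear u) with hB
  have hsymm : ∀ v w, B v w = B w v := fun v w => Q.symm _ _
  have hpos : ∀ v, v ≠ 0 → 0 < B v v := by
    intro v hv
    refine Q.pos _ fun h0 => hv ?_
    funext k
    have := repr_comb u v k
    rw [show comb u v = 0 from h0] at this
    simpa using this.symm
  -- Normalizing factor. The `i`-th vector before normalization has `i`-th coordinate 1, which shows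
  -- that it is nonzero.
  have step : ∀ (w : Fin 4 → ℝ) (i : Fin 4), w i = 1 →
      ∃ c : ℝ, 0 < c ∧ c * (c * B w w) = 1 := by
    intro w i hi
    have h := hpos w fun h0 => by simp [h0] at hi
    refine ⟨(Real.sqrt (B w w))⁻¹, inv_pos.2 (Real.sqrt_pos.2 h), ?_⟩
    have h2 := Real.mul_self_sqrt h.le
    have h3 := (Real.sqrt_pos.2 h).ne'
    field_simp
    nlinarith
  obtain ⟨c0, p0, h0⟩ := step (Pi.single 0 1) 0 (by simp)
  set x0 : Fin 4 → ℝ := c0 • Pi.single 0 1 with hx0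
  have h00 : B x0 x0 = 1 := by simpa [hx0] using h0
  obtain ⟨c1, p1, h1⟩ := step (Pi.single 1 1 - B (Pi.single 1 1) x0 • x0) 1 (by simp [hx0])
  set x1 : Fin 4 → ℝ := c1 • (Pi.single 1 1 - B (Pi.single 1 1) x0 • x0) with hx1
  have h11 : B x1 x1 = 1 := by simpa only [hx1, map_smul, LinearMap.smul_apply, smul_eq_mul] using h1
  have h10 : B x1 x0 = 0 := by
    simp only [hx1, map_smul, map_sub, LinearMap.smul_apply, LinearMap.sub_apply, smul_eq_mul, h00]
    ring
  obtain ⟨c2, p2, h2⟩ := step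
    (Pi.single 2 1 - B (Pi.single 2 1) x0 • x0 - B (Pi.single 2 1) x1 • x1) 2
    (by simp [hx0, hx1])
  set x2 : Fin 4 → ℝ :=
    c2 • (Pi.single 2 1 - B (Pi.single 2 1) x0 • x0 - B (Pi.single 2 1) x1 • x1) with hx2
  have h22 : B x2 x2 = 1 := by simpa only [hx2, map_smul, LinearMap.smul_apply, smul_eq_mul] using h2
  have h01 : B x0 x1 = 0 := (hsymm _ _).trans h10
  have h20 : B x2 x0 = 0 := by
    simp only [hx2, map_smul, map_sub, LinearMap.smul_apply, LinearMap.sub_apply, smul_eq_mul, h00,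
      h10]
    ring
  have h21 : B x2 x1 = 0 := by
    simp only [hx2, map_smul, map_sub, LinearMap.smul_apply, LinearMap.sub_apply, smul_eq_mul, h11,
      h01]
    ring
  have h02 : B x0 x2 = 0 := (hsymm _ _).trans h20
  have h12 : B x1 x2 = 0 := (hsymm _ _).trans h21
  obtain ⟨c3, p3, h3⟩ := step (Pi.single 3 1 - B (Pi.single 3 1) x0 • x0 -
      B (Pi.single 3 1) x1 • x1 - B (Pi.single 3 1) x2 • x2) 3 (by simp [hx0, hx1, hx2])
  set x3 : Fin 4 → ℝ := c3 • (Pi.single 3 1 - B (Pi.single 3 1) x0 • x0 -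
      B (Pi.single 3 1) x1 • x1 - B (Pi.single 3 1) x2 • x2) with hx3
  have h33 : B x3 x3 = 1 := by simpa only [hx3, map_smul, LinearMap.smul_apply, smul_eq_mul] using h3
  have h30 : B x3 x0 = 0 := by
    simp only [hx3, map_smul, map_sub, LinearMap.smul_apply, LinearMap.sub_apply, smul_eq_mul, h00,
      h10, h20]
    ring
  have h31 : B x3 x1 = 0 := by
    simp only [hx3, map_smul, map_sub, LinearMap.smul_apply, LinearMap.sub_apply, smul_eq_mul, h11,
      h01, h21]
    ring
  have h32 : B x3 x2 = 0 := by
    simp only [hx3, map_smul, map_sub, LinearMap.smul_apply, LinearMap.sub_apply, smul_eq_mul, h22,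
      h02, h12]
    ring
  have h03 : B x0 x3 = 0 := (hsymm _ _).trans h30
  have h13 : B x1 x3 = 0 := (hsymm _ _).trans h31
  have h23 : B x2 x3 = 0 := (hsymm _ _).trans h32
  refine ⟨![x0, x1, x2, x3], ?_, ?_, ?_⟩
  · intro i j
    change B (![x0, x1, x2, x3] i) (![x0, x1, x2, x3] j) = _
    fin_cases i <;> fin_cases j <;>
      simp [h00, h01, h02, h03, h10, h11, h12, h13, h20, h21, h22, h23, h30, h31, h32, h33]
  · intro i
    fin_cases i
    · simpa [hx0] using p0
    · simpa [hx1, hx0] using p1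
    · simpa [hx2, hx1, hx0] using p2
    · simpa [hx3, hx2, hx1, hx0] using p3
  · intro i j hij
    fin_cases i <;> fin_cases j <;> first | (exact absurd hij (by decide)) | skip
    all_goals simp [hx2, hx1, hx0]

theorem IsOrthonormal.exists_basis {Q : InnerProd L} {f : Fin 4 → L} (hf : IsOrthonormal Q f)
    (u : Module.Basis (Fin 4) ℝ L) : ∃ b : Module.Basis (Fin 4) ℝ L, ⇑b = f := by
  have : FiniteDimensional ℝ L := u.finiteDimensional_of_finite
  exact ⟨basisOfLinearIndependentOfCardEqFinrank hf.linearIndependent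
    (Module.finrank_eq_card_basis u).symm, coe_basisOfLinearIndependentOfCardEqFinrank _ _⟩

/-- Simultaneous diagonalization of an inner product and a symmetric bilinear form. -/
theorem exists_diagonal_frame (Q : InnerProd L) (u : Module.Basis (Fin 4) ℝ L)
    (B : LinearMap.BilinForm ℝ L) (hB : ∀ x y, B x y = B y x) :
    ∃ f : Fin 4 → L, IsOrthonormal Q f ∧ ∀ i j, i ≠ j → B (f i) (f j) = 0 := by
  obtain ⟨x, hx, -⟩ := exists_triangular_frame Q u
  set g := frame u x
  -- In a `Q`-orthonormal frame the problem is the spectral theorem for the Gram matrix of `B`.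
  set M : Matrix (Fin 4) (Fin 4) ℝ := Matrix.of fun i j => B (g i) (g j) with hM
  have hH : M.IsHermitian := by
    ext i j
    simp [hM, hB (g i) (g j)]
  set b := hH.eigenvectorBasis
  have hdot : ∀ i j, (b i).ofLp ⬝ᵥ (b j).ofLp = if i = j then 1 else 0 := by
    intro i j
    rw [← orthonormal_iff_ite.1 b.orthonormal i j]
    simp [PiLp.inner_apply, dotProduct, mul_comm]
  have hform : ∀ v w : Fin 4 → ℝ, Q.form (comb g v) (comb g w) = v ⬝ᵥ w := by
    intro v w
    have h1 : Q.form (comb g v) (comb g w) = ∑ k, w k * Q.form (comb g v) (g k) := by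
      conv_lhs => rw [comb.eq_def g w]
      simp
    rw [h1]
    simp only [hx.form_comb, dotProduct, mul_comm]
  have hBform : ∀ v w : Fin 4 → ℝ, B (comb g v) (comb g w) = v ⬝ᵥ M.mulVec w := by
    intro v w
    simp [comb, dotProduct, Matrix.mulVec, hM, Finset.mul_sum, LinearMap.sum_apply]
    exact Finset.sum_comm.trans (Finset.sum_congr rfl fun i _ => Finset.sum_congr rfl
      fun j _ => by ring)
  refine ⟨frame g fun i => (b i).ofLp, fun i j => (hform _ _).trans (hdot i j), fun i j hij => ?_⟩
  refine (hBform _ _).trans ?_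
  rw [hH.mulVec_eigenvectorBasis j, dotProduct_smul, hdot, if_neg hij, smul_zero]

end Existence

/-! ### Semidirect products -/

/-- The semidirect product `ℝ ⋉ ℝ³` of a block triangular action of `f₄` on `f₁, f₂, f₃`. -/
def semidirect (d x y a b c g : ℝ) : Relations where
  b14 := ![d, 0, 0, 0]
  b24 := ![x, a, c, 0]
  b34 := ![y, b, g, 0]

/-- The upper left block of twice the Ricci matrix of `semidirect d x y a b c g`. -/
def semidirectBlock (d x y a b c g : ℝ) : Matrix (Fin 3) (Fin 3) ℝ :=
  !![x ^ 2 + y ^ 2, x * a + y * b - d * x, x * c + y * g - d * y;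
    x * a + y * b - d * x, b ^ 2 - x ^ 2 - c ^ 2, a * c + b * g - x * y - a * b - c * g;
    x * c + y * g - d * y, a * c + b * g - x * y - a * b - c * g, c ^ 2 - y ^ 2 - b ^ 2]

set_option maxHeartbeats 1000000 in
theorem ricMatrix_semidirect {d x y a b c g : ℝ} (h : d + a + g = 0) :
    (semidirect d x y a b c g).ricMatrix =
      !![(x ^ 2 + y ^ 2) / 2, (x * a + y * b - d * x) / 2, (x * c + y * g - d * y) / 2, 0;
        (x * a + y * b - d * x) / 2, (b ^ 2 - x ^ 2 - c ^ 2) / 2,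
          (a * c + b * g - x * y - a * b - c * g) / 2, 0;
        (x * c + y * g - d * y) / 2, (a * c + b * g - x * y - a * b - c * g) / 2,
          (c ^ 2 - y ^ 2 - b ^ 2) / 2, 0;
        0, 0, 0, -(d ^ 2 + a ^ 2 + g ^ 2 + (x ^ 2 + y ^ 2 + (b + c) ^ 2) / 2)] := by
  obtain rfl : g = -d - a := by linarith
  ext i j
  fin_cases i <;> fin_cases j <;>
    simp only [Relations.ricMatrix, Relations.ric, Relations.christoffel, Relations.const,
      semidirect, Fin.sum_univ_four, Matrix.of_apply, Matrix.cons_val, Pi.neg_apply,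
      Pi.zero_apply, Fin.zero_eta, Fin.mk_one, Fin.reduceFinMk, Fin.isValue] <;> ring

/-- A real symmetric `3 × 3` matrix has real eigenvalues. -/
theorem exists_sorted_roots {M : Matrix (Fin 3) (Fin 3) ℝ} (hM : M.IsSymm) :
    ∃ l : Fin 3 → ℝ, l 0 ≤ l 1 ∧ l 1 ≤ l 2 ∧
      ∀ z, (Matrix.scalar (Fin 3) z - M).det = (z - l 0) * (z - l 1) * (z - l 2) := by
  have hH : M.IsHermitian := by
    rw [Matrix.IsHermitian, Matrix.conjTranspose_eq_transpose_of_trivial]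
    exact hM
  refine ⟨hH.eigenvalues ∘ Tuple.sort hH.eigenvalues, Tuple.monotone_sort _ (by decide),
    Tuple.monotone_sort _ (by decide), fun z => ?_⟩
  have h1 := congrArg (Polynomial.eval z) hH.charpoly_eq
  simp only [RCLike.ofReal_real_eq_id, id] at h1
  rw [Matrix.eval_charpoly, Polynomial.eval_prod,
    ← Equiv.prod_comp (Tuple.sort hH.eigenvalues)] at h1
  rw [h1, Fin.prod_univ_three]
  simp

/-- The squared norm of `semidirectBlock`, halved. -/
def semidirectNorm (d x y a b c g : ℝ) : ℝ :=
  ((x ^ 2 + y ^ 2) ^ 2 + (b ^ 2 - x ^ 2 - c ^ 2) ^ 2 + (c ^ 2 - y ^ 2 - b ^ 2) ^ 2) / 2 +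
    (x * a + y * b - d * x) ^ 2 + (x * c + y * g - d * y) ^ 2 +
    (a * c + b * g - x * y - a * b - c * g) ^ 2

/-- With D the matrix whose columns are (d,0,0), (x,a,c), (y,b,g), `semidirectBlock` is [D, Dᵀ]. It
is traceless, so the signs of p ≤ q ≤ r can be read off from their product and from the vanishing of
the norm. The remaining eigenvalue is -tr(S²), S being the symmetric part of D. -/
theorem exists_eval_charpoly_semidirect {d x y a b c g : ℝ} (h : d + a + g = 0) :
    ∃ p q r : ℝ, p ≤ q ∧ q ≤ r ∧ p + q + r = 0 ∧
      p * q * r = (semidirectBlock d x y a b c g).det / 8 ∧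
      p * q + p * r + q * r = -semidirectNorm d x y a b c g / 4 ∧
      ∀ z, (semidirect d x y a b c g).ricMatrix.charpoly.eval z =
        (z + (d ^ 2 + a ^ 2 + g ^ 2 + (x ^ 2 + y ^ 2 + (b + c) ^ 2) / 2)) *
          ((z - p) * (z - q) * (z - r)) := by
  obtain ⟨l, h01, h12, hl⟩ := exists_sorted_roots
    (M := (1 / 2 : ℝ) • semidirectBlock d x y a b c g) (by
      ext i j
      fin_cases i <;> fin_cases j <;> simp [semidirectBlock])
  have key : ∀ z, (z - l 0) * (z - l 1) * (z - l 2) =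
      z ^ 3 - semidirectNorm d x y a b c g / 4 * z - (semidirectBlock d x y a b c g).det / 8 := by
    intro z
    rw [← hl]
    simp [semidirectNorm, semidirectBlock, Matrix.det_fin_three]
    ring
  -- Three values of the two monic cubics give the three elementary symmetric functions of the
  -- roots.
  have k0 := key 0
  have k1 := key 1
  have k2 := key (-1)
  refine ⟨l 0, l 1, l 2, h01, h12, by linarith, by linarith, by linarith, fun z => ?_⟩
  rw [key, Matrix.eval_charpoly, ricMatrix_semidirect h, Matrix.det_succ_row_zero]
  simp [Fin.sum_univ_four, Matrix.det_fin_three, Fin.succAbove, semidirectNorm, semidirectBlock]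
  ring

theorem semidirectNorm_nonneg (d x y a b c g : ℝ) : 0 ≤ semidirectNorm d x y a b c g := by
  unfold semidirectNorm
  positivity

section

variable {d x y a b c g : ℝ}

/-- Three numbers with sum zero and negative product: one is negative and two are positive. -/
theorem signature_semidirect_of_det_neg (h : d + a + g = 0)
    (hτ : 0 < d ^ 2 + a ^ 2 + g ^ 2 + (x ^ 2 + y ^ 2 + (b + c) ^ 2) / 2)
    (hdet : (semidirectBlock d x y a b c g).det < 0) :
    HasMatrixSignature (semidirect d x y a b c g).ricMatrix (signatureItem 5) := by
  obtain ⟨p, q, r, hpq, hqr, hsum, hprod, -, hz⟩ := exists_eval_charpoly_semidirect (x := x)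
    (y := y) (b := b) (c := c) h
  set τ := d ^ 2 + a ^ 2 + g ^ 2 + (x ^ 2 + y ^ 2 + (b + c) ^ 2) / 2
  have h1 : p * q * r < 0 := by linarith
  have hp : p < 0 := by
    by_contra hp
    have : 0 ≤ p * q * r := by
      have : 0 ≤ p := by linarith
      have : 0 ≤ q := by linarith
      have : 0 ≤ r := by linarith
      positivity
    linarith
  have hr : 0 < r := by linarith
  have hq : 0 < q := by
    by_contra hq
    have : 0 ≤ p * q * r := mul_nonneg (mul_nonneg_of_nonpos_of_nonpos hp.le (by linarith)) hr.le
    linarith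
  refine hasMatrixSignature_of_roots ![-τ, p, q, r] (fun z => ?_) ?_ ?_
  · rw [hz, Fin.prod_univ_four]
    simp
    ring
  · decide
  · intro i
    fin_cases i <;> simp [signatureItem, hp, hq, hr, hτ, sign_neg]

/-- Three numbers with sum zero and positive product: two are negative and one is positive. -/
theorem signature_semidirect_of_det_pos (h : d + a + g = 0)
    (hτ : 0 < d ^ 2 + a ^ 2 + g ^ 2 + (x ^ 2 + y ^ 2 + (b + c) ^ 2) / 2)
    (hdet : 0 < (semidirectBlock d x y a b c g).det) :
    HasMatrixSignature (semidirect d x y a b c g).ricMatrix (signatureItem 2) := by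
  obtain ⟨p, q, r, hpq, hqr, hsum, hprod, -, hz⟩ := exists_eval_charpoly_semidirect (x := x)
    (y := y) (b := b) (c := c) h
  set τ := d ^ 2 + a ^ 2 + g ^ 2 + (x ^ 2 + y ^ 2 + (b + c) ^ 2) / 2
  have h1 : 0 < p * q * r := by linarith
  have hp : p < 0 := by
    by_contra hp
    have : r = 0 := by linarith
    simp [this] at h1
  have hr : 0 < r := by linarith
  have hq : q < 0 := by
    by_contra hq
    have : p * q * r ≤ 0 :=
      mul_nonpos_of_nonpos_of_nonneg (mul_nonpos_of_nonpos_of_nonneg hp.le (by linarith)) hr.le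
    linarith
  refine hasMatrixSignature_of_roots ![-τ, p, q, r] (fun z => ?_) ?_ ?_
  · rw [hz, Fin.prod_univ_four]
    simp
    ring
  · decide
  · intro i
    fin_cases i <;> simp [signatureItem, hp, hq, hr, hτ, sign_neg]

/-- A positive norm prevents all three roots from vanishing, so with sum and product zero it is the
middle one that vanishes. -/
theorem signature_semidirect_of_det_eq_zero (h : d + a + g = 0)
    (hτ : 0 < d ^ 2 + a ^ 2 + g ^ 2 + (x ^ 2 + y ^ 2 + (b + c) ^ 2) / 2)
    (hdet : (semidirectBlock d x y a b c g).det = 0)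
    (hn : 0 < semidirectNorm d x y a b c g) :
    HasMatrixSignature (semidirect d x y a b c g).ricMatrix (signatureItem 4) := by
  obtain ⟨p, q, r, hpq, hqr, hsum, hprod, he, hz⟩ := exists_eval_charpoly_semidirect (x := x)
    (y := y) (b := b) (c := c) h
  set τ := d ^ 2 + a ^ 2 + g ^ 2 + (x ^ 2 + y ^ 2 + (b + c) ^ 2) / 2
  have h1 : p * q * r = 0 := by linarith
  have hp : p < 0 := by
    by_contra hp
    have h2 : r = 0 := by linarith
    have h3 : q = 0 := by linarith
    rw [h2, h3] at he
    linarith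
  have hr : 0 < r := by linarith
  obtain rfl : q = 0 := by
    rcases mul_eq_zero.1 h1 with h2 | h2
    · exact (mul_eq_zero.1 h2).resolve_left hp.ne
    · exact absurd h2 hr.ne'
  refine hasMatrixSignature_of_roots ![-τ, p, 0, r] (fun z => ?_) ?_ ?_
  · rw [hz, Fin.prod_univ_four]
    simp
    ring
  · decide
  · intro i
    fin_cases i <;> simp [signatureItem, hp, hr, hτ, sign_neg]

/-- The norm vanishes exactly when the commutator [D, Dᵀ] does. -/
theorem roots_eq_zero_of_semidirectNorm (h : d + a + g = 0)
    (hn : semidirectNorm d x y a b c g = 0) :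
    ∀ z, (semidirect d x y a b c g).ricMatrix.charpoly.eval z =
        (z + (d ^ 2 + a ^ 2 + g ^ 2 + (x ^ 2 + y ^ 2 + (b + c) ^ 2) / 2)) * z ^ 3 := by
  obtain ⟨p, q, r, hpq, hqr, hsum, hprod, he, hz⟩ := exists_eval_charpoly_semidirect (x := x)
    (y := y) (b := b) (c := c) h
  rw [hn] at he
  have hsq : p ^ 2 + q ^ 2 + r ^ 2 = 0 := by
    have : (p + q + r) ^ 2 = 0 := by rw [hsum]; ring
    nlinarith
  obtain rfl : p = 0 := by nlinarith [sq_nonneg p, sq_nonneg q, sq_nonneg r]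
  obtain rfl : q = 0 := by nlinarith [sq_nonneg q, sq_nonneg r]
  obtain rfl : r = 0 := by linarith
  intro z
  rw [hz]
  ring

theorem signature_semidirect_of_norm_eq_zero (h : d + a + g = 0)
    (hτ : 0 < d ^ 2 + a ^ 2 + g ^ 2 + (x ^ 2 + y ^ 2 + (b + c) ^ 2) / 2)
    (hn : semidirectNorm d x y a b c g = 0) :
    HasMatrixSignature (semidirect d x y a b c g).ricMatrix (signatureItem 6) := by
  have hz := roots_eq_zero_of_semidirectNorm h hn
  set τ := d ^ 2 + a ^ 2 + g ^ 2 + (x ^ 2 + y ^ 2 + (b + c) ^ 2) / 2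
  refine hasMatrixSignature_of_roots ![-τ, 0, 0, 0] (fun z => ?_) ?_ ?_
  · rw [hz, Fin.prod_univ_four]
    simp
    ring
  · decide
  · intro i
    fin_cases i <;> simp [signatureItem, hτ]

theorem signature_semidirect_of_flat (h : d + a + g = 0)
    (hτ : d ^ 2 + a ^ 2 + g ^ 2 + (x ^ 2 + y ^ 2 + (b + c) ^ 2) / 2 = 0)
    (hn : semidirectNorm d x y a b c g = 0) :
    HasMatrixSignature (semidirect d x y a b c g).ricMatrix (signatureItem 10) := by
  have hz := roots_eq_zero_of_semidirectNorm h hn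
  rw [hτ] at hz
  refine hasMatrixSignature_of_roots ![0, 0, 0, 0] (fun z => ?_) ?_ ?_
  · rw [hz, Fin.prod_univ_four]
    simp
    ring
  · decide
  · intro i
    fin_cases i <;> simp [signatureItem]

end

/-! ### Exact sets of signatures and triangular changes of frame -/

theorem signatureItem_injective : Function.Injective signatureItem := by
  decide

section

variable {L : Type*} [LieRing L] [LieAlgebra ℝ L]

theorem HasSignature.unique [FiniteDimensional ℝ L] {A : L →ₗ[ℝ] L} {s t : Fin 4 → SignType}
    (hs : HasSignature A s) (ht : HasSignature A t) : s = t := by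
  obtain ⟨l, hl, h1, h2⟩ := hs
  obtain ⟨m, hm, h3, h4⟩ := ht
  have := eq_of_prod_eq hl hm (h1.symm.trans h3)
  funext i
  rw [h2, h4, this]

variable (L) in
/-- The numbers of the signatures of the Ricci operators of `L` form the set `S`. -/
def RealizesExactly [FiniteDimensional ℝ L] (S : Finset ℕ) : Prop :=
  ∀ k : Fin 15, (∃ Q : InnerProd L, HasSignature Q.ricciOperator (signatureItem k)) ↔
    (k : ℕ) + 1 ∈ S

theorem realizesExactly_of [FiniteDimensional ℝ L] {S : Finset ℕ}
    (h1 : ∀ Q : InnerProd L, ∃ k : Fin 15, (k : ℕ) + 1 ∈ S ∧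
      HasSignature Q.ricciOperator (signatureItem k))
    (h2 : ∀ k : Fin 15, (k : ℕ) + 1 ∈ S →
      ∃ Q : InnerProd L, HasSignature Q.ricciOperator (signatureItem k)) :
    RealizesExactly L S := by
  refine fun k => ⟨fun ⟨Q, hQ⟩ => ?_, h2 k⟩
  obtain ⟨j, hj, h⟩ := h1 Q
  rwa [signatureItem_injective (hQ.unique h)]

/-- The equations for the parameters `d', …` of a block triangular action in a new frame with
triangular coefficient matrix `X`. -/
structure SemidirectChange (X : Fin 4 → Fin 4 → ℝ) (d x y a b c g d' x' y' a' b' c' g' : ℝ) :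
    Prop where
  eq_d : d' = X 3 3 * d
  eq_c : c' * X 2 2 = X 3 3 * (X 1 1 * c)
  eq_a : a' * X 1 1 + c' * X 2 1 = X 3 3 * (X 1 1 * a)
  eq_x : x' * X 0 0 + a' * X 1 0 + c' * X 2 0 = X 3 3 * (X 1 0 * d + X 1 1 * x)
  eq_g : g' * X 2 2 = X 3 3 * (X 2 1 * c + X 2 2 * g)
  eq_b : b' * X 1 1 + g' * X 2 1 = X 3 3 * (X 2 1 * a + X 2 2 * b)
  eq_y : y' * X 0 0 + b' * X 1 0 + g' * X 2 0 = X 3 3 * (X 2 0 * d + X 2 1 * x + X 2 2 * y)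

/-- A lower triangular frame keeps both the ideal ℝ³ and its invariant line. The components of the
last vector along ℝ³ play no role because ℝ³ is abelian. -/
theorem HasRelations.semidirect_frame {u : Fin 4 → L} {X : Fin 4 → Fin 4 → ℝ}
    {d x y a b c g d' x' y' a' b' c' g' : ℝ} (h : HasRelations u (semidirect d x y a b c g))
    (hX : ∀ i j, i < j → X i j = 0)
    (hc : SemidirectChange X d x y a b c g d' x' y' a' b' c' g') :
    HasRelations (RicciSignature.frame u X) (semidirect d' x' y' a' b' c' g') := by
  obtain ⟨e1, e2, e3, e4, e5, e6, e7⟩ := hc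
  have h01 := hX 0 1 (by decide)
  have h02 := hX 0 2 (by decide)
  have h03 := hX 0 3 (by decide)
  have h12 := hX 1 2 (by decide)
  have h13 := hX 1 3 (by decide)
  have h23 := hX 2 3 (by decide)
  apply h.frame
  · funext k
    fin_cases k <;> simp [semidirect, Relations.bracket, *]
  · funext k
    fin_cases k <;> simp [semidirect, Relations.bracket, *]
  · funext k
    fin_cases k <;> simp [semidirect, Relations.bracket, Fin.sum_univ_four, h01, h02, h03, e1]
    ring
  · funext k
    fin_cases k <;> simp [semidirect, Relations.bracket, *]
  · funext k
    fin_cases k <;>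
      simp [semidirect, Relations.bracket, Fin.sum_univ_four, h01, h02, h03, h12, h13, h23] <;>
      linarith
  · funext k
    fin_cases k <;>
      simp [semidirect, Relations.bracket, Fin.sum_univ_four, h01, h02, h03, h12, h13, h23] <;>
      linarith

theorem det_of_triangular {X : Fin 4 → Fin 4 → ℝ} (hX : ∀ i j, i < j → X i j = 0) :
    (Matrix.of X).det = X 0 0 * X 1 1 * X 2 2 * X 3 3 := by
  have h : (Matrix.of X).BlockTriangular OrderDual.toDual := fun i j hij => hX i j hij
  rw [Matrix.det_of_isLowerTriangular _ h, Fin.prod_univ_four]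
  rfl

variable [FiniteDimensional ℝ L]

theorem exists_semidirect_frame (Q : InnerProd L) {u : Module.Basis (Fin 4) ℝ L}
    {d x y a b c g : ℝ} (h : HasRelations u (semidirect d x y a b c g)) :
    ∃ (X : Fin 4 → Fin 4 → ℝ) (d' x' y' a' b' c' g' : ℝ), (∀ i, 0 < X i i) ∧
      SemidirectChange X d x y a b c g d' x' y' a' b' c' g' ∧
      ∀ s, HasSignature Q.ricciOperator s ↔
        HasMatrixSignature (semidirect d' x' y' a' b' c' g').ricMatrix s := by
  obtain ⟨X, hX, hpos, htri⟩ := exists_triangular_frame Q u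
  have h0 := (hpos 0).ne'
  have h1 := (hpos 1).ne'
  have h2 := (hpos 2).ne'
  -- The equations of `SemidirectChange` form a triangular system for the new parameters, solved by
  -- back substitution.
  set c' := X 3 3 * (X 1 1 * c) / X 2 2 with hc'
  set a' := (X 3 3 * (X 1 1 * a) - c' * X 2 1) / X 1 1 with ha'
  set x' := (X 3 3 * (X 1 0 * d + X 1 1 * x) - a' * X 1 0 - c' * X 2 0) / X 0 0 with hx'
  set g' := X 3 3 * (X 2 1 * c + X 2 2 * g) / X 2 2 with hg'
  set b' := (X 3 3 * (X 2 1 * a + X 2 2 * b) - g' * X 2 1) / X 1 1 with hb'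
  set y' := (X 3 3 * (X 2 0 * d + X 2 1 * x + X 2 2 * y) - b' * X 1 0 - g' * X 2 0) / X 0 0 with hy'
  have hch : SemidirectChange X d x y a b c g (X 3 3 * d) x' y' a' b' c' g' := by
    refine ⟨rfl, ?_, ?_, ?_, ?_, ?_, ?_⟩
    · rw [hc', div_mul_cancel₀ _ h2]
    · rw [ha', div_mul_cancel₀ _ h1]; ring
    · rw [hx', div_mul_cancel₀ _ h0]; ring
    · rw [hg', div_mul_cancel₀ _ h2]
    · rw [hb', div_mul_cancel₀ _ h1]; ring
    · rw [hy', div_mul_cancel₀ _ h0]; ring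
  obtain ⟨f, hf⟩ := hX.exists_basis u
  refine ⟨X, _, _, _, _, _, _, _, hpos, hch, fun s => hasSignature_iff (f := f) (by rwa [hf]) ?_ s⟩
  rw [hf]
  exact h.semidirect_frame htri hch

theorem exists_signature_of_semidirect {u : Module.Basis (Fin 4) ℝ L} {d x y a b c g : ℝ}
    (h : HasRelations u (semidirect d x y a b c g)) (X : Fin 4 → Fin 4 → ℝ)
    (d' x' y' a' b' c' g' : ℝ) (htri : ∀ i j, i < j → X i j = 0)
    (hX : X 0 0 * X 1 1 * X 2 2 * X 3 3 ≠ 0)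
    (hch : SemidirectChange X d x y a b c g d' x' y' a' b' c' g') {s : Fin 4 → SignType}
    (hs : HasMatrixSignature (semidirect d' x' y' a' b' c' g').ricMatrix s) :
    ∃ Q : InnerProd L, HasSignature Q.ricciOperator s :=
  exists_signature_of_frame u (by rwa [det_of_triangular htri]) (h.semidirect_frame htri hch) hs

end

/-- A lower triangular frame. -/
def triangular (s₀ s₁ s₂ p q r : ℝ) : Fin 4 → Fin 4 → ℝ :=
  ![![s₀, 0, 0, 0], ![p, s₁, 0, 0], ![r, q, s₂, 0], ![0, 0, 0, 1]]

theorem triangular_eq_zero (s₀ s₁ s₂ p q r : ℝ) (i j : Fin 4) (hij : i < j) :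
    triangular s₀ s₁ s₂ p q r i j = 0 := by
  fin_cases i <;> fin_cases j <;> first | (exact absurd hij (by decide)) | rfl

/-- The new action matrix is `X 3 3` times a conjugate of the old one. -/
theorem SemidirectChange.trace {X : Fin 4 → Fin 4 → ℝ}
    {d x y a b c g d' x' y' a' b' c' g' : ℝ} (hX : ∀ i, 0 < X i i)
    (hc : SemidirectChange X d x y a b c g d' x' y' a' b' c' g') (h : d + a + g = 0) :
    d' + a' + g' = 0 := by
  obtain ⟨e1, e2, e3, e4, e5, e6, e7⟩ := hc
  have h1 := (hX 1).ne'
  have h2 := (hX 2).ne'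
  have e : (d' + a' + g') * (X 1 1 * X 2 2) = 0 := by
    linear_combination X 1 1 * X 2 2 * e1 + X 2 2 * e3 - X 2 1 * e2 + X 1 1 * e5 +
      X 1 1 * X 2 2 * X 3 3 * h
  exact (mul_eq_zero.1 e).resolve_right (mul_ne_zero h1 h2)

/-- Signatures of a nonabelian semidirect product. -/
theorem signature_semidirect {d x y a b c g : ℝ} (h : d + a + g = 0)
    (hτ : 0 < d ^ 2 + a ^ 2 + g ^ 2 + (x ^ 2 + y ^ 2 + (b + c) ^ 2) / 2) :
    HasMatrixSignature (semidirect d x y a b c g).ricMatrix (signatureItem 2) ∨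
    HasMatrixSignature (semidirect d x y a b c g).ricMatrix (signatureItem 4) ∨
    HasMatrixSignature (semidirect d x y a b c g).ricMatrix (signatureItem 5) ∨
    (semidirectNorm d x y a b c g = 0 ∧
      HasMatrixSignature (semidirect d x y a b c g).ricMatrix (signatureItem 6)) := by
  rcases lt_trichotomy (semidirectBlock d x y a b c g).det 0 with h1 | h1 | h1
  · exact Or.inr (Or.inr (Or.inl (signature_semidirect_of_det_neg h hτ h1)))
  · rcases (semidirectNorm_nonneg d x y a b c g).eq_or_lt' with h2 | h2
    · exact Or.inr (Or.inr (Or.inr ⟨h2, signature_semidirect_of_norm_eq_zero h hτ h2⟩))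
    · exact Or.inr (Or.inl (signature_semidirect_of_det_eq_zero h hτ h1 h2))
  · exact Or.inl (signature_semidirect_of_det_pos h hτ h1)

/-! ### Table rows of the semidirect products -/

section

variable {L : Type*} [LieRing L] [LieAlgebra ℝ L] [FiniteDimensional ℝ L]

/-- The determinant of `semidirectBlock` for an upper bidiagonal action. -/
theorem det_semidirectBlock_upper (d x a b g : ℝ) :
    (semidirectBlock d x 0 a b 0 g).det =
      x ^ 2 * b ^ 2 * (x ^ 2 - b ^ 2 + (d - a) ^ 2 - (a - g) ^ 2) := by
  simp [semidirectBlock, Matrix.det_fin_three]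
  ring

/-- The upper left entry x² + y² of the commutator is then positive: the action is not normal. -/
theorem semidirectNorm_pos_of_ne {d x y a b c g : ℝ} (hx : x ≠ 0) :
    0 < semidirectNorm d x y a b c g := by
  unfold semidirectNorm
  positivity

/-- Nilpotent action of rank one. -/
theorem realizesExactly_rank_one {u : Module.Basis (Fin 4) ℝ L}
    (h : HasRelations u (semidirect 0 1 0 0 0 0 0)) : RealizesExactly L {5} := by
  apply realizesExactly_of
  · intro Q
    obtain ⟨X, d, x, y, a, b, c, g, hX, ⟨e1, e2, e3, e4, e5, e6, e7⟩, hQ⟩ :=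
      exists_semidirect_frame Q h
    have h0 := hX 0
    have h1 := hX 1
    have h2 := hX 2
    have h3 := hX 3
    obtain rfl : d = 0 := by simpa using e1
    obtain rfl : c = 0 := by simpa [h2.ne'] using e2
    obtain rfl : a = 0 := by simpa [h1.ne'] using e3
    obtain rfl : g = 0 := by simpa [h2.ne'] using e5
    obtain rfl : b = 0 := by simpa [h1.ne'] using e6
    have hx : x ≠ 0 := by
      rintro rfl
      have : X 3 3 * X 1 1 = 0 := by linarith
      exact (mul_pos h3 h1).ne' this
    -- D has a single nonzero row, hence [D, Dᵀ] has rank at most two.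
    refine ⟨4, by decide, (hQ _).2 (signature_semidirect_of_det_eq_zero (by ring) ?_ ?_
      (semidirectNorm_pos_of_ne hx))⟩
    · positivity
    · simp [semidirectBlock, Matrix.det_fin_three]
      ring
  · intro k hk
    obtain rfl : k = 4 := by revert hk; revert k; decide
    refine exists_signature_of_semidirect h (triangular 1 1 1 0 0 0) 0 1 0 0 0 0 0
      (triangular_eq_zero _ _ _ _ _ _) (by simp [triangular]) ?_
      (signature_semidirect_of_det_eq_zero (by ring) (by norm_num)
        (by simp [semidirectBlock, Matrix.det_fin_three]) (semidirectNorm_pos_of_ne (by simp)))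
    constructor <;> simp [triangular]

/-- Diagonal action with distinct eigenvalues. -/
theorem realizesExactly_diagonal {u : Module.Basis (Fin 4) ℝ L} {d a g : ℝ}
    (h : HasRelations u (semidirect d 0 0 a 0 0 g)) (hd : d ≠ 0) (hda : d ≠ a) (hdg : d ≠ g)
    (hag : a ≠ g) (htr : d + a + g = 0) : RealizesExactly L {3, 5, 6, 7} := by
  apply realizesExactly_of
  · intro Q
    obtain ⟨X, d', x', y', a', b', c', g', hX, hc, hQ⟩ := exists_semidirect_frame Q h
    have hd' : d' ≠ 0 := by
      rw [hc.eq_d]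
      exact mul_ne_zero (hX 3).ne' hd
    rcases signature_semidirect (x := x') (y := y') (b := b') (c := c') (hc.trace hX htr)
      (by positivity) with h1 | h1 | h1 | h1
    · exact ⟨2, by decide, (hQ _).2 h1⟩
    · exact ⟨4, by decide, (hQ _).2 h1⟩
    · exact ⟨5, by decide, (hQ _).2 h1⟩
    · exact ⟨6, by decide, (hQ _).2 h1.2⟩
  · have key : ∀ (x b : ℝ) (s : Fin 4 → SignType),
        HasMatrixSignature (semidirect d x 0 a b 0 g).ricMatrix s →
        ∃ Q : InnerProd L, HasSignature Q.ricciOperator s := by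
      intro x b s hs
      have h1 : d - a ≠ 0 := sub_ne_zero.2 hda
      have h2 : a - g ≠ 0 := sub_ne_zero.2 hag
      have h3 : d - g ≠ 0 := sub_ne_zero.2 hdg
      -- An upper triangular matrix with distinct diagonal entries is conjugate to its diagonal by a
      -- unipotent matrix, so the entries x and b can be prescribed.
      refine exists_signature_of_semidirect h
        (triangular 1 1 1 (x / (d - a)) (b / (a - g)) (b * (x / (d - a)) / (d - g)))
        d x 0 a b 0 g (triangular_eq_zero _ _ _ _ _ _) (by simp [triangular]) ?_ hs
      constructor <;> simp [triangular] <;> field_simp <;> ring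
    have hτ : ∀ x b : ℝ, 0 < d ^ 2 + a ^ 2 + g ^ 2 + (x ^ 2 + 0 ^ 2 + (b + 0) ^ 2) / 2 :=
      fun x b => by positivity
    -- For x, b ≠ 0 the determinant has the sign of x² - b² + K, and 2 + |K| is large enough to
    -- outweigh K together with a 1.
    set K := (d - a) ^ 2 - (a - g) ^ 2 with hK
    have hK1 := le_abs_self K
    have hK2 := neg_abs_le K
    have hK3 := abs_nonneg K
    intro k hk
    have hk' : k = 2 ∨ k = 4 ∨ k = 5 ∨ k = 6 := by revert hk; revert k; decide
    rcases hk' with rfl | rfl | rfl | rfl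
    · refine key (2 + |K|) 1 _ (signature_semidirect_of_det_pos htr (hτ _ _) ?_)
      rw [det_semidirectBlock_upper]
      have : 0 < (2 + |K|) ^ 2 - 1 ^ 2 + (d - a) ^ 2 - (a - g) ^ 2 := by nlinarith
      positivity
    · refine key 1 0 _ (signature_semidirect_of_det_eq_zero htr (hτ _ _) ?_
        (semidirectNorm_pos_of_ne one_ne_zero))
      rw [det_semidirectBlock_upper]
      ring
    · refine key 1 (2 + |K|) _ (signature_semidirect_of_det_neg htr (hτ _ _) ?_)
      rw [det_semidirectBlock_upper]
      have : 1 ^ 2 - (2 + |K|) ^ 2 + (d - a) ^ 2 - (a - g) ^ 2 < 0 := by nlinarith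
      exact mul_neg_of_pos_of_neg (by positivity) this
    · refine key 0 0 _ (signature_semidirect_of_norm_eq_zero htr (hτ _ _) ?_)
      unfold semidirectNorm
      ring

/-- Nilpotent action of rank two. -/
theorem realizesExactly_rank_two {u : Module.Basis (Fin 4) ℝ L}
    (h : HasRelations u (semidirect 0 1 0 0 1 0 0)) : RealizesExactly L {3, 5, 6} := by
  apply realizesExactly_of
  · intro Q
    obtain ⟨X, d, x, y, a, b, c, g, hX, hc, hQ⟩ := exists_semidirect_frame Q h
    have htr := hc.trace hX (by ring)
    obtain ⟨e1, e2, e3, e4, e5, e6, e7⟩ := hc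
    have h0 := hX 0
    have h1 := hX 1
    have h2 := hX 2
    have h3 := hX 3
    obtain rfl : d = 0 := by simpa using e1
    obtain rfl : c = 0 := by simpa [h2.ne'] using e2
    obtain rfl : a = 0 := by simpa [h1.ne'] using e3
    have hx : x ≠ 0 := by
      rintro rfl
      have : X 3 3 * X 1 1 = 0 := by linarith
      exact (mul_pos h3 h1).ne' this
    rcases signature_semidirect (x := x) (y := y) (b := b) (c := 0) htr
      (by positivity) with h1 | h1 | h1 | h1
    · exact ⟨2, by decide, (hQ _).2 h1⟩
    · exact ⟨4, by decide, (hQ _).2 h1⟩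
    · exact ⟨5, by decide, (hQ _).2 h1⟩
    · exact absurd h1.1 (semidirectNorm_pos_of_ne hx).ne'
  · have key : ∀ (x b : ℝ), x ≠ 0 → b ≠ 0 → ∀ (s : Fin 4 → SignType),
        HasMatrixSignature (semidirect 0 x 0 0 b 0 0).ricMatrix s →
        ∃ Q : InnerProd L, HasSignature Q.ricciOperator s := by
      intro x b hx hb s hs
      -- Rescaling a Jordan basis gives any nonzero superdiagonal entries x and b.
      refine exists_signature_of_semidirect h
        (triangular 1 x (x * b) 0 0 0)
        0 x 0 0 b 0 0 (triangular_eq_zero _ _ _ _ _ _) (by simp [triangular, hx, hb]) ?_ hs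
      constructor <;> simp [triangular]; ring
    intro k hk
    have hk' : k = 2 ∨ k = 4 ∨ k = 5 := by revert hk; revert k; decide
    -- With zero diagonal the determinant has the sign of x² - b².
    rcases hk' with rfl | rfl | rfl
    · refine key 2 1 two_ne_zero one_ne_zero _
        (signature_semidirect_of_det_pos (by ring) (by norm_num) ?_)
      rw [det_semidirectBlock_upper]
      norm_num
    · refine key 1 1 one_ne_zero one_ne_zero _
        (signature_semidirect_of_det_eq_zero (by ring) (by norm_num) ?_
          (semidirectNorm_pos_of_ne one_ne_zero))
      rw [det_semidirectBlock_upper]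
      norm_num
    · refine key 1 2 one_ne_zero two_ne_zero _
        (signature_semidirect_of_det_neg (by ring) (by norm_num) ?_)
      rw [det_semidirectBlock_upper]
      norm_num

/-- Action with a double eigenvalue that is not diagonalizable. -/
theorem realizesExactly_jordan {u : Module.Basis (Fin 4) ℝ L}
    (h : HasRelations u (semidirect 1 1 0 1 0 0 (-2))) : RealizesExactly L {3, 5, 6} := by
  apply realizesExactly_of
  · intro Q
    obtain ⟨X, d, x, y, a, b, c, g, hX, hc, hQ⟩ := exists_semidirect_frame Q h
    have htr := hc.trace hX (by ring)
    obtain ⟨e1, e2, e3, e4, e5, e6, e7⟩ := hc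
    have h0 := hX 0
    have h1 := hX 1
    have h2 := hX 2
    have h3 := hX 3
    obtain rfl : c = 0 := by simpa [h2.ne'] using e2
    obtain rfl : a = X 3 3 := by
      have : (a - X 3 3) * X 1 1 = 0 := by linarith
      linarith [(mul_eq_zero.1 this).resolve_right h1.ne']
    -- The Jordan block survives in every adapted frame, which excludes normality and hence number
    -- 7.
    have hx : x ≠ 0 := by
      rintro rfl
      have : X 3 3 * X 1 1 = 0 := by linarith
      exact (mul_pos h3 h1).ne' this
    rcases signature_semidirect (x := x) (y := y) (b := b) (c := 0) htr
      (by positivity) with h1 | h1 | h1 | h1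
    · exact ⟨2, by decide, (hQ _).2 h1⟩
    · exact ⟨4, by decide, (hQ _).2 h1⟩
    · exact ⟨5, by decide, (hQ _).2 h1⟩
    · exact absurd h1.1 (semidirectNorm_pos_of_ne hx).ne'
  · have key : ∀ (x b : ℝ), x ≠ 0 → ∀ (s : Fin 4 → SignType),
        HasMatrixSignature (semidirect 1 x 0 1 b 0 (-2)).ricMatrix s →
        ∃ Q : InnerProd L, HasSignature Q.ricciOperator s := by
      intro x b hx s hs
      -- The denominators come from the gap 3 between the eigenvalues 1 and -2.
      refine exists_signature_of_semidirect h
        (triangular 1 x 1 0 (b * x / 3) (-(b * x / 9)))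
        1 x 0 1 b 0 (-2) (triangular_eq_zero _ _ _ _ _ _) (by simp [triangular, hx]) ?_ hs
      constructor <;> simp [triangular] <;> ring
    intro k hk
    have hk' : k = 2 ∨ k = 4 ∨ k = 5 := by revert hk; revert k; decide
    -- The determinant is x²b²(x² - b² - 9).
    rcases hk' with rfl | rfl | rfl
    · refine key 4 1 four_ne_zero _
        (signature_semidirect_of_det_pos (by ring) (by norm_num) ?_)
      rw [det_semidirectBlock_upper]
      norm_num
    · refine key 1 0 one_ne_zero _
        (signature_semidirect_of_det_eq_zero (by ring) (by norm_num) ?_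
          (semidirectNorm_pos_of_ne one_ne_zero))
      rw [det_semidirectBlock_upper]
      norm_num
    · refine key 1 1 one_ne_zero _
        (signature_semidirect_of_det_neg (by ring) (by norm_num) ?_)
      rw [det_semidirectBlock_upper]
      norm_num

/-- Diagonalizable action with a double eigenvalue. -/
theorem realizesExactly_double {u : Module.Basis (Fin 4) ℝ L}
    (h : HasRelations u (semidirect (-1 / 2) 0 0 (-1 / 2) 0 0 1)) : RealizesExactly L {5, 7} := by
  apply realizesExactly_of
  · intro Q
    obtain ⟨X, d, x, y, a, b, c, g, hX, hc, hQ⟩ := exists_semidirect_frame Q h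
    have htr := hc.trace hX (by norm_num)
    obtain ⟨e1, e2, e3, e4, e5, e6, e7⟩ := hc
    have h0 := hX 0
    have h1 := hX 1
    have h2 := hX 2
    have h3 := hX 3
    obtain rfl : c = 0 := by simpa [h2.ne'] using e2
    obtain rfl : a = d := by
      have : (a - d) * X 1 1 = 0 := by linear_combination e3 - X 1 1 * e1
      linarith [(mul_eq_zero.1 this).resolve_right h1.ne']
    obtain rfl : x = 0 := by
      have : x * X 0 0 = 0 := by linear_combination e4 - X 1 0 * e1
      exact (mul_eq_zero.1 this).resolve_right h0.ne'
    have ha : a ≠ 0 := by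
      rw [e1]
      exact mul_ne_zero h3.ne' (by norm_num)
    have hτ : 0 < a ^ 2 + a ^ 2 + g ^ 2 + ((0 : ℝ) ^ 2 + y ^ 2 + (b + 0) ^ 2) / 2 := by positivity
    rcases (semidirectNorm_nonneg a 0 y a b 0 g).eq_or_lt' with hn | hn
    · exact ⟨6, by decide, (hQ _).2 (signature_semidirect_of_norm_eq_zero htr hτ hn)⟩
    -- The first two frame vectors span the double eigenspace, so D - a·1 has rank at most one. Its
    -- commutator with its transpose, which equals [D, Dᵀ], is therefore singular.
    · refine ⟨4, by decide, (hQ _).2 (signature_semidirect_of_det_eq_zero htr hτ ?_ hn)⟩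
      simp [semidirectBlock, Matrix.det_fin_three]
      ring
  · have key : ∀ (b : ℝ) (s : Fin 4 → SignType),
        HasMatrixSignature (semidirect (-1 / 2) 0 0 (-1 / 2) b 0 1).ricMatrix s →
        ∃ Q : InnerProd L, HasSignature Q.ricciOperator s := by
      intro b s hs
      refine exists_signature_of_semidirect h
        (triangular 1 1 1 0 (-(2 / 3) * b) 0)
        (-1 / 2) 0 0 (-1 / 2) b 0 1 (triangular_eq_zero _ _ _ _ _ _) (by simp [triangular]) ?_ hs
      constructor <;> simp [triangular]
      ring
    intro k hk
    have hk' : k = 4 ∨ k = 6 := by revert hk; revert k; decide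
    rcases hk' with rfl | rfl
    · refine key 1 _ (signature_semidirect_of_det_eq_zero (by norm_num) (by norm_num) ?_ ?_)
      · rw [det_semidirectBlock_upper]
        norm_num
      · norm_num [semidirectNorm]
    · refine key 0 _ (signature_semidirect_of_norm_eq_zero (by norm_num) (by norm_num) ?_)
      norm_num [semidirectNorm]

theorem det_semidirectBlock_complex (x β k : ℝ) (hk : k ≠ 0) :
    (semidirectBlock (-2 * β) x 0 β k (-1 / k) β).det =
      x ^ 2 * (x ^ 2 * k ^ 2 - (k ^ 2 - 1 / k ^ 2) * (k ^ 2 - (3 * β) ^ 2)) := by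
  simp [semidirectBlock, Matrix.det_fin_three]
  field_simp
  ring

/-- Stretching one axis of the rotation plane by k deforms the entries 1, -1 to k, -1/k. Since -2β
is not an eigenvalue of the complex block, x can be prescribed by solving a linear system of
determinant (3β)² + 1. -/
theorem exists_signature_complex {u : Module.Basis (Fin 4) ℝ L} {β : ℝ}
    (h : HasRelations u (semidirect (-2 * β) 0 0 β 1 (-1) β)) (x k : ℝ) (hk : k ≠ 0)
    {s : Fin 4 → SignType}
    (hs : HasMatrixSignature (semidirect (-2 * β) x 0 β k (-1 / k) β).ricMatrix s) :
    ∃ Q : InnerProd L, HasSignature Q.ricciOperator s := by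
  have h1 : (3 * β) ^ 2 + 1 ≠ 0 := by positivity
  refine exists_signature_of_semidirect h
    (triangular 1 1 k (-(3 * β * x) / ((3 * β) ^ 2 + 1)) 0 (k * x / ((3 * β) ^ 2 + 1)))
    (-2 * β) x 0 β k (-1 / k) β
    (triangular_eq_zero _ _ _ _ _ _) (by simp [triangular, hk]) ?_ hs
  constructor <;> simp [triangular] <;> field_simp <;> ring

/-- The value β = 0 is admitted so that the infinitesimal rotations are covered too. -/
theorem exists_signature_complex_of_mem {u : Module.Basis (Fin 4) ℝ L} {β : ℝ}
    (h : HasRelations u (semidirect (-2 * β) 0 0 β 1 (-1) β)) (hβ : 0 ≤ β) (k : Fin 15)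
    (hk : k = 2 ∨ k = 4 ∨ k = 5) :
    ∃ Q : InnerProd L, HasSignature Q.ricciOperator (signatureItem k) := by
  have htr : -2 * β + β + β = 0 := by ring
  rcases hk with rfl | rfl | rfl
  · refine exists_signature_complex h 1 1 one_ne_zero
      (signature_semidirect_of_det_pos htr (by positivity) ?_)
    rw [det_semidirectBlock_complex _ _ _ one_ne_zero]
    norm_num
  · refine exists_signature_complex h 0 2 two_ne_zero
      (signature_semidirect_of_det_eq_zero htr ?_ ?_ ?_)
    · have := sq_nonneg β
      nlinarith
    · rw [det_semidirectBlock_complex _ _ _ two_ne_zero]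
      ring
    · norm_num [semidirectNorm]
      positivity
  -- With k = 2 + 3β and x = 1/k the second factor of the determinant is at most 1 - 3·4.
  · have hk : (2 + 3 * β) ≠ 0 := by positivity
    refine exists_signature_complex h (1 / (2 + 3 * β)) (2 + 3 * β) hk
      (signature_semidirect_of_det_neg htr (by positivity) ?_)
    rw [det_semidirectBlock_complex _ _ _ hk]
    refine mul_neg_of_pos_of_neg (by positivity) ?_
    have h1 : (1 / (2 + 3 * β)) ^ 2 * (2 + 3 * β) ^ 2 = 1 := by field_simp
    have h2 : 1 / (2 + 3 * β) ^ 2 ≤ 1 := by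
      rw [div_le_one (by positivity)]
      nlinarith
    rw [h1]
    have h3 : 3 ≤ (2 + 3 * β) ^ 2 - 1 / (2 + 3 * β) ^ 2 := by nlinarith
    have h4 : 4 ≤ (2 + 3 * β) ^ 2 - (3 * β) ^ 2 := by nlinarith
    nlinarith

/-- Action with a pair of complex eigenvalues. -/
theorem realizesExactly_complex {u : Module.Basis (Fin 4) ℝ L} {β : ℝ} (hβ : 0 < β)
    (h : HasRelations u (semidirect (-2 * β) 0 0 β 1 (-1) β)) :
    RealizesExactly L {3, 5, 6, 7} := by
  apply realizesExactly_of
  · intro Q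
    obtain ⟨X, d', x', y', a', b', c', g', hX, hc, hQ⟩ := exists_semidirect_frame Q h
    have hd' : d' ≠ 0 := by
      rw [hc.eq_d]
      exact mul_ne_zero (hX 3).ne' (by linarith : -2 * β < 0).ne
    rcases signature_semidirect (x := x') (y := y') (b := b') (c := c') (hc.trace hX (by ring))
      (by positivity) with h1 | h1 | h1 | h1
    · exact ⟨2, by decide, (hQ _).2 h1⟩
    · exact ⟨4, by decide, (hQ _).2 h1⟩
    · exact ⟨5, by decide, (hQ _).2 h1⟩
    · exact ⟨6, by decide, (hQ _).2 h1.2⟩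
  · intro k hk
    have hk' : (k = 2 ∨ k = 4 ∨ k = 5) ∨ k = 6 := by revert hk; revert k; decide
    rcases hk' with hk' | rfl
    · exact exists_signature_complex_of_mem h hβ.le k hk'
    · refine exists_signature_complex h 0 1 one_ne_zero
        (signature_semidirect_of_norm_eq_zero (by ring) (by positivity) ?_)
      norm_num [semidirectNorm]

/-- Normality gives x = y = 0, b² = c² and a(c - b) = 0, and bc < 0 excludes b = c. So the action is
skew, and number 7 cannot occur for rotations. -/
theorem rotation_of_semidirectNorm {x y a b c : ℝ} (hn : semidirectNorm 0 x y a b c (-a) = 0)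
    (hbc : b * c < 0) : x = 0 ∧ y = 0 ∧ a = 0 ∧ b + c = 0 := by
  unfold semidirectNorm at hn
  have h0 : x ^ 2 + y ^ 2 = 0 := by
    have := sq_nonneg (b ^ 2 - x ^ 2 - c ^ 2)
    have := sq_nonneg (c ^ 2 - y ^ 2 - b ^ 2)
    have := sq_nonneg (x * a + y * b - 0 * x)
    have := sq_nonneg (x * c + y * -a - 0 * y)
    have := sq_nonneg (a * c + b * -a - x * y - a * b - c * -a)
    have h1 : (x ^ 2 + y ^ 2) ^ 2 ≤ 0 := by linarith
    exact pow_eq_zero_iff two_ne_zero |>.1 (le_antisymm h1 (sq_nonneg _))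
  obtain rfl : x = 0 := by nlinarith [sq_nonneg x, sq_nonneg y]
  obtain rfl : y = 0 := by nlinarith [sq_nonneg y]
  have h2 : (b ^ 2 - c ^ 2) ^ 2 + (2 * a * (c - b)) ^ 2 = 0 := by linear_combination hn
  have h3 : b ^ 2 - c ^ 2 = 0 := by
    have h1 : (b ^ 2 - c ^ 2) ^ 2 ≤ 0 := by linarith [sq_nonneg (2 * a * (c - b))]
    exact pow_eq_zero_iff two_ne_zero |>.1 (le_antisymm h1 (sq_nonneg _))
  have h4 : 2 * a * (c - b) = 0 := by
    rw [h3] at h2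
    simpa using h2
  have h5 : b - c ≠ 0 := by
    intro h
    obtain rfl : b = c := by linarith
    linarith [mul_self_nonneg b]
  have h6 : b + c = 0 := by
    have : (b - c) * (b + c) = 0 := by linarith
    exact (mul_eq_zero.1 this).resolve_left h5
  have h7 : a = 0 := by
    have : a * (b - c) = 0 := by linarith
    exact (mul_eq_zero.1 this).resolve_right h5
  exact ⟨rfl, rfl, h7, h6⟩

/-- Action by infinitesimal rotations. -/
theorem realizesExactly_rotation {u : Module.Basis (Fin 4) ℝ L}
    (h : HasRelations u (semidirect 0 0 0 0 1 (-1) 0)) : RealizesExactly L {3, 5, 6, 11} := by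
  have h' : HasRelations u (semidirect (-2 * 0) 0 0 0 1 (-1) 0) := by rwa [mul_zero]
  apply realizesExactly_of
  · intro Q
    obtain ⟨X, d, x, y, a, b, c, g, hX, hc, hQ⟩ := exists_semidirect_frame Q h
    have htr := hc.trace hX (by ring)
    obtain ⟨e1, e2, e3, e4, e5, e6, e7⟩ := hc
    have h1 := hX 1
    have h2 := hX 2
    have h3 := hX 3
    obtain rfl : d = 0 := by simpa using e1
    obtain rfl : g = -a := by linarith
    -- The determinant of the rotation block is 1 and is multiplied by the square of `X 3 3`; it
    -- follows that bc < 0.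
    have hdet : -(a ^ 2) - b * c = X 3 3 ^ 2 := by
      have hne : X 1 1 * X 2 2 ≠ 0 := mul_ne_zero h1.ne' h2.ne'
      refine mul_right_cancel₀ hne ?_
      linear_combination -(X 2 2 * a) * e3 - c * X 2 2 * e6 - X 3 3 * X 2 2 * e2
    have hbc : b * c < 0 := by nlinarith [sq_nonneg a, pow_pos h3 2]
    -- The sum vanishes exactly when D is skew, in which case the Ricci operator is zero.
    rcases (by positivity : 0 ≤ 0 ^ 2 + a ^ 2 + (-a) ^ 2 + (x ^ 2 + y ^ 2 + (b + c) ^ 2) / 2).eq_or_lt'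
      with hτ | hτ
    · have ha : a = 0 := by nlinarith [sq_nonneg a, sq_nonneg x, sq_nonneg y, sq_nonneg (b + c)]
      have hx : x = 0 := by nlinarith [sq_nonneg a, sq_nonneg x, sq_nonneg y, sq_nonneg (b + c)]
      have hy : y = 0 := by nlinarith [sq_nonneg a, sq_nonneg x, sq_nonneg y, sq_nonneg (b + c)]
      have hb : b + c = 0 := by
        nlinarith [sq_nonneg a, sq_nonneg x, sq_nonneg y, sq_nonneg (b + c)]
      refine ⟨10, by decide, (hQ _).2 (signature_semidirect_of_flat htr hτ ?_)⟩
      obtain rfl : c = -b := by linarith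
      subst ha hx hy
      unfold semidirectNorm
      ring
    · rcases signature_semidirect htr hτ with h1 | h1 | h1 | h1
      · exact ⟨2, by decide, (hQ _).2 h1⟩
      · exact ⟨4, by decide, (hQ _).2 h1⟩
      · exact ⟨5, by decide, (hQ _).2 h1⟩
      · exfalso
        obtain ⟨rfl, rfl, rfl, hb⟩ := rotation_of_semidirectNorm h1.1 (by nlinarith)
        rw [hb] at hτ
        norm_num at hτ
  · intro k hk
    have hk' : (k = 2 ∨ k = 4 ∨ k = 5) ∨ k = 10 := by revert hk; revert k; decide
    rcases hk' with hk' | rfl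
    · exact exists_signature_complex_of_mem h' le_rfl k hk'
    · refine exists_signature_complex h' 0 1 one_ne_zero
        (signature_semidirect_of_flat (by ring) (by norm_num) ?_)
      norm_num [semidirectNorm]

end

/-! ### Extensions of the Heisenberg algebra -/

/-- Unimodular extensions of the Heisenberg algebra: `f₁` is central, `[f₂, f₃] = l f₁`, and `f₄`
acts on `f₂, f₃` without trace. -/
def heisenbergExt (l p a b q c : ℝ) : Relations where
  b23 := ![l, 0, 0, 0]
  b24 := ![p, a, b, 0]
  b34 := ![q, c, -a, 0]

set_option maxHeartbeats 1000000 in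
theorem ricMatrix_heisenbergExt (l p a b q c : ℝ) :
    (heisenbergExt l p a b q c).ricMatrix =
      !![(l ^ 2 + p ^ 2 + q ^ 2) / 2, (a * p + c * q) / 2, (b * p - a * q) / 2, 0;
        (a * p + c * q) / 2, (c ^ 2 - b ^ 2 - p ^ 2 - l ^ 2) / 2, (2 * a * (b - c) - p * q) / 2,
          q * l / 2;
        (b * p - a * q) / 2, (2 * a * (b - c) - p * q) / 2, (b ^ 2 - c ^ 2 - q ^ 2 - l ^ 2) / 2,
          -p * l / 2;
        0, q * l / 2, -p * l / 2, -(4 * a ^ 2 + (b + c) ^ 2 + p ^ 2 + q ^ 2) / 2] := by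
  ext i j
  fin_cases i <;> fin_cases j <;>
    simp only [Relations.ricMatrix, Relations.ric, Relations.christoffel, Relations.const,
      heisenbergExt, Fin.sum_univ_four, Matrix.of_apply, Matrix.cons_val, Pi.neg_apply,
      Pi.zero_apply, Fin.zero_eta, Fin.mk_one, Fin.reduceFinMk, Fin.isValue] <;> ring

theorem ricMatrix_heisenbergExt_isSymm (l p a b q c : ℝ) :
    (heisenbergExt l p a b q c).ricMatrix.IsSymm := by
  rw [ricMatrix_heisenbergExt]
  ext i j
  fin_cases i <;> fin_cases j <;> simp

/-- A quadratic form without trace on the plane has a nonzero null vector. -/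
theorem exists_null_vector (m n : ℝ) :
    ∃ x y : ℝ, (x ≠ 0 ∨ y ≠ 0) ∧ x ^ 2 * m + 2 * (x * y) * n - y ^ 2 * m = 0 := by
  by_cases hm : m = 0
  · exact ⟨1, 0, by simp, by simp [hm]⟩
  · refine ⟨m, n + Real.sqrt (m ^ 2 + n ^ 2), Or.inl hm, ?_⟩
    have h := Real.mul_self_sqrt (by positivity : 0 ≤ m ^ 2 + n ^ 2)
    linear_combination (-m) * h

/-- The center is a positive direction. If f₄ acts on the quotient plane by a skew map, Ric is
negative definite on ⟨f₂, f₃⟩. Otherwise a negative definite plane is spanned by f₄ and a null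
vector of the traceless part contributed by that action. -/
theorem signature_heisenbergExt {l p a b q c : ℝ} (hl : l ≠ 0) {s : Fin 4 → SignType}
    (hs : HasMatrixSignature (heisenbergExt l p a b q c).ricMatrix s) : s 1 = -1 ∧ s 3 = 1 := by
  have hsymm := ricMatrix_heisenbergExt_isSymm l p a b q c
  constructor
  · by_cases h0 : 4 * a ^ 2 + (b + c) ^ 2 = 0
    · have ha : a = 0 := by nlinarith [sq_nonneg a, sq_nonneg (b + c)]
      obtain rfl : c = -b := by nlinarith [sq_nonneg a, sq_nonneg (b + c)]
      subst ha
      refine second_of_neg hsymm hs ![0, 1, 0, 0] ![0, 0, 1, 0] fun α β h => ?_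
      rw [ricMatrix_heisenbergExt]
      have h1 : 0 < α ^ 2 + β ^ 2 := by rcases h with h | h <;> positivity
      have h2 : 0 < l ^ 2 * (α ^ 2 + β ^ 2) := by positivity
      simp [Matrix.mulVec, dotProduct, Fin.sum_univ_four]
      nlinarith [sq_nonneg (p * α + q * β)]
    · have hσ : 0 < 4 * a ^ 2 + (b + c) ^ 2 := lt_of_le_of_ne (by positivity) (Ne.symm h0)
      obtain ⟨x, y, hxy, hnull⟩ := exists_null_vector (c ^ 2 - b ^ 2) (2 * a * (b - c))
      -- On this plane minus twice the form is the sum `h1` of squares plus (β(px + qy))².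
      refine second_of_neg hsymm hs ![0, 0, 0, 1] ![0, x, y, 0] fun α β h => ?_
      rw [ricMatrix_heisenbergExt]
      have h1 : 0 < α ^ 2 * (4 * a ^ 2 + (b + c) ^ 2) + (α * q - β * l * x) ^ 2 +
          (α * p + β * l * y) ^ 2 := by
        by_cases hα : α = 0
        · have hβ : β ≠ 0 := by simpa [hα] using h
          rw [hα]
          have : 0 < (β * l) ^ 2 * (x ^ 2 + y ^ 2) := by
            have : 0 < x ^ 2 + y ^ 2 := by rcases hxy with h | h <;> positivity
            positivity
          linarith
        · positivity
      simp [Matrix.mulVec, dotProduct, Fin.sum_univ_four]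
      have h2 := sq_nonneg (β * (p * x + q * y))
      have h3 : β ^ 2 * (x ^ 2 * (c ^ 2 - b ^ 2) + 2 * (x * y) * (2 * a * (b - c)) -
        y ^ 2 * (c ^ 2 - b ^ 2)) = 0 := by rw [hnull, mul_zero]
      linarith
  · refine last_of_pos hsymm hs ![1, 0, 0, 0] ?_
    rw [ricMatrix_heisenbergExt]
    simp [Matrix.mulVec, dotProduct, Fin.sum_univ_four]
    positivity

theorem eval_charpoly_heisenbergExt (l b c z : ℝ) :
    (heisenbergExt l 0 0 b 0 c).ricMatrix.charpoly.eval z =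
      (z - l ^ 2 / 2) * (z - (c ^ 2 - b ^ 2 - l ^ 2) / 2) * (z - (b ^ 2 - c ^ 2 - l ^ 2) / 2) *
        (z - -(b + c) ^ 2 / 2) := by
  rw [Matrix.eval_charpoly, ricMatrix_heisenbergExt, Matrix.det_succ_row_zero]
  simp [Fin.sum_univ_four, Matrix.det_fin_three, Fin.succAbove]
  ring

section

variable {L : Type*} [LieRing L] [LieAlgebra ℝ L]

theorem HasRelations.heisenbergExt_frame {u : Fin 4 → L} {X : Fin 4 → Fin 4 → ℝ}
    {l p a b q c : ℝ} (h : HasRelations u (heisenbergExt l p a b q c)) (hX : ∀ i, 0 < X i i)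
    (htri : ∀ i j, i < j → X i j = 0) :
    ∃ p' a' b' q' c', HasRelations (RicciSignature.frame u X)
      (heisenbergExt (X 1 1 * X 2 2 * l / X 0 0) p' a' b' q' c') := by
  have h01 := htri 0 1 (by decide)
  have h02 := htri 0 2 (by decide)
  have h03 := htri 0 3 (by decide)
  have h12 := htri 1 2 (by decide)
  have h13 := htri 1 3 (by decide)
  have h23 := htri 2 3 (by decide)
  have n0 := (hX 0).ne'
  have n1 := (hX 1).ne'
  have n2 := (hX 2).ne'
  set b' := X 1 1 * X 3 3 * b / X 2 2
  set a' := (X 1 1 * X 3 3 * a - b' * X 2 1) / X 1 1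
  set p' := (X 1 1 * (X 3 2 * l + X 3 3 * p) - a' * X 1 0 - b' * X 2 0) / X 0 0
  set c' := (X 3 3 * (X 2 1 * a + X 2 2 * c) + a' * X 2 1) / X 1 1
  set q' := (X 2 1 * X 3 2 * l + X 2 1 * X 3 3 * p - X 2 2 * X 3 1 * l + X 2 2 * X 3 3 * q -
    c' * X 1 0 + a' * X 2 0) / X 0 0
  have eb : b' * X 2 2 = X 1 1 * X 3 3 * b := div_mul_cancel₀ _ n2
  have ea : a' * X 1 1 = X 1 1 * X 3 3 * a - b' * X 2 1 := div_mul_cancel₀ _ n1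
  have ep : p' * X 0 0 = X 1 1 * (X 3 2 * l + X 3 3 * p) - a' * X 1 0 - b' * X 2 0 :=
    div_mul_cancel₀ _ n0
  have ec : c' * X 1 1 = X 3 3 * (X 2 1 * a + X 2 2 * c) + a' * X 2 1 := div_mul_cancel₀ _ n1
  have eq : q' * X 0 0 = X 2 1 * X 3 2 * l + X 2 1 * X 3 3 * p - X 2 2 * X 3 1 * l +
    X 2 2 * X 3 3 * q - c' * X 1 0 + a' * X 2 0 := div_mul_cancel₀ _ n0
  -- The new action on the quotient plane is again traceless, so its second diagonal entry is -a'.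
  have ea' : a' * X 2 2 = X 3 3 * (a * X 2 2 - b * X 2 1) := by
    refine mul_right_cancel₀ n1 ?_
    linear_combination X 2 2 * ea - X 2 1 * eb
  refine ⟨p', a', b', q', c', ?_⟩
  apply h.frame
  all_goals funext k
  · fin_cases k <;> simp [heisenbergExt, Relations.bracket, *]
  · fin_cases k <;> simp [heisenbergExt, Relations.bracket, *]
  · fin_cases k <;> simp [heisenbergExt, Relations.bracket, h01, h02, h03]
  · fin_cases k <;>
      simp [heisenbergExt, Relations.bracket, Fin.sum_univ_four, h01, h02, h03, h12, h13, h23]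
    field_simp
  · fin_cases k <;>
      simp [heisenbergExt, Relations.bracket, Fin.sum_univ_four, h01, h02, h03, h12, h13, h23] <;>
      linarith
  · fin_cases k <;>
      simp [heisenbergExt, Relations.bracket, Fin.sum_univ_four, h01, h02, h03, h12, h13, h23] <;>
      linarith

variable [FiniteDimensional ℝ L]

theorem signature_of_heisenbergExt (Q : InnerProd L) {u : Module.Basis (Fin 4) ℝ L}
    {l p a b q c : ℝ} (h : HasRelations u (heisenbergExt l p a b q c)) (hl : l ≠ 0)
    {s : Fin 4 → SignType} (hs : HasSignature Q.ricciOperator s) : s 1 = -1 ∧ s 3 = 1 := by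
  obtain ⟨X, hX, hpos, htri⟩ := exists_triangular_frame Q u
  obtain ⟨p', a', b', q', c', hr⟩ := h.heisenbergExt_frame hpos htri
  obtain ⟨f, hf⟩ := hX.exists_basis u
  rw [← hf] at hX hr
  exact signature_heisenbergExt
    (div_ne_zero (mul_ne_zero (mul_pos (hpos 1) (hpos 2)).ne' hl) (hpos 0).ne')
    ((hasSignature_iff hX hr s).1 hs)

theorem realizesExactly_heisenbergExt {u : Module.Basis (Fin 4) ℝ L} {ε : ℝ}
    (hε : ε = 1 ∨ ε = -1) (h : HasRelations u (heisenbergExt 1 0 0 ε 0 1)) :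
    RealizesExactly L {3, 5, 6} := by
  -- Doubling f₃ makes c² - b² = 15/4 for both signs ε, and rescaling the center makes l arbitrary.
  -- The eigenvalue (15/4 - l²)/2 is the only one whose sign changes with l.
  have key : ∀ l : ℝ, l ≠ 0 → ∀ s : Fin 4 → SignType,
      HasMatrixSignature (heisenbergExt l 0 0 (ε / 2) 0 2).ricMatrix s →
      ∃ Q : InnerProd L, HasSignature Q.ricciOperator s := by
    intro l hl s hs
    refine exists_signature_of_frame u (x := ![![2 / l, 0, 0, 0], ![0, 1, 0, 0], ![0, 0, 2, 0],
      ![0, 0, 0, 1]]) ?_ ?_ hs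
    · rw [det_of_triangular]
      · simp [hl]
      · intro i j hij
        fin_cases i <;> fin_cases j <;> first | (exact absurd hij (by decide)) | rfl
    · apply h.frame <;> funext k <;> fin_cases k <;>
        simp [heisenbergExt, Relations.bracket, Fin.sum_univ_four]
      field_simp
  have hε2 : ε ^ 2 = 1 := by rcases hε with rfl | rfl <;> norm_num
  have hA : -(ε / 2 + 2) ^ 2 / 2 < 0 := by rcases hε with rfl | rfl <;> norm_num
  intro k
  constructor
  · rintro ⟨Q, hQ⟩
    have := signature_of_heisenbergExt Q h one_ne_zero hQ
    clear hQ
    revert this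
    revert k
    decide
  · intro hk
    have hk' : k = 2 ∨ k = 4 ∨ k = 5 := by revert hk; revert k; decide
    rcases hk' with rfl | rfl | rfl
    · refine key 2 two_ne_zero _ (hasMatrixSignature_of_roots
        ![-(ε / 2 + 2) ^ 2 / 2, -1 / 8, -31 / 8, 2] (fun z => ?_) (by decide) fun i => ?_)
      · rw [eval_charpoly_heisenbergExt, Fin.prod_univ_four, div_pow, hε2]
        simp
        ring
      · fin_cases i <;> simp [signatureItem]
        · exact (sign_neg hA).symm
        · exact (sign_neg (by norm_num)).symm
        · exact (sign_neg (by norm_num)).symm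
    · have hs := Real.sq_sqrt (by norm_num : (0 : ℝ) ≤ 15 / 4)
      refine key (Real.sqrt (15 / 4)) (by positivity) _ (hasMatrixSignature_of_roots
        ![-(ε / 2 + 2) ^ 2 / 2, -15 / 4, 0, 15 / 8] (fun z => ?_) (by decide) fun i => ?_)
      · rw [eval_charpoly_heisenbergExt, Fin.prod_univ_four, div_pow, hε2, hs]
        simp
        ring
      · fin_cases i <;> simp [signatureItem]
        · exact (sign_neg hA).symm
        · exact (sign_neg (by norm_num)).symm
    · refine key 1 one_ne_zero _ (hasMatrixSignature_of_roots
        ![-(ε / 2 + 2) ^ 2 / 2, -19 / 8, 11 / 8, 1 / 2] (fun z => ?_) (by decide) fun i => ?_)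
      · rw [eval_charpoly_heisenbergExt, Fin.prod_univ_four, div_pow, hε2]
        simp
        ring
      · fin_cases i <;> simp [signatureItem]
        · exact (sign_neg hA).symm
        · exact (sign_neg (by norm_num)).symm

end

/-! ### Metrics on reductive algebras -/

/-- Reductive Lie algebras with a one-dimensional center spanned by `f₄`: for distinct
`i, j, k ≤ 3` in cyclic order, `[fᵢ, fⱼ] = lₖ fₖ + tₖ f₄`. -/
def reductive (l₁ l₂ l₃ t₁ t₂ t₃ : ℝ) : Relations where
  b12 := ![0, 0, l₃, t₃]
  b13 := ![0, -l₂, 0, -t₂]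
  b23 := ![l₁, 0, 0, t₁]

set_option maxHeartbeats 1000000 in
theorem ricMatrix_reductive (l₁ l₂ l₃ t₁ t₂ t₃ : ℝ) :
    (reductive l₁ l₂ l₃ t₁ t₂ t₃).ricMatrix =
      !![(l₁ ^ 2 - (l₂ - l₃) ^ 2 - t₂ ^ 2 - t₃ ^ 2) / 2, t₁ * t₂ / 2, t₁ * t₃ / 2, l₁ * t₁ / 2;
        t₁ * t₂ / 2, (l₂ ^ 2 - (l₃ - l₁) ^ 2 - t₃ ^ 2 - t₁ ^ 2) / 2, t₂ * t₃ / 2, l₂ * t₂ / 2;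
        t₁ * t₃ / 2, t₂ * t₃ / 2, (l₃ ^ 2 - (l₁ - l₂) ^ 2 - t₁ ^ 2 - t₂ ^ 2) / 2, l₃ * t₃ / 2;
        l₁ * t₁ / 2, l₂ * t₂ / 2, l₃ * t₃ / 2, (t₁ ^ 2 + t₂ ^ 2 + t₃ ^ 2) / 2] := by
  ext i j
  fin_cases i <;> fin_cases j <;>
    simp only [Relations.ricMatrix, Relations.ric, Relations.christoffel, Relations.const,
      reductive, Fin.sum_univ_four, Matrix.of_apply, Matrix.cons_val, Pi.neg_apply,
      Pi.zero_apply, Fin.zero_eta, Fin.mk_one, Fin.reduceFinMk, Fin.isValue] <;> ring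

theorem ricMatrix_reductive_isSymm (l₁ l₂ l₃ t₁ t₂ t₃ : ℝ) :
    (reductive l₁ l₂ l₃ t₁ t₂ t₃).ricMatrix.IsSymm := by
  rw [ricMatrix_reductive]
  ext i j
  fin_cases i <;> fin_cases j <;> simp

/-- Replacing the frame by its negative reverses all structure constants. -/
theorem ricMatrix_reductive_neg (l₁ l₂ l₃ t₁ t₂ t₃ : ℝ) :
    (reductive (-l₁) (-l₂) (-l₃) (-t₁) (-t₂) (-t₃)).ricMatrix =
      (reductive l₁ l₂ l₃ t₁ t₂ t₃).ricMatrix := by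
  rw [ricMatrix_reductive, ricMatrix_reductive]
  congr! 5 <;> ring_nf

theorem hasMatrixSignature_submatrix (R : Matrix (Fin 4) (Fin 4) ℝ) (σ : Equiv.Perm (Fin 4))
    (s : Fin 4 → SignType) : HasMatrixSignature (R.submatrix σ σ) s ↔ HasMatrixSignature R s := by
  unfold HasMatrixSignature
  have := Matrix.charpoly_reindex σ.symm R
  rw [Matrix.reindex_apply, Equiv.symm_symm] at this
  rw [this]

/-- Cyclic symmetry. -/
theorem hasMatrixSignature_reductive_cycle {l₁ l₂ l₃ t₁ t₂ t₃ : ℝ} {s : Fin 4 → SignType} :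
    HasMatrixSignature (reductive l₂ l₃ l₁ t₂ t₃ t₁).ricMatrix s ↔
      HasMatrixSignature (reductive l₁ l₂ l₃ t₁ t₂ t₃).ricMatrix s := by
  rw [← hasMatrixSignature_submatrix (reductive l₁ l₂ l₃ t₁ t₂ t₃).ricMatrix
    ⟨![1, 2, 0, 3], ![2, 0, 1, 3], by decide, by decide⟩]
  refine iff_of_eq (congrArg (fun R => HasMatrixSignature R s) ?_)
  rw [ricMatrix_reductive, ricMatrix_reductive]
  ext i j
  fin_cases i <;> fin_cases j <;> simp <;> ring_nf

/-- Symmetry under a transposition. -/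
theorem hasMatrixSignature_reductive_swap {l₁ l₂ l₃ t₁ t₂ t₃ : ℝ} {s : Fin 4 → SignType} :
    HasMatrixSignature (reductive l₁ l₃ l₂ t₁ t₃ t₂).ricMatrix s ↔
      HasMatrixSignature (reductive l₁ l₂ l₃ t₁ t₂ t₃).ricMatrix s := by
  rw [← hasMatrixSignature_submatrix (reductive l₁ l₂ l₃ t₁ t₂ t₃).ricMatrix
    ⟨![0, 2, 1, 3], ![0, 2, 1, 3], by decide, by decide⟩]
  refine iff_of_eq (congrArg (fun R => HasMatrixSignature R s) ?_)
  rw [ricMatrix_reductive, ricMatrix_reductive]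
  ext i j
  fin_cases i <;> fin_cases j <;> simp <;> ring_nf

/-- With t along f₁ the Ricci matrix splits into a block on ⟨f₁, f₄⟩ and two diagonal entries. -/
theorem eval_charpoly_reductive (l₁ l₂ l₃ t z : ℝ) :
    (reductive l₁ l₂ l₃ t 0 0).ricMatrix.charpoly.eval z =
      ((z - (l₁ ^ 2 - (l₂ - l₃) ^ 2) / 2) * (z - t ^ 2 / 2) - l₁ ^ 2 * t ^ 2 / 4) *
        (z - (l₂ ^ 2 - (l₃ - l₁) ^ 2 - t ^ 2) / 2) *
        (z - (l₃ ^ 2 - (l₁ - l₂) ^ 2 - t ^ 2) / 2) := by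
  rw [Matrix.eval_charpoly, ricMatrix_reductive, Matrix.det_succ_row_zero]
  simp [Fin.sum_univ_four, Matrix.det_fin_three, Fin.succAbove]
  ring

theorem eval_charpoly_reductive_bi_invariant (l t₁ t₂ t₃ z : ℝ) :
    (reductive l l l t₁ t₂ t₃).ricMatrix.charpoly.eval z =
      z * (z - (t₁ ^ 2 + t₂ ^ 2 + t₃ ^ 2 + l ^ 2) / 2) *
        (z - (l ^ 2 - (t₁ ^ 2 + t₂ ^ 2 + t₃ ^ 2)) / 2) ^ 2 := by
  rw [Matrix.eval_charpoly, ricMatrix_reductive, Matrix.det_succ_row_zero]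
  simp [Fin.sum_univ_four, Matrix.det_fin_three, Fin.succAbove]
  ring

/-- Twice the Ricci form. -/
theorem dotProduct_ricMatrix_reductive (l₁ l₂ l₃ t₁ t₂ t₃ x₁ x₂ x₃ ζ : ℝ) :
    ![x₁, x₂, x₃, ζ] ⬝ᵥ (reductive l₁ l₂ l₃ t₁ t₂ t₃).ricMatrix.mulVec ![x₁, x₂, x₃, ζ] =
      ((l₁ ^ 2 - (l₂ - l₃) ^ 2) * x₁ ^ 2 + (l₂ ^ 2 - (l₃ - l₁) ^ 2) * x₂ ^ 2 +
        (l₃ ^ 2 - (l₁ - l₂) ^ 2) * x₃ ^ 2 - (t₁ * x₂ - t₂ * x₁) ^ 2 -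
        (t₂ * x₃ - t₃ * x₂) ^ 2 - (t₃ * x₁ - t₁ * x₃) ^ 2 +
        2 * ζ * (l₁ * t₁ * x₁ + l₂ * t₂ * x₂ + l₃ * t₃ * x₃) +
        (t₁ ^ 2 + t₂ ^ 2 + t₃ ^ 2) * ζ ^ 2) / 2 := by
  rw [ricMatrix_reductive]
  simp [Matrix.mulVec, dotProduct, Fin.sum_univ_four]
  ring

section

variable {l₁ l₂ l₃ t₁ t₂ t₃ : ℝ} {s : Fin 4 → SignType}

theorem last_of_reductive
    (hs : HasMatrixSignature (reductive l₁ l₂ l₃ t₁ t₂ t₃).ricMatrix s)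
    (ht : 0 < t₁ ^ 2 + t₂ ^ 2 + t₃ ^ 2) : s 3 = 1 := by
  refine last_of_pos (ricMatrix_reductive_isSymm _ _ _ _ _ _) hs ![0, 0, 0, 1] ?_
  rw [dotProduct_ricMatrix_reductive]
  linarith

theorem second_of_reductive
    (hs : HasMatrixSignature (reductive l₁ l₂ l₃ t₁ t₂ t₃).ricMatrix s)
    (h1 : l₁ ^ 2 - (l₂ - l₃) ^ 2 < 0) (h2 : l₂ ^ 2 - (l₃ - l₁) ^ 2 ≤ 0)
    (h : l₂ ^ 2 - (l₃ - l₁) ^ 2 < 0 ∨ 0 < t₁ ^ 2 + t₃ ^ 2) : s 1 = -1 := by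
  set N := t₁ ^ 2 + t₂ ^ 2 + t₃ ^ 2 with hN
  -- The f₄-components minimize the form in ζ, which removes the mixed terms. For N = 0 the
  -- quotients are 0 by convention, as needed.
  refine second_of_neg (ricMatrix_reductive_isSymm _ _ _ _ _ _) hs
    ![1, 0, 0, -(l₁ * t₁) / N] ![0, 1, 0, -(l₂ * t₂) / N] fun α β hαβ => ?_
  have hv : α • ![1, 0, 0, -(l₁ * t₁) / N] + β • ![0, 1, 0, -(l₂ * t₂) / N] =
      ![α, β, 0, -(l₁ * t₁ * α + l₂ * t₂ * β) / N] := by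
    ext i
    fin_cases i <;> simp
    ring
  rw [hv, dotProduct_ricMatrix_reductive, ← hN]
  have hm : 2 * (-(l₁ * t₁ * α + l₂ * t₂ * β) / N) *
        (l₁ * t₁ * α + l₂ * t₂ * β + l₃ * t₃ * 0) +
      N * (-(l₁ * t₁ * α + l₂ * t₂ * β) / N) ^ 2 ≤ 0 := by
    by_cases h0 : N = 0
    · simp [h0]
    · have hpos : 0 < N := lt_of_le_of_ne (by positivity) (Ne.symm h0)
      have : 2 * (-(l₁ * t₁ * α + l₂ * t₂ * β) / N) *
          (l₁ * t₁ * α + l₂ * t₂ * β + l₃ * t₃ * 0) +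
        N * (-(l₁ * t₁ * α + l₂ * t₂ * β) / N) ^ 2 = -((l₁ * t₁ * α + l₂ * t₂ * β) ^ 2 / N) := by
        field_simp
        ring
      rw [this, neg_nonpos]
      positivity
  have hq : (l₁ ^ 2 - (l₂ - l₃) ^ 2) * α ^ 2 + (l₂ ^ 2 - (l₃ - l₁) ^ 2) * β ^ 2 -
      (t₁ * β - t₂ * α) ^ 2 - (t₂ * 0 - t₃ * β) ^ 2 < 0 := by
    by_cases hα : α = 0
    · subst hα
      have hβ : 0 < β ^ 2 := by
        have : β ≠ 0 := by simpa using hαβ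
        positivity
      rcases h with h | h
      · have := mul_neg_of_neg_of_pos h hβ
        nlinarith [sq_nonneg (t₁ * β - t₂ * 0), sq_nonneg (t₂ * 0 - t₃ * β)]
      · have := mul_pos h hβ
        have := mul_nonpos_of_nonpos_of_nonneg h2 hβ.le
        linarith
    · have hα2 : 0 < α ^ 2 := by positivity
      have := mul_neg_of_neg_of_pos h1 hα2
      have := mul_nonpos_of_nonpos_of_nonneg h2 (sq_nonneg β)
      linarith [sq_nonneg (t₁ * β - t₂ * α), sq_nonneg (t₂ * 0 - t₃ * β)]
  have := sq_nonneg (t₃ * α - t₁ * 0)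
  linarith

/-- The metrics on `sl₂ ⊕ ℝ`, with a normalization of the first constants. -/
theorem signature_reductive_of_neg (h1 : l₁ ^ 2 - (l₂ - l₃) ^ 2 < 0)
    (hs : HasMatrixSignature (reductive l₁ l₂ l₃ t₁ t₂ t₃).ricMatrix s) :
    (s 1 = -1 ∧ s 3 = 1) ∨ s = signatureItem 6 := by
  have e2 : l₂ ^ 2 - (l₃ - l₁) ^ 2 = (l₁ + l₂ - l₃) * (-l₁ + l₂ + l₃) := by ring
  have e3 : l₃ ^ 2 - (l₁ - l₂) ^ 2 = (l₁ - l₂ + l₃) * (-l₁ + l₂ + l₃) := by ring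
  -- Writing P₁ < 0, P₂, P₃ for the three differences of squares and w = -l₁ + l₂ + l₃, this is P₂P₃
  -- = w²P₁: for w ≠ 0 exactly one of P₂, P₃ is negative, and for w = 0 both vanish.
  have e23 : (l₂ ^ 2 - (l₃ - l₁) ^ 2) * (l₃ ^ 2 - (l₁ - l₂) ^ 2) =
      (-l₁ + l₂ + l₃) ^ 2 * (l₁ ^ 2 - (l₂ - l₃) ^ 2) := by ring
  have hlast : -l₁ + l₂ + l₃ ≠ 0 → s 3 = 1 := by
    intro hw
    have h23 : (l₂ ^ 2 - (l₃ - l₁) ^ 2) * (l₃ ^ 2 - (l₁ - l₂) ^ 2) < 0 := by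
      rw [e23]
      exact mul_neg_of_pos_of_neg (by positivity) h1
    by_cases ht : 0 < t₁ ^ 2 + t₂ ^ 2 + t₃ ^ 2
    · exact last_of_reductive hs ht
    · have ht1 : t₁ = 0 := by nlinarith [sq_nonneg t₁, sq_nonneg t₂, sq_nonneg t₃]
      have ht2 : t₂ = 0 := by nlinarith [sq_nonneg t₁, sq_nonneg t₂, sq_nonneg t₃]
      have ht3 : t₃ = 0 := by nlinarith [sq_nonneg t₁, sq_nonneg t₂, sq_nonneg t₃]
      subst ht1 ht2 ht3
      rcases mul_neg_iff.1 h23 with h | h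
      · refine last_of_pos (ricMatrix_reductive_isSymm _ _ _ _ _ _) hs ![0, 1, 0, 0] ?_
        rw [dotProduct_ricMatrix_reductive]
        linarith
      · refine last_of_pos (ricMatrix_reductive_isSymm _ _ _ _ _ _) hs ![0, 0, 1, 0] ?_
        rw [dotProduct_ricMatrix_reductive]
        linarith
  by_cases hw : -l₁ + l₂ + l₃ = 0
  · rw [hw, mul_zero] at e2 e3
    by_cases ht : t₁ ^ 2 + t₂ ^ 2 + t₃ ^ 2 = 0
    · have ht1 : t₁ = 0 := by nlinarith [sq_nonneg t₁, sq_nonneg t₂, sq_nonneg t₃]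
      have ht2 : t₂ = 0 := by nlinarith [sq_nonneg t₁, sq_nonneg t₂, sq_nonneg t₃]
      have ht3 : t₃ = 0 := by nlinarith [sq_nonneg t₁, sq_nonneg t₂, sq_nonneg t₃]
      subst ht1 ht2 ht3
      refine Or.inr (hs.unique (hasMatrixSignature_of_roots
        ![(l₁ ^ 2 - (l₂ - l₃) ^ 2) / 2, 0, 0, 0] (fun z => ?_) (by decide) fun i => ?_))
      · rw [eval_charpoly_reductive, e2, e3, Fin.prod_univ_four]
        simp
      · fin_cases i <;> simp [signatureItem]
        exact (sign_neg (by linarith)).symm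
    · have ht' : 0 < t₁ ^ 2 + t₂ ^ 2 + t₃ ^ 2 := lt_of_le_of_ne (by positivity) (Ne.symm ht)
      refine Or.inl ⟨?_, last_of_reductive hs ht'⟩
      -- If t₁ and t₃ vanish then t₂ does not, and exchanging the indices 2 and 3 restores the
      -- hypothesis.
      by_cases h13 : 0 < t₁ ^ 2 + t₃ ^ 2
      · exact second_of_reductive hs h1 e2.le (Or.inr h13)
      · refine second_of_reductive (hasMatrixSignature_reductive_swap.2 hs) ?_ ?_ (Or.inr ?_)
        · linarith
        · linarith
        · nlinarith [sq_nonneg t₁, sq_nonneg t₃]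
  · refine Or.inl ⟨?_, hlast hw⟩
    have h23 : (l₂ ^ 2 - (l₃ - l₁) ^ 2) * (l₃ ^ 2 - (l₁ - l₂) ^ 2) < 0 := by
      rw [e23]
      exact mul_neg_of_pos_of_neg (by positivity) h1
    rcases mul_neg_iff.1 h23 with h | h
    · exact second_of_reductive (hasMatrixSignature_reductive_swap.2 hs) (by linarith)
        (by linarith) (Or.inl (by linarith))
    · exact second_of_reductive hs h1 h.1.le (Or.inl h.1)

/-- The metrics on `sl₂ ⊕ ℝ`. -/
theorem signature_reductive_indefinite (h1 : l₁ ≠ 0) (h2 : l₂ ≠ 0) (h3 : l₃ ≠ 0)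
    (hpos : ¬ (0 < l₁ ∧ 0 < l₂ ∧ 0 < l₃)) (hneg : ¬ (l₁ < 0 ∧ l₂ < 0 ∧ l₃ < 0))
    (hs : HasMatrixSignature (reductive l₁ l₂ l₃ t₁ t₂ t₃).ricMatrix s) :
    (s 1 = -1 ∧ s 3 = 1) ∨ s = signatureItem 6 := by
  have key : l₁ ^ 2 - (l₂ - l₃) ^ 2 < 0 ∨ l₂ ^ 2 - (l₃ - l₁) ^ 2 < 0 ∨
      l₃ ^ 2 - (l₁ - l₂) ^ 2 < 0 := by
    -- If no difference is negative, the three sums lᵢ + lⱼ - lₖ have pairwise nonnegative products.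
    -- Adding two of them gives 2lᵢ, so the constants share a sign.
    by_contra! hcon
    obtain ⟨c1, c2, c3⟩ := hcon
    have c1' : 0 ≤ (l₁ + l₂ - l₃) * (l₁ - l₂ + l₃) := by linarith
    have c2' : 0 ≤ (l₁ + l₂ - l₃) * (-l₁ + l₂ + l₃) := by linarith
    have c3' : 0 ≤ (l₁ - l₂ + l₃) * (-l₁ + l₂ + l₃) := by linarith
    rcases mul_nonneg_iff.1 c1' with a | a <;> rcases mul_nonneg_iff.1 c2' with b | b <;>
      rcases mul_nonneg_iff.1 c3' with c | c <;>
      first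
        | (refine hpos ⟨lt_of_le_of_ne ?_ (Ne.symm h1), lt_of_le_of_ne ?_ (Ne.symm h2),
            lt_of_le_of_ne ?_ (Ne.symm h3)⟩ <;> linarith)
        | (refine hneg ⟨lt_of_le_of_ne ?_ h1, lt_of_le_of_ne ?_ h2, lt_of_le_of_ne ?_ h3⟩ <;>
            linarith)
  rcases key with h | h | h
  · exact signature_reductive_of_neg h hs
  · exact signature_reductive_of_neg h (hasMatrixSignature_reductive_cycle.2 hs)
  · exact signature_reductive_of_neg h
      (hasMatrixSignature_reductive_cycle.2 (hasMatrixSignature_reductive_cycle.2 hs))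

end

/-! ### Ricci signatures on su₂ ⊕ ℝ -/

section

variable {l₁ l₂ l₃ t₁ t₂ t₃ : ℝ} {s : Fin 4 → SignType}

theorem sum_three_sq_pos_of_ne {a b c : ℝ} (h : ¬ (a = 0 ∧ b = 0 ∧ c = 0)) :
    0 < a ^ 2 + b ^ 2 + c ^ 2 := by
  by_contra hcon
  refine h ⟨?_, ?_, ?_⟩ <;> nlinarith [sq_nonneg a, sq_nonneg b, sq_nonneg c]

/-- Signatures from one zero, one positive and one double root. -/
theorem signature_of_double_root {R : Matrix (Fin 4) (Fin 4) ℝ} {p ρ : ℝ} (hp : 0 < p)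
    (h : ∀ z, R.charpoly.eval z = z * (z - p) * (z - ρ) ^ 2) (hs : HasMatrixSignature R s) :
    s = signatureItem 4 ∨ s = signatureItem 11 ∨ s = signatureItem 13 := by
  rcases lt_trichotomy ρ 0 with hρ | rfl | hρ
  · refine Or.inl (hs.unique (hasMatrixSignature_of_roots ![ρ, ρ, 0, p] (fun z => ?_)
      (by decide) fun i => ?_))
    · rw [h, Fin.prod_univ_four]
      simp
      ring
    · fin_cases i <;> simp [signatureItem, hp, hρ]
  · refine Or.inr (Or.inl (hs.unique (hasMatrixSignature_of_roots ![0, 0, 0, p] (fun z => ?_)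
      (by decide) fun i => ?_)))
    · rw [h, Fin.prod_univ_four]
      simp
      ring
    · fin_cases i <;> simp [signatureItem, hp]
  · refine Or.inr (Or.inr (hs.unique (hasMatrixSignature_of_roots ![0, ρ, ρ, p] (fun z => ?_)
      (by decide) fun i => ?_)))
    · rw [h, Fin.prod_univ_four]
      simp
      ring
    · fin_cases i <;> simp [signatureItem, hp, hρ]

/-- A product metric on `su₂ ⊕ ℝ`, the first combination of constants being the least. -/
theorem signature_product_of_le (h1 : 0 < l₁) (h2 : 0 < l₂)
    (hxy : l₁ + l₂ - l₃ ≤ l₁ - l₂ + l₃) (hxw : l₁ + l₂ - l₃ ≤ -l₁ + l₂ + l₃)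
    (hs : HasMatrixSignature (reductive l₁ l₂ l₃ 0 0 0).ricMatrix s) :
    s = signatureItem 4 ∨ s = signatureItem 11 ∨ s = signatureItem 13 := by
  have hy : 0 < l₁ - l₂ + l₃ := by linarith
  have hw : 0 < -l₁ + l₂ + l₃ := by linarith
  have hyw : 0 < (l₁ - l₂ + l₃) * (-l₁ + l₂ + l₃) := mul_pos hy hw
  have hz : ∀ z, (reductive l₁ l₂ l₃ 0 0 0).ricMatrix.charpoly.eval z =
      z * (z - (l₁ + l₂ - l₃) * (l₁ - l₂ + l₃) / 2) * (z - (l₁ + l₂ - l₃) * (-l₁ + l₂ + l₃) / 2) *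
        (z - (l₁ - l₂ + l₃) * (-l₁ + l₂ + l₃) / 2) := by
    intro z
    rw [eval_charpoly_reductive]
    ring
  rcases lt_trichotomy (l₁ + l₂ - l₃) 0 with hx | hx | hx
  · refine Or.inl (hs.unique (hasMatrixSignature_of_roots ![(l₁ + l₂ - l₃) * (l₁ - l₂ + l₃) / 2,
      (l₁ + l₂ - l₃) * (-l₁ + l₂ + l₃) / 2, 0, (l₁ - l₂ + l₃) * (-l₁ + l₂ + l₃) / 2]
      (fun z => ?_) (by decide) fun i => ?_))
    · rw [hz, Fin.prod_univ_four]
      simp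
      exact Or.inl (by ring)
    · have a1 := mul_neg_of_neg_of_pos hx hy
      have a2 := mul_neg_of_neg_of_pos hx hw
      fin_cases i
      · exact (sign_neg (by simp; linarith)).symm
      · exact (sign_neg (by simp; linarith)).symm
      · simp [signatureItem]
      · exact (sign_pos (by simp; linarith)).symm
  · refine Or.inr (Or.inl (hs.unique (hasMatrixSignature_of_roots ![0, 0, 0,
      (l₁ - l₂ + l₃) * (-l₁ + l₂ + l₃) / 2] (fun z => ?_) (by decide) fun i => ?_)))
    · rw [hz, hx, Fin.prod_univ_four]
      simp
    · fin_cases i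
      · simp [signatureItem]
      · simp [signatureItem]
      · simp [signatureItem]
      · exact (sign_pos (by simp; linarith)).symm
  · refine Or.inr (Or.inr (hs.unique (hasMatrixSignature_of_roots ![0,
      (l₁ + l₂ - l₃) * (l₁ - l₂ + l₃) / 2, (l₁ + l₂ - l₃) * (-l₁ + l₂ + l₃) / 2,
      (l₁ - l₂ + l₃) * (-l₁ + l₂ + l₃) / 2] (fun z => ?_) (by decide) fun i => ?_)))
    · rw [hz, Fin.prod_univ_four]
      simp
    · have a1 := mul_pos hx hy
      have a2 := mul_pos hx hw
      fin_cases i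
      · simp [signatureItem]
      · exact (sign_pos (by simp; linarith)).symm
      · exact (sign_pos (by simp; linarith)).symm
      · exact (sign_pos (by simp; linarith)).symm

theorem signature_product (h1 : 0 < l₁) (h2 : 0 < l₂) (h3 : 0 < l₃)
    (hs : HasMatrixSignature (reductive l₁ l₂ l₃ 0 0 0).ricMatrix s) :
    s = signatureItem 4 ∨ s = signatureItem 11 ∨ s = signatureItem 13 := by
  rcases le_total l₁ l₂ with h12 | h12 <;> rcases le_total l₂ l₃ with h23 | h23 <;>
    rcases le_total l₁ l₃ with h13 | h13
  all_goals
    first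
      | exact signature_product_of_le h1 h2 (by linarith) (by linarith) hs
      | exact signature_product_of_le h2 h3 (by linarith) (by linarith)
          (hasMatrixSignature_reductive_cycle.2 hs)
      | exact signature_product_of_le h3 h1 (by linarith) (by linarith)
          (hasMatrixSignature_reductive_cycle.2 (hasMatrixSignature_reductive_cycle.2 hs))

/-- The metrics on `su₂ ⊕ ℝ` that are not products, if the Ricci form is nonnegative on the
direction orthogonal to `su₂` with respect to an invariant form. -/
theorem signature_reductive_of_ne (ht : t₁ ≠ 0) (h23 : l₂ = l₃)
    (h2 : t₂ ≠ 0 → l₁ = l₃) (h3 : t₃ ≠ 0 → l₁ = l₂)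
    (hs : HasMatrixSignature (reductive l₁ l₂ l₃ t₁ t₂ t₃).ricMatrix s) :
    s = signatureItem 4 ∨ s = signatureItem 11 ∨ s = signatureItem 13 := by
  subst h23
  by_cases h : t₂ = 0 ∧ t₃ = 0
  · obtain ⟨rfl, rfl⟩ := h
    refine signature_of_double_root (p := (t₁ ^ 2 + l₁ ^ 2) / 2)
      (ρ := (l₂ ^ 2 - (l₂ - l₁) ^ 2 - t₁ ^ 2) / 2) (by positivity) (fun z => ?_) hs
    rw [eval_charpoly_reductive]
    ring
  -- A second nonzero component of t forces all three constants to agree.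
  · obtain rfl : l₁ = l₂ := by
      by_cases h' : t₂ = 0
      · exact h3 fun h'' => h ⟨h', h''⟩
      · exact h2 h'
    exact signature_of_double_root (by positivity)
      (eval_charpoly_reductive_bi_invariant l₁ t₁ t₂ t₃) hs

theorem signature_reductive_of_pos (h1 : 0 < l₁) (h2 : 0 < l₂) (h3 : 0 < l₃)
    (hs : HasMatrixSignature (reductive l₁ l₂ l₃ t₁ t₂ t₃).ricMatrix s) :
    (s 0 = -1 ∧ s 3 = 1) ∨ s = signatureItem 4 ∨ s = signatureItem 11 ∨ s = signatureItem 13 := by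
  by_cases ht : t₁ = 0 ∧ t₂ = 0 ∧ t₃ = 0
  · obtain ⟨rfl, rfl, rfl⟩ := ht
    exact Or.inr (signature_product h1 h2 h3 hs)
  have hlast := last_of_reductive hs (sum_three_sq_pos_of_ne ht)
  -- v = f₄ - Σ (tᵢ/lᵢ) fᵢ is orthogonal to the derived algebra, which is spanned by the lₖ fₖ + tₖ
  -- f₄. Twice Ric(v, v) is -q minus three further squares, so only q = 0 leaves room for a
  -- nonnegative spectrum.
  set q := ((l₂ - l₃) * (t₁ / l₁)) ^ 2 + ((l₃ - l₁) * (t₂ / l₂)) ^ 2 +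
    ((l₁ - l₂) * (t₃ / l₃)) ^ 2 with hq
  have hq0 : 0 ≤ q := by positivity
  rcases hq0.eq_or_lt' with hq1 | hq1
  · right
    have e1 : t₁ ≠ 0 → l₂ = l₃ := by
      intro h
      have : (l₂ - l₃) * (t₁ / l₁) = 0 := by
        nlinarith [sq_nonneg ((l₂ - l₃) * (t₁ / l₁)), sq_nonneg ((l₃ - l₁) * (t₂ / l₂)),
          sq_nonneg ((l₁ - l₂) * (t₃ / l₃))]
      exact sub_eq_zero.1 ((mul_eq_zero.1 this).resolve_right (div_ne_zero h h1.ne'))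
    have e2 : t₂ ≠ 0 → l₃ = l₁ := by
      intro h
      have : (l₃ - l₁) * (t₂ / l₂) = 0 := by
        nlinarith [sq_nonneg ((l₂ - l₃) * (t₁ / l₁)), sq_nonneg ((l₃ - l₁) * (t₂ / l₂)),
          sq_nonneg ((l₁ - l₂) * (t₃ / l₃))]
      exact sub_eq_zero.1 ((mul_eq_zero.1 this).resolve_right (div_ne_zero h h2.ne'))
    have e3 : t₃ ≠ 0 → l₁ = l₂ := by
      intro h
      have : (l₁ - l₂) * (t₃ / l₃) = 0 := by
        nlinarith [sq_nonneg ((l₂ - l₃) * (t₁ / l₁)), sq_nonneg ((l₃ - l₁) * (t₂ / l₂)),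
          sq_nonneg ((l₁ - l₂) * (t₃ / l₃))]
      exact sub_eq_zero.1 ((mul_eq_zero.1 this).resolve_right (div_ne_zero h h3.ne'))
    by_cases n1 : t₁ = 0
    · by_cases n2 : t₂ = 0
      · have n3 : t₃ ≠ 0 := fun n3 => ht ⟨n1, n2, n3⟩
        exact signature_reductive_of_ne n3 (e3 n3) (fun h => absurd n1 h) (fun h => absurd n2 h)
          (hasMatrixSignature_reductive_cycle.2 (hasMatrixSignature_reductive_cycle.2 hs))
      · exact signature_reductive_of_ne n2 (e2 n2) (fun h => (e3 h).symm)
          (fun h => absurd n1 h) (hasMatrixSignature_reductive_cycle.2 hs)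
    · exact signature_reductive_of_ne n1 (e1 n1) (fun h => (e2 h).symm) e3 hs
  · refine Or.inl ⟨?_, hlast⟩
    refine first_of_neg (ricMatrix_reductive_isSymm _ _ _ _ _ _) hs
      ![-(t₁ / l₁), -(t₂ / l₂), -(t₃ / l₃), 1] ?_
    rw [dotProduct_ricMatrix_reductive]
    have c1 : l₁ * (t₁ / l₁) = t₁ := mul_div_cancel₀ _ h1.ne'
    have c2 : l₂ * (t₂ / l₂) = t₂ := mul_div_cancel₀ _ h2.ne'
    have c3 : l₃ * (t₃ / l₃) = t₃ := mul_div_cancel₀ _ h3.ne'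
    set a₁ := t₁ / l₁
    set a₂ := t₂ / l₂
    set a₃ := t₃ / l₃
    have p1 := sq_nonneg (t₁ * a₂ - t₂ * a₁)
    have p2 := sq_nonneg (t₂ * a₃ - t₃ * a₂)
    have p3 := sq_nonneg (t₃ * a₁ - t₁ * a₃)
    have key : (l₁ ^ 2 - (l₂ - l₃) ^ 2) * a₁ ^ 2 + (l₂ ^ 2 - (l₃ - l₁) ^ 2) * a₂ ^ 2 +
        (l₃ ^ 2 - (l₁ - l₂) ^ 2) * a₃ ^ 2 - 2 * (l₁ * t₁ * a₁ + l₂ * t₂ * a₂ + l₃ * t₃ * a₃) +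
        (t₁ ^ 2 + t₂ ^ 2 + t₃ ^ 2) = -q := by
      rw [hq, ← c1, ← c2, ← c3]
      ring
    linarith

/-- The metrics on `su₂ ⊕ ℝ`. -/
theorem signature_reductive_definite
    (h : (0 < l₁ ∧ 0 < l₂ ∧ 0 < l₃) ∨ (l₁ < 0 ∧ l₂ < 0 ∧ l₃ < 0))
    (hs : HasMatrixSignature (reductive l₁ l₂ l₃ t₁ t₂ t₃).ricMatrix s) :
    (s 0 = -1 ∧ s 3 = 1) ∨ s = signatureItem 4 ∨ s = signatureItem 11 ∨ s = signatureItem 13 := by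
  rcases h with h | h
  · exact signature_reductive_of_pos h.1 h.2.1 h.2.2 hs
  · rw [← ricMatrix_reductive_neg] at hs
    exact signature_reductive_of_pos (neg_pos.2 h.1) (neg_pos.2 h.2.1) (neg_pos.2 h.2.2) hs

end

/-! ### Adapted frames of reductive algebras -/

section

variable {L : Type*} [LieRing L] [LieAlgebra ℝ L]

/-- The bilinear form with diagonal matrix `(1, 1, ε, 0)`. -/
def invariantForm (u : Module.Basis (Fin 4) ℝ L) (ε : ℝ) : LinearMap.BilinForm ℝ L :=
  (u.coord 0).smulRight (u.coord 0) + (u.coord 1).smulRight (u.coord 1) +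
    ε • (u.coord 2).smulRight (u.coord 2)

theorem invariantForm_apply (u : Module.Basis (Fin 4) ℝ L) (ε : ℝ) (x y : L) :
    invariantForm u ε x y = u.repr x 0 * u.repr y 0 + u.repr x 1 * u.repr y 1 +
      ε * (u.repr x 2 * u.repr y 2) := by
  simp [invariantForm]

theorem comb_repr (u : Module.Basis (Fin 4) ℝ L) (x : L) : comb u (fun i => u.repr x i) = x :=
  u.sum_repr x

theorem HasRelations.repr_lie {u : Module.Basis (Fin 4) ℝ L} {r : Relations}
    (h : HasRelations u r) (x y : L) (k : Fin 4) :
    u.repr ⁅x, y⁆ k = r.bracket (fun i => u.repr x i) (fun i => u.repr y i) k := by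
  conv_lhs => rw [← comb_repr u x, ← comb_repr u y, h.lie_comb, repr_comb]

/-- The Killing form is -2ε times `invariantForm`. -/
theorem invariantForm_lie {u : Module.Basis (Fin 4) ℝ L} {ε : ℝ} (hε : ε ^ 2 = 1)
    (h : HasRelations u (reductive 1 1 ε 0 0 0)) (x y z : L) :
    invariantForm u ε ⁅x, y⁆ z = invariantForm u ε x ⁅y, z⁆ := by
  simp only [invariantForm_apply, h.repr_lie]
  simp [reductive, Relations.bracket]
  linear_combination ((u.repr x 0 * u.repr y 1 - u.repr x 1 * u.repr y 0) * u.repr z 2 -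
    (u.repr y 0 * u.repr z 1 - u.repr y 1 * u.repr z 0) * u.repr x 2) * hε

theorem lie_eq_zero_of_repr {u : Module.Basis (Fin 4) ℝ L} {ε : ℝ}
    (h : HasRelations u (reductive 1 1 ε 0 0 0)) {x : L} (h0 : u.repr x 0 = 0)
    (h1 : u.repr x 1 = 0) (h2 : u.repr x 2 = 0) (y : L) : ⁅y, x⁆ = 0 := by
  apply u.repr.injective
  ext k
  rw [h.repr_lie]
  fin_cases k <;> simp [reductive, Relations.bracket, h0, h1, h2]

theorem IsOrthonormal.comp_perm {Q : InnerProd L} {f : Fin 4 → L} (hf : IsOrthonormal Q f)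
    (σ : Equiv.Perm (Fin 4)) : IsOrthonormal Q (f ∘ σ) := by
  intro i j
  simp [hf _ _]

/-- An orthonormal frame that diagonalizes the invariant form, the last member being central. -/
theorem exists_invariant_frame (Q : InnerProd L) (u : Module.Basis (Fin 4) ℝ L) {ε : ℝ}
    (hε : ε ≠ 0) :
    ∃ f : Module.Basis (Fin 4) ℝ L, IsOrthonormal Q f ∧
      (∀ i j, i ≠ j → invariantForm u ε (f i) (f j) = 0) ∧
      (u.repr (f 3) 0 = 0 ∧ u.repr (f 3) 1 = 0 ∧ u.repr (f 3) 2 = 0) ∧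
      ∀ i, i ≠ 3 → invariantForm u ε (f i) (f i) ≠ 0 := by
  set B := invariantForm u ε with hB
  obtain ⟨f₀, hf₀, hd₀⟩ := exists_diagonal_frame Q u B fun x y => by
    simp only [hB, invariantForm_apply]
    ring
  have hBu : ∀ (f : Module.Basis (Fin 4) ℝ L), (∀ i j, i ≠ j → B (f i) (f j) = 0) →
      ∀ x k, B x (f k) = f.repr x k * B (f k) (f k) := by
    intro f hd x k
    conv_lhs => rw [← f.sum_repr x]
    rw [map_sum, LinearMap.sum_apply, Finset.sum_eq_single k]
    · simp
    · intro b _ hb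
      simp [hd b k hb]
    · simp
  have hsymm : ∀ x y, B x y = B y x := by
    intro x y
    simp only [hB, invariantForm_apply]
    ring
  have hrad : ∀ (f : Module.Basis (Fin 4) ℝ L), (∀ i j, i ≠ j → B (f i) (f j) = 0) →
      ∀ k, B (f k) (f k) = 0 →
        u.repr (f k) 0 = 0 ∧ u.repr (f k) 1 = 0 ∧ u.repr (f k) 2 = 0 := by
    intro f hd k hk
    have h : ∀ x, B x (f k) = 0 := fun x => by rw [hBu f hd, hk, mul_zero]
    refine ⟨?_, ?_, ?_⟩
    · simpa [hB, invariantForm_apply] using h (u 0)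
    · simpa [hB, invariantForm_apply] using h (u 1)
    · simpa [hB, invariantForm_apply, hε] using h (u 2)
  obtain ⟨b₀, hb₀⟩ := hf₀.exists_basis u
  rw [← hb₀] at hf₀ hd₀
  -- `u 3` spans the radical of `B`; a frame vector along which it has a nonzero component must be
  -- null. A transposition then moves that vector to the last place.
  obtain ⟨i, hi⟩ : ∃ i, B (b₀ i) (b₀ i) = 0 := by
    have hne : b₀.repr (u 3) ≠ 0 := by
      rw [Ne, LinearEquiv.map_eq_zero_iff]
      exact u.ne_zero 3
    obtain ⟨i, hi⟩ := Finsupp.ne_iff.1 hne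
    refine ⟨i, ?_⟩
    have h := hBu b₀ hd₀ (u 3) i
    have h' : B (u 3) (b₀ i) = 0 := by simp [hB, invariantForm_apply]
    rw [h'] at h
    exact (mul_eq_zero.1 h.symm).resolve_left hi
  obtain ⟨f, hf⟩ := (hf₀.comp_perm (Equiv.swap i 3)).exists_basis u
  have hfo : IsOrthonormal Q f := by
    rw [hf]
    exact hf₀.comp_perm _
  have hfd : ∀ i j, i ≠ j → B (f i) (f j) = 0 := by
    intro j k hjk
    rw [hf]
    exact hd₀ _ _ fun h => hjk ((Equiv.swap i 3).injective h)
  have hf3 : B (f 3) (f 3) = 0 := by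
    rw [hf]
    simpa using hi
  have h3 := hrad f hfd 3 hf3
  refine ⟨f, hfo, hfd, h3, fun k hk hk0 => ?_⟩
  have h4 := hrad f hfd k hk0
  -- The radical is a line, so it cannot contain two orthonormal vectors.
  have hmul : ∀ x, u.repr x 0 = 0 ∧ u.repr x 1 = 0 ∧ u.repr x 2 = 0 → x = u.repr x 3 • u 3 := by
    intro x hx
    conv_lhs => rw [← u.sum_repr x, Fin.sum_univ_four, hx.1, hx.2.1, hx.2.2]
    simp
  have q1 := hfo k k
  have q2 := hfo 3 3
  have q3 := hfo k 3
  rw [hmul _ h3] at q2 q3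
  rw [hmul _ h4] at q1 q3
  simp [hk] at q1 q2 q3
  rcases q3 with q | q | q
  · simp [q] at q2
  · simp [q] at q1
  · simp [q] at q1

/-- Orthonormal frames of `sl₂ ⊕ ℝ` and `su₂ ⊕ ℝ`. -/
theorem exists_reductive_frame (Q : InnerProd L) {u : Module.Basis (Fin 4) ℝ L} {ε : ℝ}
    (hε : ε ^ 2 = 1) (h : HasRelations u (reductive 1 1 ε 0 0 0)) :
    ∃ (f : Module.Basis (Fin 4) ℝ L) (δ t₁ t₂ t₃ : ℝ), IsOrthonormal Q f ∧
      HasRelations f (reductive (δ / invariantForm u ε (f 0) (f 0))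
        (δ / invariantForm u ε (f 1) (f 1)) (δ / invariantForm u ε (f 2) (f 2)) t₁ t₂ t₃) ∧
      δ ≠ 0 ∧ (∀ i, i ≠ 3 → invariantForm u ε (f i) (f i) ≠ 0) ∧
      ∀ x, invariantForm u ε x x = f.repr x 0 ^ 2 * invariantForm u ε (f 0) (f 0) +
        f.repr x 1 ^ 2 * invariantForm u ε (f 1) (f 1) +
        f.repr x 2 ^ 2 * invariantForm u ε (f 2) (f 2) := by
  have hε0 : ε ≠ 0 := by
    rintro rfl
    norm_num at hε
  obtain ⟨f, hfo, hfd, ⟨h30, h31, h32⟩, hne⟩ := exists_invariant_frame Q u hε0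
  set B := invariantForm u ε with hB
  have hinv : ∀ x y z, B ⁅x, y⁆ z = B x ⁅y, z⁆ := invariantForm_lie hε h
  have hsymm : ∀ x y, B x y = B y x := by
    intro x y
    simp only [hB, invariantForm_apply]
    ring
  have hBf : ∀ x k, B x (f k) = f.repr x k * B (f k) (f k) := by
    intro x k
    conv_lhs => rw [← f.sum_repr x]
    rw [map_sum, LinearMap.sum_apply, Finset.sum_eq_single k]
    · simp
    · intro b _ hb
      simp [hfd b k hb]
    · simp
  have n0 := hne 0 (by decide)
  have n1 := hne 1 (by decide)
  have n2 := hne 2 (by decide)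
  have hrepr : ∀ x k, k ≠ 3 → f.repr x k = B x (f k) / B (f k) (f k) := fun x k hk => by
    rw [hBf x k, mul_div_cancel_right₀ _ (hne k hk)]
  have hcent := lie_eq_zero_of_repr h h30 h31 h32
  have hf3 : ∀ x, B (f 3) x = 0 := fun x => by
    simp [hB, invariantForm_apply, h30, h31, h32]
  -- B([x, y], z) is alternating by invariance, so this one number determines all brackets modulo
  -- the center.
  set δ := B ⁅f 0, f 1⁆ (f 2) with hδ
  have d1 : B ⁅f 1, f 2⁆ (f 0) = δ := by rw [hsymm, ← hinv]
  have d2 : B ⁅f 0, f 2⁆ (f 1) = -δ := by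
    rw [hinv, ← lie_skew, map_neg, ← hinv, hδ]
  have z1 : ∀ x y : L, B ⁅x, y⁆ y = 0 := fun x y => by rw [hinv, lie_self, map_zero]
  have z2 : ∀ x y : L, B ⁅x, y⁆ x = 0 := fun x y => by
    rw [← lie_skew, map_neg, LinearMap.neg_apply, z1, neg_zero]
  have hrel : HasRelations f (reductive (δ / B (f 0) (f 0)) (δ / B (f 1) (f 1))
      (δ / B (f 2) (f 2)) (f.repr ⁅f 1, f 2⁆ 3) (-f.repr ⁅f 0, f 2⁆ 3)
      (f.repr ⁅f 0, f 1⁆ 3)) := by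
    constructor <;> apply f.repr.injective <;> ext k <;> rw [repr_comb]
    · fin_cases k <;> simp [hrepr, z1, z2, reductive, ← hδ]
    · fin_cases k <;> simp [hrepr, z1, z2, d2, reductive, neg_div]
    · rw [hcent]
      fin_cases k <;> simp [reductive]
    · fin_cases k <;> simp [hrepr, z1, z2, d1, reductive]
    · rw [hcent]
      fin_cases k <;> simp [reductive]
    · rw [hcent]
      fin_cases k <;> simp [reductive]
  refine ⟨f, δ, _, _, _, hfo, hrel, fun h0 => ?_, hne, fun x => ?_⟩
  -- If δ were 0, all brackets would lie on the central line of `f 3`, but `u 0` is a bracket with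
  -- B(u₀, u₀) = 1.
  · have h5 : ⁅u 1, u 2⁆ = u 0 := by
      rw [h.h23]
      simp [comb, reductive, Fin.sum_univ_four]
    have h6 : B (u 0) (u 0) = 1 := by simp [hB, invariantForm_apply]
    have h7 : u 0 = f.repr (u 0) 3 • f 3 := by
      have h8 : ∀ k : Fin 4, k ≠ 3 → f.repr (u 0) k = 0 := by
        intro k hk
        rw [← h5, hrel.repr_lie, h0]
        fin_cases k <;> simp [reductive, Relations.bracket] at hk ⊢
      conv_lhs => rw [← f.sum_repr (u 0), Fin.sum_univ_four, h8 0 (by decide), h8 1 (by decide),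
        h8 2 (by decide)]
      simp
    have h9 := congrArg (fun y => B y (u 0)) h7
    simp [hf3, h6] at h9
  · have hx : B x x = ∑ k, f.repr x k * B x (f k) := by
      conv_lhs =>
        arg 2
        rw [← f.sum_repr x]
      rw [map_sum]
      simp only [map_smul, smul_eq_mul]
    rw [hx, Fin.sum_univ_four, hBf x 0, hBf x 1, hBf x 2, hsymm x (f 3), hf3]
    ring

end

/-! ### Table rows of sl₂ ⊕ ℝ and su₂ ⊕ ℝ -/

section

variable {L : Type*} [LieRing L] [LieAlgebra ℝ L] [FiniteDimensional ℝ L]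

theorem signature_of_su2 (Q : InnerProd L) {u : Module.Basis (Fin 4) ℝ L}
    (h : HasRelations u (reductive 1 1 1 0 0 0)) {s : Fin 4 → SignType}
    (hs : HasSignature Q.ricciOperator s) :
    (s 0 = -1 ∧ s 3 = 1) ∨ s = signatureItem 4 ∨ s = signatureItem 11 ∨ s = signatureItem 13 := by
  obtain ⟨f, δ, t₁, t₂, t₃, hf, hr, hδ, hne, -⟩ := exists_reductive_frame Q (by norm_num) h
  have hpos : ∀ i, i ≠ 3 → 0 < invariantForm u 1 (f i) (f i) := by
    intro i hi
    refine lt_of_le_of_ne ?_ (hne i hi).symm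
    rw [invariantForm_apply]
    nlinarith [mul_self_nonneg (u.repr (f i) 0), mul_self_nonneg (u.repr (f i) 1),
      mul_self_nonneg (u.repr (f i) 2)]
  have p0 := hpos 0 (by decide)
  have p1 := hpos 1 (by decide)
  have p2 := hpos 2 (by decide)
  refine signature_reductive_definite ?_ ((hasSignature_iff hf hr s).1 hs)
  rcases lt_or_gt_of_ne hδ with h0 | h0
  · exact Or.inr ⟨div_neg_of_neg_of_pos h0 p0, div_neg_of_neg_of_pos h0 p1,
      div_neg_of_neg_of_pos h0 p2⟩
  · exact Or.inl ⟨div_pos h0 p0, div_pos h0 p1, div_pos h0 p2⟩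

theorem signature_of_sl2 (Q : InnerProd L) {u : Module.Basis (Fin 4) ℝ L}
    (h : HasRelations u (reductive 1 1 (-1) 0 0 0)) {s : Fin 4 → SignType}
    (hs : HasSignature Q.ricciOperator s) : (s 1 = -1 ∧ s 3 = 1) ∨ s = signatureItem 6 := by
  obtain ⟨f, δ, t₁, t₂, t₃, hf, hr, hδ, hne, hB⟩ := exists_reductive_frame Q (by norm_num) h
  have n0 := hne 0 (by decide)
  have n1 := hne 1 (by decide)
  have n2 := hne 2 (by decide)
  -- B takes the values 1 on `u 0` and -1 on `u 2`, so the diagonal entries are neither all positive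
  -- nor all negative.
  have b0 := hB (u 0)
  have b2 := hB (u 2)
  simp only [invariantForm_apply u (-1) (u _)] at b0 b2
  simp at b0 b2
  set β₀ := invariantForm u (-1) (f 0) (f 0)
  set β₁ := invariantForm u (-1) (f 1) (f 1)
  set β₂ := invariantForm u (-1) (f 2) (f 2)
  have key1 : ¬ (0 < β₀ ∧ 0 < β₁ ∧ 0 < β₂) := by
    rintro ⟨p0, p1, p2⟩
    have : 0 ≤ (f.repr (u 2)) 0 ^ 2 * β₀ + (f.repr (u 2)) 1 ^ 2 * β₁ +
      (f.repr (u 2)) 2 ^ 2 * β₂ := by positivity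
    linarith
  have key2 : ¬ (β₀ < 0 ∧ β₁ < 0 ∧ β₂ < 0) := by
    rintro ⟨p0, p1, p2⟩
    have := mul_nonpos_of_nonneg_of_nonpos (sq_nonneg ((f.repr (u 0)) 0)) p0.le
    have := mul_nonpos_of_nonneg_of_nonpos (sq_nonneg ((f.repr (u 0)) 1)) p1.le
    have := mul_nonpos_of_nonneg_of_nonpos (sq_nonneg ((f.repr (u 0)) 2)) p2.le
    linarith
  refine signature_reductive_indefinite (div_ne_zero hδ n0) (div_ne_zero hδ n1)
    (div_ne_zero hδ n2) ?_ ?_ ((hasSignature_iff hf hr s).1 hs)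
  · simp only [div_pos_iff]
    rintro ⟨a | a, b | b, c | c⟩ <;>
      first
        | exact key1 ⟨a.2, b.2, c.2⟩
        | exact key2 ⟨a.2, b.2, c.2⟩
        | linarith
  · simp only [div_neg_iff]
    rintro ⟨a | a, b | b, c | c⟩ <;>
      first
        | exact key1 ⟨a.2, b.2, c.2⟩
        | exact key2 ⟨a.2, b.2, c.2⟩
        | linarith

/-- The constants of metrics on `sl₂ ⊕ ℝ` and `su₂ ⊕ ℝ` may be prescribed up to signs. -/
theorem exists_signature_of_reductive {u : Module.Basis (Fin 4) ℝ L} {ε : ℝ}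
    (h : HasRelations u (reductive 1 1 ε 0 0 0)) {l₁ l₂ l₃ : ℝ} (h1 : 0 < l₁) (h2 : 0 < l₂)
    (h3 : 0 < l₃) (t₁ t₂ : ℝ) {s : Fin 4 → SignType}
    (hs : HasMatrixSignature (reductive l₁ l₂ (ε * l₃) t₁ t₂ 0).ricMatrix s) :
    ∃ Q : InnerProd L, HasSignature Q.ricciOperator s := by
  have q1 := Real.mul_self_sqrt h1.le
  have q2 := Real.mul_self_sqrt h2.le
  have q3 := Real.mul_self_sqrt h3.le
  have r1 := Real.sqrt_pos.2 h1
  have r2 := Real.sqrt_pos.2 h2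
  have r3 := Real.sqrt_pos.2 h3
  set p₁ := Real.sqrt l₁
  set p₂ := Real.sqrt l₂
  set p₃ := Real.sqrt l₃
  -- The products of square roots scale the brackets to the prescribed lₖ; tilting by the center
  -- produces t₁ and t₂.
  refine exists_signature_of_frame u (x := ![![p₂ * p₃, 0, 0, -(t₁ / l₁)],
    ![0, p₁ * p₃, 0, -(t₂ / l₂)], ![0, 0, p₁ * p₂, 0], ![0, 0, 0, 1]]) ?_ ?_ hs
  · have : (Matrix.of ![![p₂ * p₃, 0, 0, -(t₁ / l₁)], ![0, p₁ * p₃, 0, -(t₂ / l₂)],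
        ![0, 0, p₁ * p₂, 0], ![0, 0, 0, 1]]).det = (p₂ * p₃) * (p₁ * p₃) * (p₁ * p₂) := by
      rw [Matrix.det_succ_row_zero]
      simp [Fin.sum_univ_four, Matrix.det_fin_three, Fin.succAbove]
      ring
    rw [this]
    positivity
  · have c1 : l₁ * (t₁ / l₁) = t₁ := mul_div_cancel₀ _ h1.ne'
    have c2 : l₂ * (t₂ / l₂) = t₂ := mul_div_cancel₀ _ h2.ne'
    apply h.frame <;> funext k <;> fin_cases k <;>
      simp [reductive, Relations.bracket, Fin.sum_univ_four]
    · rw [← q3]; ring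
    · rw [← q2]; ring
    · rw [c2]; ring
    · rw [← q1]; ring
    · rw [c1]; ring

/-- The quadratic factor has root product -c < 0, hence one root of each sign; σ only reorders the
signs. -/
theorem signature_quadratic {R : Matrix (Fin 4) (Fin 4) ℝ} {b c P P' : ℝ} (hc : 0 < c)
    (h : ∀ z, R.charpoly.eval z = (z ^ 2 - b * z - c) * (z - P) * (z - P'))
    {s : Fin 4 → SignType} (hs : Monotone s) (σ : Equiv.Perm (Fin 4))
    (h' : s ∘ σ = ![-1, SignType.sign P, SignType.sign P', 1]) : HasMatrixSignature R s := by
  have hq := Real.sq_sqrt (by positivity : 0 ≤ b ^ 2 + 4 * c)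
  set q := Real.sqrt (b ^ 2 + 4 * c)
  have hlt : |b| < q := by
    refine abs_lt_of_sq_lt_sq ?_ (Real.sqrt_nonneg _)
    linarith
  obtain ⟨hb1, hb2⟩ := abs_lt.1 hlt
  refine hasMatrixSignature_of_roots (![(b - q) / 2, P, P', (b + q) / 2] ∘ σ.symm) (fun z => ?_)
    hs fun i => ?_
  · rw [h]
    simp only [Function.comp_apply]
    rw [Equiv.prod_comp σ.symm fun i => z - ![(b - q) / 2, P, P', (b + q) / 2] i,
      Fin.prod_univ_four]
    simp
    linear_combination (1 / 4 * (z - P) * (z - P')) * hq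
  · have h1 := congrFun h' (σ.symm i)
    simp only [Function.comp_apply, Equiv.apply_symm_apply] at h1 ⊢
    rw [h1]
    generalize σ.symm i = j
    fin_cases j
    · exact (sign_neg (by simp; linarith)).symm
    · rfl
    · rfl
    · exact (sign_pos (by simp; linarith)).symm

theorem realizesExactly_su2 {u : Module.Basis (Fin 4) ℝ L}
    (h : HasRelations u (reductive 1 1 1 0 0 0)) :
    RealizesExactly L {3, 5, 6, 8, 9, 10, 12, 14} := by
  intro k
  constructor
  · rintro ⟨Q, hQ⟩
    have := signature_of_su2 Q h hQ
    clear hQ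
    revert this
    revert k
    decide
  · intro hk
    have hk' : k = 2 ∨ k = 4 ∨ k = 5 ∨ k = 7 ∨ k = 8 ∨ k = 9 ∨ k = 11 ∨ k = 13 := by
      revert hk; revert k; decide
    -- Constants (2, 2, 1) with t along f₁: the two linear factors change sign at t² = 3 and t² = 1.
    have key : ∀ t : ℝ, t ≠ 0 → ∀ s : Fin 4 → SignType, Monotone s → ∀ σ : Equiv.Perm (Fin 4),
        s ∘ σ = ![-1, SignType.sign ((3 - t ^ 2) / 2), SignType.sign ((1 - t ^ 2) / 2), 1] →
        ∃ Q : InnerProd L, HasSignature Q.ricciOperator s := by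
      intro t ht s hs σ hσ
      refine exists_signature_of_reductive h two_pos two_pos one_pos t 0
        (signature_quadratic (b := 3 / 2 + t ^ 2 / 2) (c := t ^ 2 / 4) (by positivity)
          (fun z => ?_) hs σ hσ)
      rw [eval_charpoly_reductive]
      ring
    rcases hk' with rfl | rfl | rfl | rfl | rfl | rfl | rfl | rfl
    · refine key 2 two_ne_zero _ (by decide) 1 ?_
      rw [sign_neg (by norm_num), sign_neg (by norm_num)]
      decide
    · refine exists_signature_of_reductive h three_pos one_pos one_pos 0 0
        (hasMatrixSignature_of_roots ![-3 / 2, -3 / 2, 0, 9 / 2] (fun z => ?_) (by decide)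
          fun i => ?_)
      · rw [eval_charpoly_reductive, Fin.prod_univ_four]
        simp
        ring
      · fin_cases i
        · exact (sign_neg (by simp; norm_num)).symm
        · exact (sign_neg (by simp; norm_num)).symm
        · simp [signatureItem]
        · simp [signatureItem]
    · refine key (3 / 2) (by norm_num) _ (by decide) (Equiv.swap 1 2) ?_
      rw [sign_pos (by norm_num), sign_neg (by norm_num)]
      decide
    -- Here t must be oblique. For t ≠ 0 along f₁ both linear factors vanish only if l₂ = l₃, and
    -- then the quadratic factor has root 0 instead of a negative one.
    · refine exists_signature_of_reductive h one_pos three_pos three_pos 2 1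
        (signature_quadratic (b := 3) (c := 3) (P := 0) (P' := 0) three_pos (fun z => ?_)
          (by decide) 1 ?_)
      · rw [Matrix.eval_charpoly, ricMatrix_reductive, Matrix.det_succ_row_zero]
        simp [Fin.sum_univ_four, Matrix.det_fin_three, Fin.succAbove]
        ring
      · rw [sign_zero]
        decide
    · refine key 1 one_ne_zero _ (by decide) (Equiv.swap 1 2) ?_
      rw [sign_pos (by norm_num), show ((1 : ℝ) - 1 ^ 2) / 2 = 0 by norm_num, sign_zero]
      decide
    · refine key (1 / 2) (by norm_num) _ (by decide) 1 ?_
      rw [sign_pos (by norm_num), sign_pos (by norm_num)]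
      decide
    · refine exists_signature_of_reductive h two_pos one_pos one_pos 0 0
        (hasMatrixSignature_of_roots ![0, 0, 0, 2] (fun z => ?_) (by decide)
          fun i => ?_)
      · rw [eval_charpoly_reductive, Fin.prod_univ_four]
        simp
        ring
      · fin_cases i <;> simp [signatureItem]
    · refine exists_signature_of_reductive h one_pos one_pos one_pos 0 0
        (hasMatrixSignature_of_roots ![0, 1 / 2, 1 / 2, 1 / 2] (fun z => ?_) (by decide)
          fun i => ?_)
      · rw [eval_charpoly_reductive, Fin.prod_univ_four]
        simp
        exact Or.inl (by ring)
      · fin_cases i <;> simp [signatureItem]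

theorem realizesExactly_sl2 {u : Module.Basis (Fin 4) ℝ L}
    (h : HasRelations u (reductive 1 1 (-1) 0 0 0)) : RealizesExactly L {3, 5, 6, 7} := by
  intro k
  constructor
  · rintro ⟨Q, hQ⟩
    have := signature_of_sl2 Q h hQ
    clear hQ
    revert this
    revert k
    decide
  · intro hk
    have hk' : k = 2 ∨ k = 4 ∨ k = 5 ∨ k = 6 := by revert hk; revert k; decide
    -- Constants (1, 1, -1) with t along f₁: the first linear factor always has a negative root, the
    -- second changes sign at t² = 1.
    have key : ∀ t : ℝ, t ≠ 0 → ∀ s : Fin 4 → SignType, Monotone s → ∀ σ : Equiv.Perm (Fin 4),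
        s ∘ σ = ![-1, SignType.sign ((-3 - t ^ 2) / 2), SignType.sign ((1 - t ^ 2) / 2), 1] →
        ∃ Q : InnerProd L, HasSignature Q.ricciOperator s := by
      intro t ht s hs σ hσ
      refine exists_signature_of_reductive h one_pos one_pos one_pos t 0
        (signature_quadratic (b := -3 / 2 + t ^ 2 / 2) (c := t ^ 2) (by positivity)
          (fun z => ?_) hs σ hσ)
      rw [eval_charpoly_reductive]
      ring
    rcases hk' with rfl | rfl | rfl | rfl
    · refine key 2 two_ne_zero _ (by decide) 1 ?_
      rw [sign_neg (by norm_num), sign_neg (by norm_num)]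
      decide
    · refine exists_signature_of_reductive h one_pos one_pos one_pos 0 0
        (hasMatrixSignature_of_roots ![-3 / 2, -3 / 2, 0, 1 / 2] (fun z => ?_) (by decide)
          fun i => ?_)
      · rw [eval_charpoly_reductive, Fin.prod_univ_four]
        simp
        exact Or.inl (by ring)
      · fin_cases i
        · exact (sign_neg (by simp; norm_num)).symm
        · exact (sign_neg (by simp; norm_num)).symm
        · simp [signatureItem]
        · simp [signatureItem]
    · refine key (1 / 2) (by norm_num) _ (by decide) 1 ?_
      rw [sign_neg (by norm_num), sign_pos (by norm_num)]
      decide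
    -- The constants (1, 2, -1) satisfy -l₁ + l₂ + l₃ = 0, the degenerate product case.
    · refine exists_signature_of_reductive h one_pos two_pos one_pos 0 0
        (hasMatrixSignature_of_roots ![-4, 0, 0, 0] (fun z => ?_) (by decide)
          fun i => ?_)
      · rw [eval_charpoly_reductive, Fin.prod_univ_four]
        simp
        ring
      · fin_cases i <;> simp [signatureItem]

end

/-! ### Bases and traces -/

section

variable {L : Type*} [LieRing L] [LieAlgebra ℝ L]

theorem exists_basis_of_equiv {g : Mubarakzhanov} (φ : L ≃ₗ⁅ℝ⁆ g.Alg) :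
    ∃ u : Module.Basis (Fin 4) ℝ L, HasRelations u g.relations := by
  let b : Module.Basis (Fin 4) ℝ g.Alg := Pi.basisFun ℝ (Fin 4)
  let e : L ≃ₗ[ℝ] g.Alg := φ.toLinearEquiv
  refine ⟨b.map e.symm, ?_⟩
  have hu : ∀ i, φ (b.map e.symm i) = b i := fun i => by
    rw [Module.Basis.map_apply]
    exact e.apply_symm_apply _
  have hcomb : ∀ v : Fin 4 → ℝ, φ (comb (b.map e.symm) v) = (v : g.Alg) := by
    intro v
    have h1 : φ (comb (b.map e.symm) v) = ∑ k, v k • b k := by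
      rw [comb, map_sum]
      simp only [map_smul, hu]
    rw [h1]
    exact b.sum_repr v
  have hlie : ∀ i j : Fin 4, ∀ v : Fin 4 → ℝ,
      g.relations.bracket (Pi.single i 1) (Pi.single j 1) = v →
        ⁅b.map e.symm i, b.map e.symm j⁆ = comb (b.map e.symm) v := by
    intro i j v hv
    apply φ.injective
    refine (LieEquiv.map_lie φ _ _).trans ?_
    refine Eq.trans ?_ (hcomb v).symm
    rw [hu, hu, ← hv]
    have hb : ∀ i, b i = (Pi.single i 1 : Fin 4 → ℝ) := fun i => Pi.basisFun_apply ℝ (Fin 4) i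
    rw [hb, hb]
    rfl
  constructor <;> apply hlie <;> funext k <;> simp [Relations.bracket]

theorem HasRelations.traces {u : Module.Basis (Fin 4) ℝ L} {r : Relations}
    (h : HasRelations u r) (hL : IsUnimodular L) :
    r.b12 1 + r.b13 2 + r.b14 3 = 0 ∧ -r.b12 0 + r.b23 2 + r.b24 3 = 0 ∧
      -r.b13 0 + -r.b23 1 + r.b34 3 = 0 ∧ -r.b14 0 + -r.b24 1 + -r.b34 2 = 0 := by
  have h0 := h.unimodular hL 0
  have h1 := h.unimodular hL 1
  have h2 := h.unimodular hL 2
  have h3 := h.unimodular hL 3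
  simp [Relations.const, Fin.sum_univ_four] at h0 h1 h2 h3
  exact ⟨h0, h1, h2, h3⟩

variable [FiniteDimensional ℝ L]

theorem realizesExactly_abelian {u : Module.Basis (Fin 4) ℝ L}
    (h : HasRelations u (semidirect 0 0 0 0 0 0 0)) : RealizesExactly L {11} := by
  apply realizesExactly_of
  · intro Q
    obtain ⟨X, d, x, y, a, b, c, g, hX, ⟨e1, e2, e3, e4, e5, e6, e7⟩, hQ⟩ :=
      exists_semidirect_frame Q h
    obtain rfl : d = 0 := by simpa using e1
    obtain rfl : c = 0 := by simpa [(hX 2).ne'] using e2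
    obtain rfl : a = 0 := by simpa [(hX 1).ne'] using e3
    obtain rfl : x = 0 := by simpa [(hX 0).ne'] using e4
    obtain rfl : g = 0 := by simpa [(hX 2).ne'] using e5
    obtain rfl : b = 0 := by simpa [(hX 1).ne'] using e6
    obtain rfl : y = 0 := by simpa [(hX 0).ne'] using e7
    exact ⟨10, by decide, (hQ _).2 (signature_semidirect_of_flat (by ring) (by ring)
      (by norm_num [semidirectNorm]))⟩
  · intro k hk
    obtain rfl : k = 10 := by revert hk; revert k; decide
    refine exists_signature_of_semidirect h (triangular 1 1 1 0 0 0) 0 0 0 0 0 0 0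
      (triangular_eq_zero _ _ _ _ _ _) (by simp [triangular]) ?_
      (signature_semidirect_of_flat (by ring) (by ring) (by norm_num [semidirectNorm]))
    constructor <;> simp [triangular]

end

/-! ### The unimodular algebras of the list -/

section

variable {L : Type*} [LieRing L] [LieAlgebra ℝ L] [FiniteDimensional ℝ L]
  {u : Module.Basis (Fin 4) ℝ L}

theorem realizesExactly_of_frame (x : Fin 4 → Fin 4 → ℝ) {r : Relations} {S : Finset ℕ}
    (hS : ∀ f : Module.Basis (Fin 4) ℝ L, HasRelations f r → RealizesExactly L S)
    (hx : (Matrix.of x).det ≠ 0) (h : HasRelations (frame u x) r) : RealizesExactly L S := by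
  obtain ⟨f, hf⟩ := exists_basis_frame u x hx
  exact hS f (by rwa [hf])

theorem realizesExactly_fourA1
    (hu : HasRelations u (Mubarakzhanov.relations .fourA1)) : RealizesExactly L {11} := by
  refine realizesExactly_of_frame (u := u)
    ![![1, 0, 0, 0], ![0, 1, 0, 0], ![0, 0, 1, 0], ![0, 0, 0, 1]]
    (fun f hf => realizesExactly_abelian hf) ?_
    (hu.frame _ ?_ ?_ ?_ ?_ ?_ ?_)
  · simp [Matrix.det_succ_row_zero, Fin.sum_univ_succ, Fin.succAbove]
  all_goals
    funext k
    fin_cases k <;>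
      simp only [Mubarakzhanov.relations, semidirect, Relations.bracket, Fin.sum_univ_four,
        Matrix.cons_val, Pi.add_apply, Pi.smul_apply, Pi.zero_apply,
        smul_eq_mul, Fin.zero_eta, Fin.mk_one, Fin.reduceFinMk, Fin.isValue] <;>
      ring

theorem realizesExactly_A31_A1
    (hu : HasRelations u (Mubarakzhanov.relations .A31_A1)) : RealizesExactly L {5} := by
  refine realizesExactly_of_frame (u := u)
    ![![1, 0, 0, 0], ![0, 1, 0, 0], ![0, 0, 0, 1], ![0, 0, 1, 0]]
    (fun f hf => realizesExactly_rank_one hf) ?_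
    (hu.frame _ ?_ ?_ ?_ ?_ ?_ ?_)
  · simp [Matrix.det_succ_row_zero, Fin.sum_univ_succ, Fin.succAbove]
  all_goals
    funext k
    fin_cases k <;>
      simp only [Mubarakzhanov.relations, e1, semidirect, Relations.bracket, Fin.sum_univ_four,
        Matrix.cons_val, Pi.add_apply, Pi.smul_apply, Pi.zero_apply,
        smul_eq_mul, Fin.zero_eta, Fin.mk_one, Fin.reduceFinMk, Fin.isValue] <;>
      ring

theorem realizesExactly_A34_A1
    (hu : HasRelations u (Mubarakzhanov.relations .A34_A1)) : RealizesExactly L {3, 5, 6, 7} := by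
  refine realizesExactly_of_frame (u := u)
    ![![1, 0, 0, 0], ![0, 1, 0, 0], ![0, 0, 0, 1], ![0, 0, 1, 0]]
    (fun f hf => realizesExactly_diagonal (d := 1) (a := -1) (g := 0) hf (by norm_num)
      (by norm_num) (by norm_num) (by norm_num) (by norm_num)) ?_
    (hu.frame _ ?_ ?_ ?_ ?_ ?_ ?_)
  · simp [Matrix.det_succ_row_zero, Fin.sum_univ_succ, Fin.succAbove]
  all_goals
    funext k
    fin_cases k <;>
      simp only [Mubarakzhanov.relations, e1, e2, semidirect, Relations.bracket, Fin.sum_univ_four,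
        Matrix.cons_val, Pi.add_apply, Pi.neg_apply, Pi.smul_apply, Pi.zero_apply,
        smul_eq_mul, Fin.zero_eta, Fin.mk_one, Fin.reduceFinMk, Fin.isValue] <;>
      ring

theorem realizesExactly_A36_A1
    (hu : HasRelations u (Mubarakzhanov.relations .A36_A1)) : RealizesExactly L {3, 5, 6, 11} := by
  refine realizesExactly_of_frame (u := u)
    ![![0, 0, 0, 1], ![1, 0, 0, 0], ![0, 1, 0, 0], ![0, 0, 1, 0]]
    (fun f hf => realizesExactly_rotation hf) ?_
    (hu.frame _ ?_ ?_ ?_ ?_ ?_ ?_)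
  · simp [Matrix.det_succ_row_zero, Fin.sum_univ_succ, Fin.succAbove]
  all_goals
    funext k
    fin_cases k <;>
      simp only [Mubarakzhanov.relations, e1, e2, semidirect, Relations.bracket, Fin.sum_univ_four,
        Matrix.cons_val, Pi.add_apply, Pi.neg_apply, Pi.smul_apply, Pi.zero_apply,
        smul_eq_mul, Fin.zero_eta, Fin.mk_one, Fin.reduceFinMk, Fin.isValue] <;>
      ring

theorem realizesExactly_A38_A1
    (hu : HasRelations u (Mubarakzhanov.relations .A38_A1)) : RealizesExactly L {3, 5, 6, 7} := by
  refine realizesExactly_of_frame (u := u)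
    ![![1, 0, 0, 0], ![0, 1, 0, 0], ![0, 0, 1, 0], ![0, 0, 0, 1]]
    (fun f hf => realizesExactly_sl2 hf) ?_
    (hu.frame _ ?_ ?_ ?_ ?_ ?_ ?_)
  · simp [Matrix.det_succ_row_zero, Fin.sum_univ_succ, Fin.succAbove]
  all_goals
    funext k
    fin_cases k <;>
      simp only [Mubarakzhanov.relations, e1, e2, e3, reductive, Relations.bracket, Fin.sum_univ_four,
        Matrix.cons_val, Pi.add_apply, Pi.neg_apply, Pi.smul_apply, Pi.zero_apply,
        smul_eq_mul, Fin.zero_eta, Fin.mk_one, Fin.reduceFinMk, Fin.isValue] <;>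
      ring

theorem realizesExactly_A39_A1
    (hu : HasRelations u (Mubarakzhanov.relations .A39_A1)) : RealizesExactly L {3, 5, 6, 8, 9, 10, 12, 14} := by
  refine realizesExactly_of_frame (u := u)
    ![![1, 0, 0, 0], ![0, 1, 0, 0], ![0, 0, 1, 0], ![0, 0, 0, 1]]
    (fun f hf => realizesExactly_su2 hf) ?_
    (hu.frame _ ?_ ?_ ?_ ?_ ?_ ?_)
  · simp [Matrix.det_succ_row_zero, Fin.sum_univ_succ, Fin.succAbove]
  all_goals
    funext k
    fin_cases k <;>
      simp only [Mubarakzhanov.relations, e1, e2, e3, reductive, Relations.bracket, Fin.sum_univ_four,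
        Matrix.cons_val, Pi.add_apply, Pi.neg_apply, Pi.smul_apply, Pi.zero_apply,
        smul_eq_mul, Fin.zero_eta, Fin.mk_one, Fin.reduceFinMk, Fin.isValue] <;>
      ring

theorem realizesExactly_A41
    (hu : HasRelations u (Mubarakzhanov.relations .A41)) : RealizesExactly L {3, 5, 6} := by
  refine realizesExactly_of_frame (u := u)
    ![![1, 0, 0, 0], ![0, 1, 0, 0], ![0, 0, 1, 0], ![0, 0, 0, 1]]
    (fun f hf => realizesExactly_rank_two hf) ?_
    (hu.frame _ ?_ ?_ ?_ ?_ ?_ ?_)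
  · simp [Matrix.det_succ_row_zero, Fin.sum_univ_succ, Fin.succAbove]
  all_goals
    funext k
    fin_cases k <;>
      simp only [Mubarakzhanov.relations, e1, e2, semidirect, Relations.bracket, Fin.sum_univ_four,
        Matrix.cons_val, Pi.add_apply, Pi.smul_apply, Pi.zero_apply,
        smul_eq_mul, Fin.zero_eta, Fin.mk_one, Fin.reduceFinMk, Fin.isValue] <;>
      ring

theorem realizesExactly_A42 {hα : (-2 : ℝ) ≠ 0}
    (hu : HasRelations u (Mubarakzhanov.relations (.A42 (-2) hα))) : RealizesExactly L {3, 5, 6} := by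
  refine realizesExactly_of_frame (u := u)
    -- The Jordan block comes first and the eigenvalue -2 last.
    ![![0, 1, 0, 0], ![0, 0, 1, 0], ![1, 0, 0, 0], ![0, 0, 0, 1]]
    (fun f hf => realizesExactly_jordan hf) ?_
    (hu.frame _ ?_ ?_ ?_ ?_ ?_ ?_)
  · simp [Matrix.det_succ_row_zero, Fin.sum_univ_succ, Fin.succAbove]
  all_goals
    funext k
    fin_cases k <;>
      simp only [Mubarakzhanov.relations, e1, e2, e3, semidirect, Relations.bracket, Fin.sum_univ_four,
        Matrix.cons_val, Pi.add_apply, Pi.smul_apply, Pi.zero_apply,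
        smul_eq_mul, Fin.zero_eta, Fin.mk_one, Fin.reduceFinMk, Fin.isValue] <;>
      ring

/-- The second parameter keeps the form -1 - α that the trace condition gives it. -/
theorem realizesExactly_A45_of_eq {hαβ : (-1 / 2 : ℝ) * (-1 - -1 / 2) ≠ 0}
    {h' : (-1 : ℝ) ≤ -1 / 2 ∧ (-1 / 2 : ℝ) ≤ -1 - -1 / 2 ∧ (-1 - -1 / 2 : ℝ) ≤ 1}
    (hu : HasRelations u (Mubarakzhanov.relations (.A45 (-1 / 2) (-1 - -1 / 2) hαβ h'))) : RealizesExactly L {5, 7} := by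
  refine realizesExactly_of_frame (u := u)
    ![![0, 1, 0, 0], ![0, 0, 1, 0], ![1, 0, 0, 0], ![0, 0, 0, 1]]
    (fun f hf => realizesExactly_double hf) ?_
    (hu.frame _ ?_ ?_ ?_ ?_ ?_ ?_)
  · simp [Matrix.det_succ_row_zero, Fin.sum_univ_succ, Fin.succAbove]
  all_goals
    funext k
    fin_cases k <;>
      simp only [Mubarakzhanov.relations, e1, e2, e3, semidirect, Relations.bracket, Fin.sum_univ_four,
        Matrix.cons_val, Pi.add_apply, Pi.smul_apply, Pi.zero_apply,
        smul_eq_mul, Fin.zero_eta, Fin.mk_one, Fin.reduceFinMk, Fin.isValue] <;>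
      ring

theorem realizesExactly_A45_of_lt {α : ℝ} {hαβ : α * (-1 - α) ≠ 0}
    {h' : -1 ≤ α ∧ α ≤ -1 - α ∧ -1 - α ≤ 1} (hα : α < -1 / 2)
    (hu : HasRelations u (Mubarakzhanov.relations (.A45 α (-1 - α) hαβ h'))) : RealizesExactly L {3, 5, 6, 7} := by
  refine realizesExactly_of_frame (u := u)
    ![![1, 0, 0, 0], ![0, 1, 0, 0], ![0, 0, 1, 0], ![0, 0, 0, 1]]
    (fun f hf => realizesExactly_diagonal (d := 1) (a := α) (g := -1 - α) hf one_ne_zero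
      (by linarith : α < 1).ne' (by linarith : -1 - α < 1).ne'
      (by linarith : α < -1 - α).ne (by ring)) ?_
    (hu.frame _ ?_ ?_ ?_ ?_ ?_ ?_)
  · simp [Matrix.det_succ_row_zero, Fin.sum_univ_succ, Fin.succAbove]
  all_goals
    funext k
    fin_cases k <;>
      simp only [Mubarakzhanov.relations, e1, e2, e3, semidirect, Relations.bracket, Fin.sum_univ_four,
        Matrix.cons_val, Pi.add_apply, Pi.smul_apply, Pi.zero_apply,
        smul_eq_mul, Fin.zero_eta, Fin.mk_one, Fin.reduceFinMk, Fin.isValue] <;>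
      ring

theorem realizesExactly_A46 {β : ℝ} {hα : -2 * β ≠ 0} {hβ : 0 ≤ β}
    (hu : HasRelations u (Mubarakzhanov.relations (.A46 (-2 * β) β hα hβ))) : RealizesExactly L {3, 5, 6, 7} := by
  refine realizesExactly_of_frame (u := u)
    ![![1, 0, 0, 0], ![0, 1, 0, 0], ![0, 0, 1, 0], ![0, 0, 0, 1]]
    (fun f hf => realizesExactly_complex
      (lt_of_le_of_ne hβ fun h => hα (by rw [← h, mul_zero])) hf) ?_
    (hu.frame _ ?_ ?_ ?_ ?_ ?_ ?_)
  · simp [Matrix.det_succ_row_zero, Fin.sum_univ_succ, Fin.succAbove]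
  all_goals
    funext k
    fin_cases k <;>
      simp only [Mubarakzhanov.relations, e1, e2, e3, semidirect, Relations.bracket, Fin.sum_univ_four,
        Matrix.cons_val, Pi.add_apply, Pi.sub_apply, Pi.smul_apply, Pi.zero_apply,
        smul_eq_mul, Fin.zero_eta, Fin.mk_one, Fin.reduceFinMk, Fin.isValue] <;>
      ring

theorem realizesExactly_A48
    (hu : HasRelations u (Mubarakzhanov.relations .A48)) : RealizesExactly L {3, 5, 6} := by
  refine realizesExactly_of_frame (u := u)
    -- The action of e₄ exchanges e₂ + e₃ and e₂ - e₃, whose bracket is -2e₁.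
    ![![-2, 0, 0, 0], ![0, 1, 1, 0], ![0, 1, -1, 0], ![0, 0, 0, 1]]
    (fun f hf => realizesExactly_heisenbergExt (Or.inl rfl) hf) ?_
    (hu.frame _ ?_ ?_ ?_ ?_ ?_ ?_)
  · simp [Matrix.det_succ_row_zero, Fin.sum_univ_succ, Fin.succAbove]
  all_goals
    funext k
    fin_cases k <;>
      simp only [Mubarakzhanov.relations, e1, e2, e3, heisenbergExt, Relations.bracket, Fin.sum_univ_four,
        Matrix.cons_val, Pi.add_apply, Pi.neg_apply, Pi.smul_apply, Pi.zero_apply,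
        smul_eq_mul, Fin.zero_eta, Fin.mk_one, Fin.reduceFinMk, Fin.isValue] <;>
      ring

theorem realizesExactly_A410
    (hu : HasRelations u (Mubarakzhanov.relations .A410)) : RealizesExactly L {3, 5, 6} := by
  refine realizesExactly_of_frame (u := u)
    ![![1, 0, 0, 0], ![0, 1, 0, 0], ![0, 0, 1, 0], ![0, 0, 0, 1]]
    (fun f hf => realizesExactly_heisenbergExt (Or.inr rfl) hf) ?_
    (hu.frame _ ?_ ?_ ?_ ?_ ?_ ?_)
  · simp [Matrix.det_succ_row_zero, Fin.sum_univ_succ, Fin.succAbove]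
  all_goals
    funext k
    fin_cases k <;>
      simp only [Mubarakzhanov.relations, e1, e2, e3, heisenbergExt, Relations.bracket, Fin.sum_univ_four,
        Matrix.cons_val, Pi.add_apply, Pi.neg_apply, Pi.smul_apply, Pi.zero_apply,
        smul_eq_mul, Fin.zero_eta, Fin.mk_one, Fin.reduceFinMk, Fin.isValue] <;>
      ring

end

end RicciSignature

end

/-! ### Case analysis over the list -/

open RicciSignature in
theorem theorem1 (g : Mubarakzhanov) (L : Type*) [LieRing L] [LieAlgebra ℝ L]
    [FiniteDimensional ℝ L] (φ : L ≃ₗ⁅ℝ⁆ g.Alg) (hL : IsUnimodular L) (k : Fin 15) :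
    (∃ Q : InnerProd L, HasSignature Q.ricciOperator (signatureItem k)) ↔
      (k : ℕ) + 1 ∈ plusEntries g := by
  obtain ⟨u, hu⟩ := exists_basis_of_equiv φ
  -- In each row the vanishing traces of the basis vectors hold identically, fix a parameter, or
  -- give a contradiction.
  obtain ⟨h0, h1, h2, h3⟩ := hu.traces hL
  clear φ
  revert k
  change RealizesExactly L _
  cases g with
  | fourA1 => exact realizesExactly_fourA1 hu
  | A31_A1 => exact realizesExactly_A31_A1 hu
  | A34_A1 => exact realizesExactly_A34_A1 hu
  | A36_A1 => exact realizesExactly_A36_A1 hu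
  | A38_A1 => exact realizesExactly_A38_A1 hu
  | A39_A1 => exact realizesExactly_A39_A1 hu
  | A41 => exact realizesExactly_A41 hu
  | A42 α hα =>
    simp [Mubarakzhanov.relations, e1, e2, e3] at h3
    obtain rfl : α = -2 := by linarith
    rw [plusEntries, if_pos rfl]
    exact realizesExactly_A42 hu
  | A45 α β hαβ h' =>
    simp [Mubarakzhanov.relations, e1, e2, e3] at h3
    obtain rfl : β = -1 - α := by linarith
    rw [plusEntries]
    split_ifs with hc hc'
    · obtain ⟨rfl, -⟩ := hc
      exact realizesExactly_A45_of_eq hu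
    · exact realizesExactly_A45_of_lt hc'.2.1 hu
    · exfalso
      -- α = -1 would give β = 0, against αβ ≠ 0; and α ≤ β gives α ≤ -1/2, so the two rows of the
      -- table exhaust the unimodular parameters.
      have hα : α ≠ -1 := by
        rintro rfl
        simp at hαβ
      refine hc' ⟨lt_of_le_of_ne h'.1 hα.symm, lt_of_le_of_ne (by linarith) fun h => hc ⟨h, ?_⟩,
        rfl⟩
      rw [h]
      norm_num
  | A46 α β hα hβ =>
    simp [Mubarakzhanov.relations, e1, e2, e3] at h3
    obtain rfl : α = -2 * β := by linarith
    rw [plusEntries, if_pos rfl]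
    exact realizesExactly_A46 hu
  | A48 => exact realizesExactly_A48 hu
  | A410 => exact realizesExactly_A410 hu
  | A2_2A1 | twoA2 => simp [Mubarakzhanov.relations, e2] at h0
  | A32_A1 | A33_A1 | A412 => norm_num [Mubarakzhanov.relations, e1, e2] at h2
  | A35_A1 α hα =>
    simp [Mubarakzhanov.relations, e1, e2] at h2
    linarith
  | A37_A1 α hα =>
    simp [Mubarakzhanov.relations, e1, e2] at h2
    linarith
  | A43 | A44 | A47 => simp [Mubarakzhanov.relations, e1, e2, e3] at h3 <;> norm_num at h3
  | A49 β hβ =>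
    simp [Mubarakzhanov.relations, e1, e2, e3] at h3
    linarith
  | A411 α hα =>
    simp [Mubarakzhanov.relations, e1, e2, e3] at h3
    linarith
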